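/- Let $\mathcal C$ be a symmetric monoidal category with tensor product $\otimes$, unit object $K$ and symmetry $c$ (constraints are suppressed in the formulas). **Hopf quasigroups.** A Hopf quasigroup in $\mathcal C$ is an object $H$ with a unital, not necessarily associative, product $(\eta_H,\mu_H)$, a coassociative counital coproduct $(\varepsilon_H,\delta_H)$ such that $\varepsilon_H,\delta_H$ are morphisms of unital magmas, and an antipode $\lambda_H:H\to H$ with $$\mu_H(\lambda_H\otimes\mu_H)(\delta_H\otimes H)=\varepsilon_H\otimes H=\mu_H(H\otimes\mu_H)(H\otimes\lambda_H\otimes H)(\delta_H\otimes H),$$ $$\mu_H(\mu_H\otimes H)(H\otimes\lambda_H\otimes H)(H\otimes\delta_H)=H\otimes\varepsilon_H=\mu_H(\mu_H\otimes\lambda_H)(H\otimes\delta_H).$$ A morphism of Hopf quasigroups is a morphism of unital magmas and of comonoids. **Data and hypotheses.** Let $A,H$ be Hopf quasigroups in $\mathcal C$. Let $\tau:A\otimes H\to K$ be a skew pairing: $\tau(\mu_A\otimes H)=(\tau\otimes\tau)(A\otimes c_{A,H}\otimes H)(A\otimes A\otimes\delta_H)$, $\tau(A\otimes\mu_H)=(\tau\otimes\tau)(A\otimes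 c_{A,H}\otimes H)((c_{A,A}\delta_A)\otimes H\otimes H)$, $\tau(A\otimes\eta_H)=\varepsilon_A$, $\tau(\eta_A\otimes H)=\varepsilon_H$. Let $R:K\to H\otimes H$ be a quasitriangular structure on $H$: $(\delta_H\otimes H)R=(H\otimes H\otimes\mu_H)(H\otimes c_{H,H}\otimes H)(R\otimes R)$, $(H\otimes\delta_H)R=(\mu_H\otimes c_{H,H})(H\otimes c_{H,H}\otimes H)(R\otimes R)$, $\mu_{H\otimes H}((c_{H,H}\delta_H)\otimes R)=\mu_{H\otimes H}(R\otimes\delta_H)$, $(\varepsilon_H\otimes H)R=\eta_H=(H\otimes\varepsilon_H)R$. Put $g=(\tau\otimes\mu_H)(A\otimes R\otimes H):A\otimes H\to H$ and assume $$\mu_H(g\otimes H)=g(A\otimes\mu_H),\qquad \mu_H(H\otimes g)=\mu_H(\mu_H\otimes H)\bigl(H\otimes((\tau\otimes H)(A\otimes R))\otimes H\bigr).$$ **Conclusion.** Let $\delta_{A\otimes H}=(A\otimes c_{A,H}\otimes H)(\delta_A\otimes\delta_H)$ and $\tau^{-1}=\tau(\lambda_A\otimes H)$. 1. $\tau^{-1}$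 is the two-sided convolution inverse of $\tau$, and $A\bowtie_\tau H$ is a Hopf quasigroup, where $A\bowtie_\tau H$ is $A\otimes H$ with the tensor product unit, counit and coproduct, product $$(\mu_A\otimes\mu_H)\bigl(A\otimes[(\tau\otimes A\otimes H\otimes\tau^{-1})(A\otimes H\otimes\delta_{A\otimes H})\,\delta_{A\otimes H}\,c_{H,A}]\otimes H\bigr)$$ and antipode $(\tau^{-1}\otimes\lambda_A\otimes\lambda_H\otimes\tau)(A\otimes H\otimes\delta_{A\otimes H})\delta_{A\otimes H}$. 2. Put $$\varphi_A=(\tau\otimes A\otimes\tau^{-1})(A\otimes H\otimes\delta_A\otimes H)\,\delta_{A\otimes H}\,c_{H,A}:H\otimes A\to A,\qquad i=(A\otimes\tau\otimes\lambda_H)(\delta_A\otimes R):A\to A\otimes H,$$ $$\rho_A=(\tau\otimes c_{A,H})(A\otimes c_{A,H}\otimes\mu_H)(\delta_A\otimes(R\,\tau)\otimes\lambda_H)(\delta_A\otimes R):A\to H\otimes A,$$ $$m_A=\mu_A(A\otimes\varphi_A)(i\otimes A),\qquad s_A=(\tau\otimes\varphi_A)(A\otimes R\otimes\lambda_A)\delta_A.$$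 Then $A$ with action $\varphi_A$, coaction $\rho_A$, unit $\eta_A$, product $m_A$, counit $\varepsilon_A$, coproduct $\delta_A$ and antipode $s_A$ is a Hopf quasigroup in ${}^H_H\mathcal{YD}$. This means the following. * $(A,\varphi_A)$ is a left $H$-module ($\varphi_A(\eta_H\otimes A)=id_A$, $\varphi_A(H\otimes\varphi_A)=\varphi_A(\mu_H\otimes A)$), $(A,\rho_A)$ is a left $H$-comodule, and they satisfy the Yetter–Drinfeld conditions, with $r=(\mu_H\otimes A)(H\otimes c_{A,H})$: $r\,((\rho_A\varphi_A)\otimes H)(H\otimes c_{H,A})(\delta_H\otimes A)=(\mu_H\otimes\varphi_A)(H\otimes c_{H,H}\otimes A)(\delta_H\otimes\rho_A)$, $r\,(\rho_A\otimes\mu_H)=r\,(r\otimes H)(\rho_A\otimes H\otimes H)$, $(\mu_H\otimes A)(H\otimes(r(\rho_A\otimes H)))=r\,\bigl([(\mu_H\otimes A)(H\otimes\rho_A)]\otimes H\bigr)$. * $(\eta_A,m_A)$ is a unital magma and $(\varepsilon_A,\delta_A)$ is a comonoid, and $\eta_A,m_A,\varepsilon_A,\delta_A$ are $H$-linear and $H$-colinear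 for the diagonal action and codiagonal coaction. * $\varepsilon_A\eta_A=id_K$, $\varepsilon_Am_A=\varepsilon_A\otimes\varepsilon_A$, $\delta_A\eta_A=\eta_A\otimes\eta_A$ and $\delta_Am_A=(m_A\otimes m_A)(A\otimes t\otimes A)(\delta_A\otimes\delta_A)$, where $t=(\varphi_A\otimes A)(H\otimes c_{A,A})(\rho_A\otimes A)$. (When $\lambda_H$ is an isomorphism, this is the braiding of ${}^H_H\mathcal{YD}$; the identities listed here hold without assuming that.) * $s_A$ satisfies, with $m_A,\varepsilon_A,\delta_A$, the four antipode identities displayed above. 3. The bosonization $A\rtimes H$ is a Hopf quasigroup in $\mathcal C$, where $A\rtimes H$ is $A\otimes H$ with the tensor product unit and counit, product $(m_A\otimes\mu_H)(A\otimes\Psi\otimes H)$, coproduct $(A\otimes\Gamma\otimes H)(\delta_A\otimes\delta_H)$ and antipode $\Psi(\lambda_H\otimes s_A)\Gamma$, with $\Gamma=(\mu_H\otimes A)(H\otimes c_{A,H})(\rho_A\otimes H)$ and $\Psi=(\varphi_A\otimes H)(H\otimes c_{H,A})(\delta_H\otimes A)$. Moreover $$w=(A\otimes\mu_H)(i\otimes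 H):A\rtimes H\to A\bowtie_\tau H$$ is an isomorphism of Hopf quasigroups. -/

import Mathlib

open CategoryTheory MonoidalCategory

universe v u

noncomputable section

namespace HopfQG

variable {C : Type u} [Category.{v} C] [MonoidalCategory C]

/-! ### Unital magmas, comonoids, Hopf quasigroups -/

/-- The structure morphisms of a candidate Hopf quasigroup on the object `X`: unit, product,
counit, coproduct, antipode. The laws are in `IsHopfQuasigroup` (or `IsYDHopfQuasigroup`). -/
structure HopfData (X : C) where
  /-- the unit -/
  one : 𝟙_ C ⟶ X
  /-- the (not necessarily associative) product -/
  mul : X ⊗ X ⟶ X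
  /-- the counit -/
  counit : X ⟶ 𝟙_ C
  /-- the coproduct -/
  comul : X ⟶ X ⊗ X
  /-- the antipode -/
  antipode : X ⟶ X

/-- `(X, one, mul)` is a unital magma. -/
structure IsUnitalMagma {X : C} (D : HopfData X) : Prop where
  one_mul : (D.one ▷ X) ≫ D.mul = (λ_ X).hom
  mul_one : (X ◁ D.one) ≫ D.mul = (ρ_ X).hom

/-- `(X, counit, comul)` is a (coassociative, counital) comonoid. -/
structure IsComonoid {X : C} (D : HopfData X) : Prop where
  counit_comul : D.comul ≫ (D.counit ▷ X) = (λ_ X).inv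
  comul_counit : D.comul ≫ (X ◁ D.counit) = (ρ_ X).inv
  comul_assoc : D.comul ≫ (X ◁ D.comul) = D.comul ≫ (D.comul ▷ X) ≫ (α_ X X X).hom

/-- The four identities that make `antipode` a left and right antipode. In Sweedler notation:
`S(x₁)(x₂y) = ε(x)y = x₁(S(x₂)y)` and `(yS(x₁))x₂ = yε(x) = (yx₁)S(x₂)`. -/
structure HasAntipode {X : C} (D : HopfData X) : Prop where
  left₁ : (D.comul ▷ X) ≫ (α_ X X X).hom ≫ (D.antipode ⊗ₘ D.mul) ≫ D.mul =
    (D.counit ▷ X) ≫ (λ_ X).hom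
  left₂ : (D.comul ▷ X) ≫ (α_ X X X).hom ≫ (X ◁ (D.antipode ▷ X)) ≫ (X ◁ D.mul) ≫ D.mul =
    (D.counit ▷ X) ≫ (λ_ X).hom
  right₁ : (X ◁ D.comul) ≫ (α_ X X X).inv ≫ ((X ◁ D.antipode) ▷ X) ≫ (D.mul ▷ X) ≫ D.mul =
    (X ◁ D.counit) ≫ (ρ_ X).hom
  right₂ : (X ◁ D.comul) ≫ (α_ X X X).inv ≫ (D.mul ⊗ₘ D.antipode) ≫ D.mul =
    (X ◁ D.counit) ≫ (ρ_ X).hom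

variable [BraidedCategory C]

/-- The coproduct of `A ⊗ H`. -/
def tensorComul {A H : C} (𝓐 : HopfData A) (𝓗 : HopfData H) :
    A ⊗ H ⟶ (A ⊗ H) ⊗ (A ⊗ H) :=
  (𝓐.comul ⊗ₘ 𝓗.comul) ≫ tensorμ A A H H

/-- The counit of `A ⊗ H`. -/
def tensorCounit {A H : C} (𝓐 : HopfData A) (𝓗 : HopfData H) : A ⊗ H ⟶ 𝟙_ C :=
  (𝓐.counit ⊗ₘ 𝓗.counit) ≫ (λ_ (𝟙_ C)).hom

/-- The unit of `A ⊗ H`. -/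
def tensorOne {A H : C} (𝓐 : HopfData A) (𝓗 : HopfData H) : 𝟙_ C ⟶ A ⊗ H :=
  (λ_ (𝟙_ C)).inv ≫ (𝓐.one ⊗ₘ 𝓗.one)

/-- The product of `A ⊗ H`. -/
def tensorMul {A H : C} (𝓐 : HopfData A) (𝓗 : HopfData H) :
    (A ⊗ H) ⊗ (A ⊗ H) ⟶ A ⊗ H :=
  tensorμ A H A H ≫ (𝓐.mul ⊗ₘ 𝓗.mul)

/-- Non-associative bimonoid: a unital magma and a comonoid such that counit and coproduct are
morphisms of unital magmas. -/
structure IsNonassocBimonoid {X : C} (D : HopfData X) : Prop where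
  magma : IsUnitalMagma D
  comonoid : IsComonoid D
  one_counit : D.one ≫ D.counit = 𝟙 (𝟙_ C)
  mul_counit : D.mul ≫ D.counit = tensorCounit D D
  one_comul : D.one ≫ D.comul = tensorOne D D
  mul_comul : D.mul ≫ D.comul = tensorComul D D ≫ (D.mul ⊗ₘ D.mul)

/-- Hopf quasigroup in the symmetric (braided) monoidal category `C`. -/
structure IsHopfQuasigroup {X : C} (D : HopfData X) : Prop where
  bimonoid : IsNonassocBimonoid D
  hasAntipode : HasAntipode D

/-- Morphisms of Hopf quasigroups: morphisms of unital magmas and of comonoids. -/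
structure IsHopfQuasigroupHom {X Y : C} (D : HopfData X) (E : HopfData Y) (f : X ⟶ Y) : Prop where
  one : D.one ≫ f = E.one
  mul : D.mul ≫ f = (f ⊗ₘ f) ≫ E.mul
  counit : f ≫ E.counit = D.counit
  comul : f ≫ E.comul = D.comul ≫ (f ⊗ₘ f)

/-! ### Skew pairings, quasitriangular structures and the double cross product `A ⋈_τ H` -/

/-- Skew pairing between `A` and `H`. In Sweedler notation: `τ(ab, h) = τ(a, h₁)τ(b, h₂)`,
`τ(a, hk) = τ(a₂, h)τ(a₁, k)`, `τ(a, 1) = ε(a)`, `τ(1, h) = ε(h)`. -/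
structure IsSkewPairing {A H : C} (𝓐 : HopfData A) (𝓗 : HopfData H) (τ : A ⊗ H ⟶ 𝟙_ C) :
    Prop where
  mul_left : (𝓐.mul ▷ H) ≫ τ =
    ((A ⊗ A) ◁ 𝓗.comul) ≫ tensorμ A A H H ≫ (τ ⊗ₘ τ) ≫ (λ_ (𝟙_ C)).hom
  mul_right : (A ◁ 𝓗.mul) ≫ τ =
    ((𝓐.comul ≫ (β_ A A).hom) ▷ (H ⊗ H)) ≫ tensorμ A A H H ≫ (τ ⊗ₘ τ) ≫ (λ_ (𝟙_ C)).hom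
  one_right : (A ◁ 𝓗.one) ≫ τ = (ρ_ A).hom ≫ 𝓐.counit
  one_left : (𝓐.one ▷ H) ≫ τ = (λ_ H).hom ≫ 𝓗.counit

/-- `τ'` is a two-sided inverse of `τ : A ⊗ H ⟶ 𝟙_ C` for the convolution product. -/
structure IsConvolutionInverse {A H : C} (𝓐 : HopfData A) (𝓗 : HopfData H)
    (τ τ' : A ⊗ H ⟶ 𝟙_ C) : Prop where
  conv_inv : tensorComul 𝓐 𝓗 ≫ (τ ⊗ₘ τ') ≫ (λ_ (𝟙_ C)).hom = tensorCounit 𝓐 𝓗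
  inv_conv : tensorComul 𝓐 𝓗 ≫ (τ' ⊗ₘ τ) ≫ (λ_ (𝟙_ C)).hom = tensorCounit 𝓐 𝓗

/-- The morphism `τ⁻¹ = τ ∘ (S_A ⊗ H)`. -/
def skewPairingInv {A H : C} (𝓐 : HopfData A) (τ : A ⊗ H ⟶ 𝟙_ C) : A ⊗ H ⟶ 𝟙_ C :=
  (𝓐.antipode ▷ H) ≫ τ

/-- `R : 𝟙_ C ⟶ H ⊗ H` is a quasitriangular structure on `H`. With `R = R¹ ⊗ R² = r¹ ⊗ r²`:
`δ(R¹) ⊗ R² = R¹ ⊗ r¹ ⊗ R²r²`, `R¹ ⊗ δ(R²) = R¹r¹ ⊗ r² ⊗ R²`,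
`h₂R¹ ⊗ h₁R² = R¹h₁ ⊗ R²h₂`, `ε(R¹)R² = 1 = R¹ε(R²)`. -/
structure IsQuasitriangular {H : C} (𝓗 : HopfData H) (R : 𝟙_ C ⟶ H ⊗ H) : Prop where
  comul_left : R ≫ (𝓗.comul ▷ H) =
    (λ_ (𝟙_ C)).inv ≫ (R ⊗ₘ R) ≫ tensorμ H H H H ≫ ((H ⊗ H) ◁ 𝓗.mul)
  comul_right : R ≫ (H ◁ 𝓗.comul) =
    (λ_ (𝟙_ C)).inv ≫ (R ⊗ₘ R) ≫ tensorμ H H H H ≫ (𝓗.mul ⊗ₘ (β_ H H).hom)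
  comul_comm : (ρ_ H).inv ≫ ((𝓗.comul ≫ (β_ H H).hom) ⊗ₘ R) ≫ tensorMul 𝓗 𝓗 =
    (λ_ H).inv ≫ (R ⊗ₘ 𝓗.comul) ≫ tensorMul 𝓗 𝓗
  counit_left : R ≫ (𝓗.counit ▷ H) ≫ (λ_ H).hom = 𝓗.one
  counit_right : R ≫ (H ◁ 𝓗.counit) ≫ (ρ_ H).hom = 𝓗.one

/-- The morphism `(τ ⊗ H) ∘ (A ⊗ R) : A ⟶ H`, i.e. `a ↦ τ(a, R¹)R²`. -/
def pairingR {A H : C} (τ : A ⊗ H ⟶ 𝟙_ C) (R : 𝟙_ C ⟶ H ⊗ H) : A ⟶ H :=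
  (ρ_ A).inv ≫ (A ◁ R) ≫ (α_ A H H).inv ≫ (τ ▷ H) ≫ (λ_ H).hom

/-- The morphism `g = (τ ⊗ μ_H) ∘ (A ⊗ R ⊗ H) : A ⊗ H ⟶ H`, i.e. `a ⊗ h ↦ (τ(a, R¹)R²)h`. -/
def projG {A H : C} (𝓗 : HopfData H) (τ : A ⊗ H ⟶ 𝟙_ C) (R : 𝟙_ C ⟶ H ⊗ H) : A ⊗ H ⟶ H :=
  (pairingR τ R ▷ H) ≫ 𝓗.mul

/-- `(φ ⊗ A ⊗ H ⊗ ψ) ∘ (A ⊗ H ⊗ δ_{A⊗H}) ∘ δ_{A⊗H}`, i.e. `x ↦ φ(x₁)x₂ψ(x₃)`. -/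
def sandwich {A H : C} (𝓐 : HopfData A) (𝓗 : HopfData H) (φ ψ : A ⊗ H ⟶ 𝟙_ C) :
    A ⊗ H ⟶ A ⊗ H :=
  tensorComul 𝓐 𝓗 ≫ (φ ⊗ₘ tensorComul 𝓐 𝓗) ≫ (λ_ ((A ⊗ H) ⊗ (A ⊗ H))).hom ≫
    ((A ⊗ H) ◁ ψ) ≫ (ρ_ (A ⊗ H)).hom

/-- `X ⊗ f ⊗ Y`, bracketed as a morphism between tensor products of pairs. -/
def mid (X Y : C) {P Q P' Q' : C} (f : P ⊗ Q ⟶ P' ⊗ Q') :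
    (X ⊗ P) ⊗ (Q ⊗ Y) ⟶ (X ⊗ P') ⊗ (Q' ⊗ Y) :=
  (α_ X P (Q ⊗ Y)).hom ≫ (X ◁ ((α_ P Q Y).inv ≫ (f ▷ Y) ≫ (α_ P' Q' Y).hom)) ≫
    (α_ X P' (Q' ⊗ Y)).inv

/-- The structure of `A ⋈_τ H` on `A ⊗ H`: tensor product unit, counit and coproduct, product
`(a ⊗ h)(b ⊗ k) = τ(b₁, h₁) ab₂ ⊗ h₂k τ⁻¹(b₃, h₃)` and antipode
`a ⊗ h ↦ τ⁻¹(a₁, h₁) S(a₂) ⊗ S(h₂) τ(a₃, h₃)`. -/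
def doubleCross {A H : C} (𝓐 : HopfData A) (𝓗 : HopfData H) (τ : A ⊗ H ⟶ 𝟙_ C) :
    HopfData (A ⊗ H) where
  one := tensorOne 𝓐 𝓗
  mul := mid A H ((β_ H A).hom ≫ sandwich 𝓐 𝓗 τ (skewPairingInv 𝓐 τ)) ≫ (𝓐.mul ⊗ₘ 𝓗.mul)
  counit := tensorCounit 𝓐 𝓗
  comul := tensorComul 𝓐 𝓗
  antipode := sandwich 𝓐 𝓗 (skewPairingInv 𝓐 τ) τ ≫ (𝓐.antipode ⊗ₘ 𝓗.antipode)

/-! ### Left-left Yetter–Drinfeld modules over a Hopf quasigroup -/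

/-- The diagonal action of `H` on `M ⊗ N`. -/
def diagAction {H M N : C} (𝓗 : HopfData H) (φM : H ⊗ M ⟶ M) (φN : H ⊗ N ⟶ N) :
    H ⊗ (M ⊗ N) ⟶ M ⊗ N :=
  (𝓗.comul ▷ (M ⊗ N)) ≫ tensorμ H H M N ≫ (φM ⊗ₘ φN)

/-- The codiagonal coaction of `H` on `M ⊗ N`. -/
def codiagCoaction {H M N : C} (𝓗 : HopfData H) (ρM : M ⟶ H ⊗ M) (ρN : N ⟶ H ⊗ N) :
    M ⊗ N ⟶ H ⊗ (M ⊗ N) :=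
  (ρM ⊗ₘ ρN) ≫ tensorμ H M H N ≫ (𝓗.mul ▷ (M ⊗ N))

/-- Right multiplication on the first factor: `(h ⊗ m) ⊗ k ↦ hk ⊗ m`. -/
def mulPast {H : C} (𝓗 : HopfData H) (M : C) : (H ⊗ M) ⊗ H ⟶ H ⊗ M :=
  (α_ H M H).hom ≫ (H ◁ (β_ M H).hom) ≫ (α_ H H M).inv ≫ (𝓗.mul ▷ M)

/-- `Γ = (μ_H ⊗ M) ∘ (H ⊗ c_{M,H}) ∘ (ρ_M ⊗ H)`, i.e. `m ⊗ h ↦ m₍₋₁₎h ⊗ m₍₀₎`. -/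
def coactMap {H M : C} (𝓗 : HopfData H) (ρM : M ⟶ H ⊗ M) : M ⊗ H ⟶ H ⊗ M :=
  (ρM ▷ H) ≫ mulPast 𝓗 M

/-- `Ψ = (φ_M ⊗ H) ∘ (H ⊗ c_{H,M}) ∘ (δ_H ⊗ M)`, i.e. `h ⊗ m ↦ h₁m ⊗ h₂`. -/
def actMap {H M : C} (𝓗 : HopfData H) (φM : H ⊗ M ⟶ M) : H ⊗ M ⟶ M ⊗ H :=
  (𝓗.comul ▷ M) ≫ (α_ H H M).hom ≫ (H ◁ (β_ H M).hom) ≫ (α_ H M H).inv ≫ (φM ▷ H)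

/-- The braiding of left-left Yetter–Drinfeld modules,
`t = (φ_N ⊗ M) ∘ (H ⊗ c_{M,N}) ∘ (ρ_M ⊗ N)`, i.e. `m ⊗ n ↦ m₍₋₁₎n ⊗ m₍₀₎`. -/
def ydBraiding {H M N : C} (ρM : M ⟶ H ⊗ M) (φN : H ⊗ N ⟶ N) : M ⊗ N ⟶ N ⊗ M :=
  (ρM ▷ N) ≫ (α_ H M N).hom ≫ (H ◁ (β_ M N).hom) ≫ (α_ H N M).inv ≫ (φN ▷ M)

/-- Left-left Yetter–Drinfeld module over the Hopf quasigroup `H`. -/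
structure IsYDModule {H M : C} (𝓗 : HopfData H) (φ : H ⊗ M ⟶ M) (ρ : M ⟶ H ⊗ M) : Prop where
  one_act : (𝓗.one ▷ M) ≫ φ = (λ_ M).hom
  act_act : (H ◁ φ) ≫ φ = (α_ H H M).inv ≫ (𝓗.mul ▷ M) ≫ φ
  counit_coact : ρ ≫ (𝓗.counit ▷ M) = (λ_ M).inv
  coact_coact : ρ ≫ (H ◁ ρ) = ρ ≫ (𝓗.comul ▷ M) ≫ (α_ H H M).hom
  /-- `(h₁m)₍₋₁₎h₂ ⊗ (h₁m)₍₀₎ = h₁m₍₋₁₎ ⊗ h₂m₍₀₎` -/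
  compat : (𝓗.comul ▷ M) ≫ (α_ H H M).hom ≫ (H ◁ (β_ H M).hom) ≫ (α_ H M H).inv ≫
      ((φ ≫ ρ) ▷ H) ≫ mulPast 𝓗 M =
    (𝓗.comul ⊗ₘ ρ) ≫ tensorμ H H H M ≫ (𝓗.mul ⊗ₘ φ)
  /-- `m₍₋₁₎(hk) ⊗ m₍₀₎ = (m₍₋₁₎h)k ⊗ m₍₀₎` -/
  coact_assoc_left : (ρ ⊗ₘ 𝓗.mul) ≫ mulPast 𝓗 M =
    (α_ M H H).inv ≫ ((ρ ▷ H) ▷ H) ≫ (mulPast 𝓗 M ▷ H) ≫ mulPast 𝓗 M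
  /-- `h(m₍₋₁₎k) ⊗ m₍₀₎ = (hm₍₋₁₎)k ⊗ m₍₀₎` -/
  coact_assoc_mid : (H ◁ coactMap 𝓗 ρ) ≫ (α_ H H M).inv ≫ (𝓗.mul ▷ M) =
    (α_ H M H).inv ≫ (((H ◁ ρ) ≫ (α_ H H M).inv ≫ (𝓗.mul ▷ M)) ▷ H) ≫ mulPast 𝓗 M

/-- `(M, φ, ρ)` with the structure morphisms `D` is a Hopf quasigroup in the category of left-left
Yetter–Drinfeld modules over the Hopf quasigroup `H` (with the braiding `ydBraiding`). -/
structure IsYDHopfQuasigroup {H M : C} (𝓗 : HopfData H) (φ : H ⊗ M ⟶ M) (ρ : M ⟶ H ⊗ M)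
    (D : HopfData M) : Prop where
  ydModule : IsYDModule 𝓗 φ ρ
  magma : IsUnitalMagma D
  act_one : (H ◁ D.one) ≫ φ = (𝓗.counit ⊗ₘ D.one) ≫ (λ_ M).hom
  act_mul : diagAction 𝓗 φ φ ≫ D.mul = (H ◁ D.mul) ≫ φ
  coact_one : D.one ≫ ρ = (λ_ (𝟙_ C)).inv ≫ (𝓗.one ⊗ₘ D.one)
  coact_mul : D.mul ≫ ρ = codiagCoaction 𝓗 ρ ρ ≫ (H ◁ D.mul)
  comonoid : IsComonoid D
  act_counit : φ ≫ D.counit = (𝓗.counit ⊗ₘ D.counit) ≫ (λ_ (𝟙_ C)).hom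
  act_comul : φ ≫ D.comul = (H ◁ D.comul) ≫ diagAction 𝓗 φ φ
  coact_counit : ρ ≫ (H ◁ D.counit) = D.counit ≫ 𝓗.one ≫ (ρ_ H).inv
  coact_comul : ρ ≫ (H ◁ D.comul) = D.comul ≫ codiagCoaction 𝓗 ρ ρ
  one_counit : D.one ≫ D.counit = 𝟙 (𝟙_ C)
  mul_counit : D.mul ≫ D.counit = tensorCounit D D
  one_comul : D.one ≫ D.comul = tensorOne D D
  mul_comul : D.mul ≫ D.comul =
    (D.comul ⊗ₘ D.comul) ≫ mid M M (ydBraiding ρ φ) ≫ (D.mul ⊗ₘ D.mul)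
  hasAntipode : HasAntipode D

/-- The bosonization (smash product and smash coproduct) `M ⋊ H` on `M ⊗ H`:
`(m ⊗ h)(n ⊗ k) = m(h₁n) ⊗ h₂k`, `δ(m ⊗ h) = m₁ ⊗ m₂₍₋₁₎h₁ ⊗ m₂₍₀₎ ⊗ h₂`, antipode
`Ψ ∘ (S_H ⊗ S_M) ∘ Γ`. -/
def bosonization {H M : C} (𝓗 : HopfData H) (φ : H ⊗ M ⟶ M) (ρ : M ⟶ H ⊗ M) (D : HopfData M) :
    HopfData (M ⊗ H) where
  one := tensorOne D 𝓗
  mul := mid M H (actMap 𝓗 φ) ≫ (D.mul ⊗ₘ 𝓗.mul)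
  counit := tensorCounit D 𝓗
  comul := (D.comul ⊗ₘ 𝓗.comul) ≫ mid M H (coactMap 𝓗 ρ)
  antipode := coactMap 𝓗 ρ ≫ (𝓗.antipode ⊗ₘ D.antipode) ≫ actMap 𝓗 φ

/-! ### The structure on `A` induced by `τ` and `R` -/

/-- The action `φ_A = (τ ⊗ A ⊗ τ⁻¹) ∘ (A ⊗ H ⊗ δ_A ⊗ H) ∘ δ_{A⊗H} ∘ c_{H,A}`, i.e.
`h ⊗ a ↦ τ(a₁, h₁) a₂ τ⁻¹(a₃, h₂)`. -/
def actionA {A H : C} (𝓐 : HopfData A) (𝓗 : HopfData H) (τ : A ⊗ H ⟶ 𝟙_ C) : H ⊗ A ⟶ A :=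
  (β_ H A).hom ≫ tensorComul 𝓐 𝓗 ≫ (τ ⊗ₘ (𝓐.comul ▷ H)) ≫ (λ_ ((A ⊗ A) ⊗ H)).hom ≫
    (α_ A A H).hom ≫ (A ◁ skewPairingInv 𝓐 τ) ≫ (ρ_ A).hom

/-- The morphism `i = (A ⊗ τ ⊗ S_H) ∘ (δ_A ⊗ R) : A ⟶ A ⊗ H`, i.e.
`a ↦ a₁ ⊗ τ(a₂, R¹)S_H(R²)`. -/
def inclA {A H : C} (𝓐 : HopfData A) (𝓗 : HopfData H) (τ : A ⊗ H ⟶ 𝟙_ C)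
    (R : 𝟙_ C ⟶ H ⊗ H) : A ⟶ A ⊗ H :=
  𝓐.comul ≫ (A ◁ (pairingR τ R ≫ 𝓗.antipode))

/-- The coaction `a ↦ τ(a₁, r¹) r²S_H(R²) τ(a₃, R¹) ⊗ a₂`, i.e.
`(τ ⊗ c_{A,H}) ∘ (A ⊗ c_{A,H} ⊗ μ_H) ∘ (δ_A ⊗ (R ∘ τ) ⊗ S_H) ∘ (δ_A ⊗ R)`. -/
def coactionA {A H : C} (𝓐 : HopfData A) (𝓗 : HopfData H) (τ : A ⊗ H ⟶ 𝟙_ C)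
    (R : 𝟙_ C ⟶ H ⊗ H) : A ⟶ H ⊗ A :=
  inclA 𝓐 𝓗 τ R ≫ (𝓐.comul ▷ H) ≫ ((pairingR τ R ▷ A) ▷ H) ≫ mulPast 𝓗 A

/-- The modified Hopf data on `A`: unit, counit and coproduct are unchanged, the product is
`μ_A ∘ (A ⊗ φ_A) ∘ (i ⊗ A)` and the antipode is `(τ ⊗ φ_A) ∘ (A ⊗ R ⊗ S_A) ∘ δ_A`. -/
def modifiedA {A H : C} (𝓐 : HopfData A) (𝓗 : HopfData H) (τ : A ⊗ H ⟶ 𝟙_ C)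
    (R : 𝟙_ C ⟶ H ⊗ H) : HopfData A where
  one := 𝓐.one
  mul := (inclA 𝓐 𝓗 τ R ▷ A) ≫ (α_ A H A).hom ≫ (A ◁ actionA 𝓐 𝓗 τ) ≫ 𝓐.mul
  counit := 𝓐.counit
  comul := 𝓐.comul
  antipode := 𝓐.comul ≫ (pairingR τ R ⊗ₘ 𝓐.antipode) ≫ actionA 𝓐 𝓗 τ

/-- The morphism `w = (A ⊗ μ_H) ∘ (i ⊗ H) : A ⊗ H ⟶ A ⊗ H`. -/
def isoW {A H : C} (𝓐 : HopfData A) (𝓗 : HopfData H) (τ : A ⊗ H ⟶ 𝟙_ C)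
    (R : 𝟙_ C ⟶ H ⊗ H) : A ⊗ H ⟶ A ⊗ H :=
  (inclA 𝓐 𝓗 τ R ▷ H) ≫ (α_ A H H).hom ≫ (A ◁ 𝓗.mul)

end HopfQG

end

/-! Contracting the first leg of R against τ gives q(a) = τ(a, R¹)R². The axioms for δ(R¹) ⊗ R² and
R¹ ⊗ δ(R²), together with the skew pairing axioms, make q : A → H a morphism of Hopf quasigroups
(`IsHom.of_isInduced`). Contracting h₂R¹ ⊗ h₁R² = R¹h₁ ⊗ R²h₂ gives the exchange law h₁q(a₁)τ(a₂,
h₂) = τ(a₁, h₁)q(a₂)h₂ (`qTwist`). The two hypotheses on g say that q(A) lies in the left and the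
middle nucleus of H. Conceptually, a ⊗ h ↦ q(a)h is then a projection of A ⋈_τ H onto H, and the
theorem is a form of Radford's projection theorem: i(a) = a₁ ⊗ S(q(a₂)) embeds A as the
coinvariants, the modified product is the one for which i is multiplicative (`inclMul`), and w(a ⊗
h) = i(a)h has the inverse a ⊗ h ↦ a₁ ⊗ q(a₂)h.

The proof verifies this by calculations in Sweedler notation. Its ingredients are the antipode
identities, the fact that S reverses products and coproducts (`mulAntipode`, `antComul`), the
convolution inverses of τ, the exchange law with its variants, and nuclearity. The double cross
product and the Yetter–Drinfeld structure are checked identity by identity. The bosonization is not: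
w is shown to be an isomorphism compatible with all structure maps, including the antipodes
(`bosonization_ant_isoW`), and the laws are pulled back along it (`isHopfQuasigroup_of_isIso`).

The calculations are done by reflection. An expression is compiled to a list of boxes connected by
named wires. Coherence for symmetric categories (`Sh.unique`) implies that the list determines the
morphism (`Den.unique`), and the interchange law (`Den.swap`) allows independent boxes to be
reordered. A rule whose two sides denote the same morphism may be applied inside any diagram
(`applyAt_sound`). The proof of an identity is then a script of rewriting steps for each side, run
in the kernel, after which both results are compared up to renaming of wires and exchange of boxes
(`Expr.eval_eq`). -/

set_option linter.unusedSectionVars false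

/-! ### Tensor words and shuffles of named wires -/

namespace Sweedler

noncomputable section

variable {C : Type u} [Category.{v} C] [MonoidalCategory C]

section Swap

variable [BraidedCategory C]

/-- `X ⊗ (Y ⊗ Z) ⟶ Y ⊗ (X ⊗ Z)`. -/
def bswap (X Y Z : C) : X ⊗ (Y ⊗ Z) ⟶ Y ⊗ (X ⊗ Z) :=
  (α_ X Y Z).inv ≫ ((β_ X Y).hom ▷ Z) ≫ (α_ Y X Z).hom

theorem bswap_naturality {X X' Y Y' Z Z' : C} (f : X ⟶ X') (g : Y ⟶ Y') (h : Z ⟶ Z') :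
    (f ⊗ₘ (g ⊗ₘ h)) ≫ bswap X' Y' Z' = bswap X Y Z ≫ (g ⊗ₘ (f ⊗ₘ h)) := by
  simp only [bswap, Category.assoc, associator_inv_naturality_assoc]
  rw [← associator_naturality, ← tensorHom_id, ← tensorHom_id]
  simp only [tensorHom_comp_tensorHom_assoc, Category.comp_id, Category.id_comp,
    BraidedCategory.braiding_naturality]

theorem bswap_natural_right (X Y : C) {Z Z' : C} (h : Z ⟶ Z') :
    X ◁ Y ◁ h ≫ bswap X Y Z' = bswap X Y Z ≫ Y ◁ X ◁ h := by
  simpa using bswap_naturality (𝟙 X) (𝟙 Y) h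

theorem bswap_natural_left {X X' : C} (Y Z : C) (f : X ⟶ X') :
    f ▷ (Y ⊗ Z) ≫ bswap X' Y Z = bswap X Y Z ≫ Y ◁ f ▷ Z := by
  simpa using bswap_naturality f (𝟙 Y) (𝟙 Z)

/-- The braid relation for three factors, whiskered with the spectator `W`; only associators
separate the two forms. -/
theorem bswap_yang_baxter (X Y Z W : C) :
    bswap X Y (Z ⊗ W) ≫ Y ◁ bswap X Z W ≫ bswap Y Z (X ⊗ W) =
      X ◁ bswap Y Z W ≫ bswap X Z (Y ⊗ W) ≫ Z ◁ bswap X Y W := by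
  have h := BraidedCategory.yang_baxter' X Y Z
  have h1 : bswap X Y (Z ⊗ W) ≫ Y ◁ bswap X Z W ≫ bswap Y Z (X ⊗ W) =
     𝟙 (X ⊗ Y ⊗ Z ⊗ W) ⊗≫ (((β_ X Y).hom ▷ Z ⊗≫ Y ◁ (β_ X Z).hom ⊗≫ (β_ Y Z).hom ▷ X) ▷ W) ⊗≫ 𝟙 (Z ⊗ Y ⊗ X ⊗ W) := by
    simp only [bswap]; monoidal
  have h2 : X ◁ bswap Y Z W ≫ bswap X Z (Y ⊗ W) ≫ Z ◁ bswap X Y W =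
     𝟙 _ ⊗≫ ((𝟙 ((X ⊗ Y) ⊗ Z) ⊗≫ (X ◁ (β_ Y Z).hom ⊗≫ (β_ X Z).hom ▷ Y ⊗≫ Z ◁ (β_ X Y).hom) ⊗≫ 𝟙 ((Z ⊗ Y) ⊗ X)) ▷ W) ⊗≫ 𝟙 _ := by
    simp only [bswap]; monoidal
  rw [h1, h2, h]

theorem bswap_tensor_left (X X' Y Z : C) :
    bswap (X ⊗ X') Y Z = (α_ X X' (Y ⊗ Z)).hom ≫ X ◁ bswap X' Y Z ≫ bswap X Y (X' ⊗ Z) ≫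
      Y ◁ (α_ X X' Z).inv := by
  simp only [bswap, BraidedCategory.braiding_tensor_left_hom]; monoidal

theorem bswap_unit_left (Y Z : C) :
    bswap (𝟙_ C) Y Z = (λ_ (Y ⊗ Z)).hom ≫ Y ◁ (λ_ Z).inv := by
  simp only [bswap, braiding_tensorUnit_left]; monoidal

end Swap

variable [SymmetricCategory C]

theorem bswap_symm (X Y Z : C) : bswap X Y Z ≫ bswap Y X Z = 𝟙 _ := by
  simp [bswap, ← comp_whiskerRight_assoc]

/-- Inductive step of `Ex.exchange`: one more wire `Z` stands in front of the two that are pulled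
out. Pulling both past `Z` and then swapping them is one side of Yang–Baxter. -/
theorem bswap_exchange (Z A B : C) {L P Q P' : C} {f : L ⟶ A ⊗ P} {g : P ⟶ B ⊗ Q}
    {d : L ⟶ B ⊗ P'} {d' : P' ⟶ A ⊗ Q} (h : (f ≫ A ◁ g) ≫ bswap A B Q = d ≫ B ◁ d') :
    ((Z ◁ f ≫ bswap Z A P) ≫ A ◁ (Z ◁ g ≫ bswap Z B Q)) ≫ bswap A B (Z ⊗ Q) =
      (Z ◁ d ≫ bswap Z B P') ≫ B ◁ (Z ◁ d' ≫ bswap Z A Q) := by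
  simp only [MonoidalCategory.whiskerLeft_comp, Category.assoc]
  rw [← reassoc_of% (bswap_natural_right Z A), bswap_yang_baxter,
    ← reassoc_of% (bswap_natural_right Z B d')]
  simp only [← MonoidalCategory.whiskerLeft_comp_assoc, ← h, Category.assoc]

theorem bswap_exchange_comp (A B : C) {L P Q P' R : C} {f : L ⟶ A ⊗ P} {g : P ⟶ B ⊗ Q}
    {d : L ⟶ B ⊗ P'} {d' : P' ⟶ A ⊗ Q} (h : (f ≫ A ◁ g) ≫ bswap A B Q = d ≫ B ◁ d')
    (k : Q ⟶ R) :
    (f ≫ A ◁ (g ≫ B ◁ k)) ≫ bswap A B R = d ≫ B ◁ (d' ≫ A ◁ k) := by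
  simp only [Category.assoc, MonoidalCategory.whiskerLeft_comp] at h ⊢
  rw [bswap_natural_right, reassoc_of% h]

/-- The case of `Ex.exchange` in which the second wire is already in front. Moving `A` past `Z` and
back has to be the identity, so a braiding that is not symmetric would not do. -/
theorem bswap_exchange_symm (Z A : C) {L P : C} (f : L ⟶ A ⊗ P) :
    ((Z ◁ f ≫ bswap Z A P) ≫ A ◁ 𝟙 (Z ⊗ P)) ≫ bswap A Z P = 𝟙 (Z ⊗ L) ≫ Z ◁ f := by
  simp [bswap_symm]

theorem comp_whiskerLeft_comp (A : C) {L P Q R : C} (e : L ⟶ A ⊗ P) (g : P ⟶ Q) (f : Q ⟶ R) :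
    e ≫ A ◁ (g ≫ f) = (e ≫ A ◁ g) ≫ A ◁ f := by
  simp

/-- The right-bracketed tensor product of a word. -/
def obj {S : Type} (ob : S → C) : List S → C
  | [] => 𝟙_ C
  | s :: l => ob s ⊗ obj ob l

variable {S : Type} (ob : S → C) (ty : ℕ → S)

/-- Shuffles of named wires: `Sh ob ty l m f` says that `f` is a composite of identities and swaps
that carries the wires `l` to the wires `m`. -/
inductive Sh : List ℕ → List ℕ → ∀ {L M : List S}, (obj ob L ⟶ obj ob M) → Prop
  | refl (l : List ℕ) : Sh l l (𝟙 (obj ob (l.map ty)))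
  | cons (x : ℕ) {l m : List ℕ} {L M : List S} {f : obj ob L ⟶ obj ob M} (h : Sh l m f) :
      Sh (x :: l) (x :: m) (L := ty x :: L) (M := ty x :: M) (ob (ty x) ◁ f)
  | swap (x y : ℕ) (l : List ℕ) :
      Sh (x :: y :: l) (y :: x :: l) (L := ty x :: ty y :: l.map ty)
        (M := ty y :: ty x :: l.map ty) (bswap (ob (ty x)) (ob (ty y)) (obj ob (l.map ty)))
  | trans {l m n : List ℕ} {L M N : List S} {f : obj ob L ⟶ obj ob M} {g : obj ob M ⟶ obj ob N}
      (h : Sh l m f) (k : Sh m n g) : Sh l n (f ≫ g)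

/-- `Ex ob ty x l r f`: the morphism `f` pulls the first wire `x` of `l` to the front, leaving
`r`. -/
inductive Ex : ℕ → List ℕ → List ℕ → ∀ {L : List S} {a : S} {R : List S},
    (obj ob L ⟶ obj ob (a :: R)) → Prop
  | head (x : ℕ) (r : List ℕ) : Ex x (x :: r) r (𝟙 (obj ob (ty x :: r.map ty)))
  | tail (y : ℕ) {x : ℕ} {l r : List ℕ} {L : List S} {a : S} {R : List S}
      {f : obj ob L ⟶ obj ob (a :: R)} (h : Ex x l r f) :
      Ex x (y :: l) (y :: r) (L := ty y :: L) (R := ty y :: R)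
        (ob (ty y) ◁ f ≫ bswap (ob (ty y)) (ob a) (obj ob R))

/-- Shuffles in normal form: the wires are pulled out one after the other. -/
inductive Can : List ℕ → List ℕ → ∀ {L M : List S}, (obj ob L ⟶ obj ob M) → Prop
  | nil : Can [] [] (L := []) (M := []) (𝟙 (𝟙_ C))
  | cons {x : ℕ} {l r t : List ℕ} {L : List S} {a : S} {R T : List S}
      {e : obj ob L ⟶ obj ob (a :: R)} {g : obj ob R ⟶ obj ob T} (h : Ex ob ty x l r e)
      (k : Can r t g) : Can l (x :: t) (M := a :: T) (e ≫ ob a ◁ g)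

variable {ob ty}

theorem Ex.typed {x : ℕ} {l r : List ℕ} {L : List S} {a : S} {R : List S}
    {f : obj ob L ⟶ obj ob (a :: R)} (h : Ex ob ty x l r f) :
    L = l.map ty ∧ a = ty x ∧ R = r.map ty := by
  induction h with
  | head => simp
  | tail y h ih => obtain ⟨rfl, rfl, rfl⟩ := ih; simp

theorem Ex.perm {x : ℕ} {l r : List ℕ} {L : List S} {a : S} {R : List S}
    {f : obj ob L ⟶ obj ob (a :: R)} (h : Ex ob ty x l r f) : l.Perm (x :: r) := by
  induction h with
  | head => exact List.Perm.refl _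
  | tail y h ih => exact (ih.cons y).trans (List.Perm.swap _ _ _)

/-- Distinctness of the names excludes the mixed cases: a wire at the head of the list cannot also
be extracted from the tail. -/
theorem Ex.rest_unique {x : ℕ} {l r r' : List ℕ} {L : List S} {a a' : S} {R R' : List S}
    {f : obj ob L ⟶ obj ob (a :: R)} {f' : obj ob L ⟶ obj ob (a' :: R')}
    (h : Ex ob ty x l r f) (h' : Ex ob ty x l r' f') (hl : l.Nodup) : r = r' := by
  induction h generalizing r' a' R' with
  | head x r =>
    cases h' with
    | head => rfl
    | tail y h' =>
      have := h'.perm.mem_iff (a := x)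
      simp_all
  | tail y h ih =>
    cases h' with
    | head =>
      have := h.perm.mem_iff (a := y)
      simp_all
    | tail _ h' => rw [ih h' (List.nodup_cons.1 hl).2]

theorem Ex.unique {x : ℕ} {l r : List ℕ} {L : List S} {a : S} {R : List S}
    {f f' : obj ob L ⟶ obj ob (a :: R)}
    (h : Ex ob ty x l r f) (h' : Ex ob ty x l r f') (hl : l.Nodup) : f = f' := by
  induction h with
  | head x r =>
    cases h' with
    | head => rfl
    | tail y h' =>
      have := h'.perm.mem_iff (a := x)
      simp_all
  | tail y h ih =>
    cases h' with
    | head =>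
      have := h.perm.mem_iff (a := y)
      simp_all
    | tail _ h' => rw [ih h' (List.nodup_cons.1 hl).2]

theorem Can.unique {l m : List ℕ} {L M : List S} {f f' : obj ob L ⟶ obj ob M}
    (h : Can ob ty l m f) (h' : Can ob ty l m f') (hl : l.Nodup) : f = f' := by
  induction h with
  | nil => cases h'; rfl
  | cons h k ih =>
    cases h' with
    | cons h' k' =>
      obtain rfl := h.rest_unique h' hl
      obtain ⟨-, -, rfl⟩ := h.typed
      obtain ⟨-, -, rfl⟩ := h'.typed
      rw [h.unique h' hl, ih k' (List.nodup_cons.1 (h.perm.nodup_iff.1 hl)).2]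

theorem Can.refl (l : List ℕ) : Can ob ty l l (𝟙 (obj ob (l.map ty))) := by
  induction l with
  | nil => exact Can.nil
  | cons x l ih =>
    have := Can.cons (Ex.head x l) ih
    rw [whiskerLeft_id] at this
    exact (Category.id_comp (𝟙 (obj ob (ty x :: l.map ty)))) ▸ this

/-- Two extractions followed by a swap of the extracted wires are two extractions in the opposite
order. This is how a normal form absorbs a swap. -/
theorem Ex.exchange {x y : ℕ} {l r s : List ℕ} {L : List S} {a b : S} {R Q : List S}
    {e : obj ob L ⟶ obj ob (a :: R)} {e' : obj ob R ⟶ obj ob (b :: Q)}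
    (h : Ex ob ty x l r e) (h' : Ex ob ty y r s e') :
    ∃ (r' : List ℕ) (R' : List S) (d : obj ob L ⟶ obj ob (b :: R'))
      (d' : obj ob R' ⟶ obj ob (a :: Q)), Ex ob ty y l r' d ∧ Ex ob ty x r' s d' ∧
      (e ≫ ob a ◁ e') ≫ bswap (ob a) (ob b) (obj ob Q) = d ≫ ob b ◁ d' := by
  induction h generalizing y s b Q with
  | head x r =>
    obtain ⟨-, -, rfl⟩ := h'.typed
    refine ⟨_, _, _, _, Ex.tail x h', Ex.head x s, ?_⟩
    simp [obj]
  | @tail z x l r L a R f h ih =>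
    cases h' with
    | head =>
      obtain ⟨rfl, rfl, -⟩ := h.typed
      exact ⟨_, _, _, _, Ex.head _ _, h, bswap_exchange_symm _ _ f⟩
    | tail _ h' =>
      obtain ⟨r', R', d, d', k, k', hd⟩ := ih h'
      exact ⟨_, _, _, _, Ex.tail z k, Ex.tail z k', bswap_exchange _ _ _ hd⟩

/-- Normal forms are stable under composition with shuffles. Starting from the identity, every
shuffle has a normal form; as normal forms are unique, coherence follows by a selection sort,
without a presentation of the symmetric group. -/
theorem Sh.can_comp {l m : List ℕ} {L M : List S} {f : obj ob L ⟶ obj ob M}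
    (h : Sh ob ty l m f) : ∀ {k : List ℕ} {K : List S} {g : obj ob K ⟶ obj ob L},
      Can ob ty k l g → Can ob ty k m (g ≫ f) := by
  induction h with
  | refl l => intro k K g hg; rwa [Category.comp_id]
  | cons x h ih =>
    intro k K g hg
    cases hg with
    | cons e c =>
      have := Can.cons e (ih c)
      exact cast (congrArg (Can ob ty _ _) (comp_whiskerLeft_comp _ _ _ _)) this
  | swap x y l =>
    intro k K g hg
    cases hg with
    | cons e c =>
      cases c with
      | cons e' c =>
        obtain ⟨r', R', d, d', k, k', hd⟩ := e.exchange e'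
        have := Can.cons k (Can.cons k' c)
        have eq := bswap_exchange_comp _ _ hd ‹_›
        exact cast (congrArg (Can ob ty _ _) eq.symm) this
  | trans h k ih ih' =>
    intro k K g hg
    rw [← Category.assoc]
    exact ih' (ih hg)

theorem Sh.typed {l m : List ℕ} {L M : List S} {f : obj ob L ⟶ obj ob M}
    (h : Sh ob ty l m f) : L = l.map ty ∧ M = m.map ty := by
  induction h with
  | refl => simp
  | cons x h ih => obtain ⟨rfl, rfl⟩ := ih; simp
  | swap => simp
  | trans h k ih ih' => exact ⟨ih.1, ih'.2⟩

theorem Sh.perm {l m : List ℕ} {L M : List S} {f : obj ob L ⟶ obj ob M}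
    (h : Sh ob ty l m f) : l.Perm m := by
  induction h with
  | refl => exact .refl _
  | cons x h ih => exact ih.cons x
  | swap => exact .swap _ _ _
  | trans h k ih ih' => exact ih.trans ih'

/-- A shuffle of distinct wires is determined by its source and target. -/
theorem Sh.unique {l m : List ℕ} {L M : List S} {f f' : obj ob L ⟶ obj ob M}
    (h : Sh ob ty l m f) (h' : Sh ob ty l m f') (hl : l.Nodup) : f = f' := by
  obtain ⟨rfl, rfl⟩ := h.typed
  have := (h.can_comp (Can.refl l)).unique (h'.can_comp (Can.refl l)) hl
  simpa using this

theorem Sh.exists_of_perm {l m : List ℕ} (h : l.Perm m) :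
    ∃ f : obj ob (l.map ty) ⟶ obj ob (m.map ty), Sh ob ty l m f := by
  induction h with
  | nil => exact ⟨_, Sh.refl []⟩
  | cons x h ih => obtain ⟨f, hf⟩ := ih; exact ⟨_, Sh.cons x hf⟩
  | swap x y l => exact ⟨_, Sh.swap y x l⟩
  | trans h k ih ih' =>
    obtain ⟨f, hf⟩ := ih
    obtain ⟨g, hg⟩ := ih'
    exact ⟨_, Sh.trans hf hg⟩

/-- Names only guide the construction, so the morphism does not change, and `σ` need not be
injective. -/
theorem Sh.rename {l m : List ℕ} {L M : List S} {f : obj ob L ⟶ obj ob M}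
    (h : Sh ob ty l m f) {σ : ℕ → ℕ} (hσ : ∀ x, ty (σ x) = ty x) :
    Sh ob ty (l.map σ) (m.map σ) f := by
  have aux (l : List ℕ) : (l.map σ).map ty = l.map ty := by simp [hσ]
  induction h with
  | refl l =>
    have := Sh.refl (ob := ob) (ty := ty) (l.map σ)
    rwa [aux] at this
  | cons x h ih =>
    have := Sh.cons (σ x) ih
    rwa [hσ] at this
  | swap x y l =>
    have := Sh.swap (ob := ob) (ty := ty) (σ x) (σ y) (l.map σ)
    rwa [aux, hσ, hσ] at this
  | trans h k ih ih' => exact ih.trans ih'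

end

/-! ### Diagrams with named wires -/

/-- The two sorts of wires. -/
inductive Srt
  | A
  | H
  deriving DecidableEq

/-- Bracketed tensor products of sorts. -/
inductive Ob
  | unit
  | atom (s : Srt)
  | ten (X Y : Ob)

/-- `X ⊗ Q` as a word. -/
def Ob.flat : Ob → List Srt → List Srt
  | .unit, Q => Q
  | .atom s, Q => s :: Q
  | .ten X Y, Q => X.flat (Y.flat Q)

/-- The number of tensor factors. -/
def Ob.size : Ob → ℕ
  | .unit => 0
  | .atom _ => 1
  | .ten X Y => X.size + Y.size

theorem Ob.flat_eq (X : Ob) (Q : List Srt) : X.flat Q = X.flat [] ++ Q := by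
  induction X generalizing Q with
  | unit => rfl
  | atom s => rfl
  | ten X Y ih ih' => rw [flat, flat, ih, ih', ih (Y.flat []), List.append_assoc]

theorem Ob.flat_length (X : Ob) : (X.flat []).length = X.size := by
  induction X with
  | unit => rfl
  | atom s => rfl
  | ten X Y ih ih' => rw [flat, flat_eq, List.length_append, ih, ih', size]

/-- The generating morphisms: product, unit, coproduct, counit, antipode of `A` and of `H`, the
pairing `τ : A ⊗ H ⟶ 𝟙_ C`, the morphism `q : A ⟶ H`, and the induced action, product and
antipode. -/
inductive Gen
  | mulA | mulH | oneA | oneH | comulA | comulH | counitA | counitH | antA | antH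
  | tau | q | rmat | act | tmul | tant
  deriving DecidableEq

/-- Equality test for generators. -/
def Gen.beq (g h : Gen) : Bool := Nat.beq g.ctorIdx h.ctorIdx

theorem Gen.eq_of_beq {g h : Gen} (e : g.beq h = true) : g = h := by
  rw [← Gen.ofNat_ctorIdx g, ← Gen.ofNat_ctorIdx h, Nat.eq_of_beq_eq_true e]

/-- The source of a generator. -/
def Gen.dom : Gen → Ob
  | mulA => .ten (.atom .A) (.atom .A)
  | mulH => .ten (.atom .H) (.atom .H)
  | oneA => .unit
  | oneH => .unit
  | comulA => .atom .A
  | comulH => .atom .H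
  | counitA => .atom .A
  | counitH => .atom .H
  | antA => .atom .A
  | antH => .atom .H
  | tau => .ten (.atom .A) (.atom .H)
  | q => .atom .A
  | rmat => .unit
  | act => .ten (.atom .H) (.atom .A)
  | tmul => .ten (.atom .A) (.atom .A)
  | tant => .atom .A

/-- The target of a generator. -/
def Gen.cod : Gen → Ob
  | mulA => .atom .A
  | mulH => .atom .H
  | oneA => .atom .A
  | oneH => .atom .H
  | comulA => .ten (.atom .A) (.atom .A)
  | comulH => .ten (.atom .H) (.atom .H)
  | counitA => .unit
  | counitH => .unit
  | antA => .atom .A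
  | antH => .atom .H
  | tau => .unit
  | q => .atom .H
  | rmat => .ten (.atom .H) (.atom .H)
  | act => .atom .A
  | tmul => .atom .A
  | tant => .atom .A

/-- Names of wires are natural numbers; the even ones have sort `A`, the odd ones sort `H`. -/
def ty (n : ℕ) : Srt :=
  match n % 2 with
  | 0 => .A
  | _ => .H

/-- A generator applied to named wires. -/
structure Box where
  /-- the generator -/
  g : Gen
  /-- the wires it consumes -/
  ins : List ℕ
  /-- the wires it produces -/
  outs : List ℕ

/-- Renaming of wires. -/
def Box.map (σ : ℕ → ℕ) : Box → Box
  | ⟨g, ins, outs⟩ => ⟨g, ins.map σ, outs.map σ⟩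

/-- All wires produced in a diagram. -/
def allOuts (D : List Box) : List ℕ := D.flatMap Box.outs

/-- All wires consumed in a diagram. -/
def allIns (D : List Box) : List ℕ := D.flatMap Box.ins

noncomputable section

variable {C : Type u} [Category.{v} C] [MonoidalCategory C] [SymmetricCategory C]

/-- Interpretation of sorts and generators in `C`. -/
structure Model (C : Type u) [Category.{v} C] [MonoidalCategory C] where
  /-- the objects -/
  ob : Srt → C
  /-- the structure morphisms of `A` and `H` -/
  dat : ∀ s, HopfQG.HopfData (ob s)
  /-- the pairing -/
  tau : ob .A ⊗ ob .H ⟶ 𝟙_ C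
  /-- the morphism from `A` to `H` -/
  q : ob .A ⟶ ob .H
  /-- the candidate for a quasitriangular structure -/
  R : 𝟙_ C ⟶ ob .H ⊗ ob .H

/-- Interpretation of bracketed tensor products. -/
def Ob.ev (ob : Srt → C) : Ob → C
  | .unit => 𝟙_ C
  | .atom s => ob s
  | .ten X Y => X.ev ob ⊗ Y.ev ob

/-- Interpretation of the generators. -/
def Model.hom (M : Model C) : ∀ g : Gen, g.dom.ev M.ob ⟶ g.cod.ev M.ob
  | .mulA => (M.dat .A).mul
  | .mulH => (M.dat .H).mul
  | .oneA => (M.dat .A).one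
  | .oneH => (M.dat .H).one
  | .comulA => (M.dat .A).comul
  | .comulH => (M.dat .H).comul
  | .counitA => (M.dat .A).counit
  | .counitH => (M.dat .H).counit
  | .antA => (M.dat .A).antipode
  | .antH => (M.dat .H).antipode
  | .tau => M.tau
  | .q => M.q
  | .rmat => M.R
  | .act => HopfQG.actionA (M.dat .A) (M.dat .H) M.tau
  | .tmul => (((M.dat .A).comul ≫ (M.ob .A ◁ (M.q ≫ (M.dat .H).antipode))) ▷ M.ob .A) ≫
      (α_ _ _ _).hom ≫ (M.ob .A ◁ HopfQG.actionA (M.dat .A) (M.dat .H) M.tau) ≫ (M.dat .A).mul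
  | .tant => (M.dat .A).comul ≫ (M.q ⊗ₘ (M.dat .A).antipode) ≫
      HopfQG.actionA (M.dat .A) (M.dat .H) M.tau

variable {ob : Srt → C}

/-- `X ⊗ Q` as a word, on objects of `C`. -/
def fl (ob : Srt → C) : ∀ (X : Ob) (Q : List Srt), X.ev ob ⊗ obj ob Q ≅ obj ob (X.flat Q)
  | .unit, Q => λ_ (obj ob Q)
  | .atom s, Q => Iso.refl (ob s ⊗ obj ob Q)
  | .ten X Y, Q => α_ (X.ev ob) (Y.ev ob) (obj ob Q) ≪≫ whiskerLeftIso (X.ev ob) (fl ob Y Q) ≪≫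
      fl ob X (Y.flat Q)

/-- `f ⊗ Q` between words. -/
def lift {X Y : Ob} (f : X.ev ob ⟶ Y.ev ob) (Q : List Srt) :
    obj ob (X.flat Q) ⟶ obj ob (Y.flat Q) :=
  (fl ob X Q).inv ≫ (f ▷ obj ob Q) ≫ (fl ob Y Q).hom

/-- `X ⊗ f` between words. -/
def wl (X : Ob) {Q R : List Srt} (f : obj ob Q ⟶ obj ob R) :
    obj ob (X.flat Q) ⟶ obj ob (X.flat R) :=
  (fl ob X Q).inv ≫ (X.ev ob ◁ f) ≫ (fl ob X R).hom

/-- The swap of `X` and `Y` in front of `Q`, between words. -/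
def bs (ob : Srt → C) (X Y : Ob) (Q : List Srt) :
    obj ob (X.flat (Y.flat Q)) ⟶ obj ob (Y.flat (X.flat Q)) :=
  (fl ob X (Y.flat Q)).inv ≫ (X.ev ob ◁ (fl ob Y Q).inv) ≫
    bswap (X.ev ob) (Y.ev ob) (obj ob Q) ≫ (Y.ev ob ◁ (fl ob X Q).hom) ≫
      (fl ob Y (X.flat Q)).hom

theorem lift_id (X : Ob) (Q : List Srt) : lift (𝟙 (X.ev ob)) Q = 𝟙 _ := by simp [lift]

theorem lift_comp {X Y Z : Ob} (f : X.ev ob ⟶ Y.ev ob) (g : Y.ev ob ⟶ Z.ev ob) (Q : List Srt) :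
    lift (f ≫ g) Q = lift f Q ≫ lift g Q := by simp [lift]

theorem wl_comp (X : Ob) {Q R S : List Srt} (f : obj ob Q ⟶ obj ob R) (g : obj ob R ⟶ obj ob S) :
    wl X (f ≫ g) = wl X f ≫ wl X g := by simp [wl]

theorem wl_id (X : Ob) (Q : List Srt) : wl X (𝟙 (obj ob Q)) = 𝟙 _ := by simp [wl]

theorem lift_wl {X Y : Ob} (f : X.ev ob ⟶ Y.ev ob) {Q R : List Srt} (g : obj ob Q ⟶ obj ob R) :
    lift f Q ≫ wl Y g = wl X g ≫ lift f R := by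
  simp [lift, wl, whisker_exchange_assoc]

theorem bs_symm (X Y : Ob) (Q : List Srt) : bs ob X Y Q ≫ bs ob Y X Q = 𝟙 _ := by
  simp only [bs, Category.assoc, Iso.hom_inv_id_assoc, whiskerLeft_hom_inv_assoc]
  rw [reassoc_of% (bswap_symm (X.ev ob) (Y.ev ob)), whiskerLeft_inv_hom_assoc, Iso.inv_hom_id]

theorem lift_bs {X Y : Ob} (f : X.ev ob ⟶ Y.ev ob) (Z : Ob) (Q : List Srt) :
    lift f (Z.flat Q) ≫ bs ob Y Z Q = bs ob X Z Q ≫ wl Z (lift f Q) := by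
  simp only [lift, bs, wl, Category.assoc, Iso.hom_inv_id_assoc, MonoidalCategory.whiskerLeft_comp,
    whiskerLeft_hom_inv_assoc]
  rw [← reassoc_of% (bswap_natural_left (Z.ev ob)), whisker_exchange_assoc]

theorem wl_unit {Q R : List Srt} (f : obj ob Q ⟶ obj ob R) : wl .unit f = f :=
  (by simp : (λ_ (obj ob Q)).inv ≫ (𝟙_ C ◁ f) ≫ (λ_ (obj ob R)).hom = f)

theorem wl_at (s : Srt) {Q R : List Srt} (f : obj ob Q ⟶ obj ob R) :
    wl (.atom s) f = (ob s ◁ f : obj ob (s :: Q) ⟶ obj ob (s :: R)) :=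
  (by simp : 𝟙 (ob s ⊗ obj ob Q) ≫ (ob s ◁ f) ≫ 𝟙 (ob s ⊗ obj ob R) = ob s ◁ f)

theorem wl_ten (X Y : Ob) {Q R : List Srt} (f : obj ob Q ⟶ obj ob R) :
    wl (.ten X Y) f = wl X (wl Y f) := by
  have h : wl (.ten X Y) f = (((fl ob X _).inv ≫ (X.ev ob ◁ (fl ob Y Q).inv)) ≫
      (α_ _ _ _).inv) ≫ ((X.ev ob ⊗ Y.ev ob) ◁ f) ≫
      ((α_ _ _ _).hom ≫ (X.ev ob ◁ (fl ob Y R).hom) ≫ (fl ob X _).hom) := rfl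
  rw [h]
  simp only [wl, MonoidalCategory.whiskerLeft_comp, tensor_whiskerLeft, Category.assoc,
    Iso.inv_hom_id_assoc]
  rfl

theorem bs_unit_left (Y : Ob) (Q : List Srt) : bs ob .unit Y Q = 𝟙 _ := by
  have : bs ob .unit Y Q = (λ_ _).inv ≫ (𝟙_ C ◁ (fl ob Y Q).inv) ≫
    bswap (𝟙_ C) (Y.ev ob) (obj ob Q) ≫ (Y.ev ob ◁ (λ_ _).hom) ≫ (fl ob Y Q).hom := rfl
  rw [this, bswap_unit_left]
  simp
  rfl

theorem bs_unit_right (X : Ob) (Q : List Srt) : bs ob X .unit Q = 𝟙 _ := by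
  have h := bs_symm (ob := ob) X .unit Q
  rw [bs_unit_left] at h
  exact (Category.comp_id _).symm.trans h

theorem bs_ten_left (X X' Y : Ob) (Q : List Srt) :
    bs ob (.ten X X') Y Q = wl X (bs ob X' Y Q) ≫ bs ob X Y (X'.flat Q) := by
  have h1 : bs ob (.ten X X') Y Q = (((fl ob X _).inv ≫ (X.ev ob ◁ (fl ob X' _).inv)) ≫
    (α_ _ _ _).inv) ≫ ((X.ev ob ⊗ X'.ev ob) ◁ (fl ob Y Q).inv) ≫
    bswap (X.ev ob ⊗ X'.ev ob) (Y.ev ob) (obj ob Q) ≫ (Y.ev ob ◁ ((α_ _ _ _).hom ≫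
      (X.ev ob ◁ (fl ob X' _).hom) ≫ (fl ob X _).hom)) ≫ (fl ob Y _).hom := rfl
  rw [h1, bswap_tensor_left]
  simp only [wl, bs, MonoidalCategory.whiskerLeft_comp, Category.assoc, Iso.hom_inv_id_assoc,
    whiskerLeft_hom_inv_assoc, tensor_whiskerLeft, Iso.inv_hom_id_assoc,
    whiskerLeft_inv_hom_assoc]
  rw [← reassoc_of% (bswap_natural_right (X.ev ob) (Y.ev ob) (fl ob X' Q).hom)]

theorem eq_of_inverses {a b : C} {f f' : a ⟶ b} {g : b ⟶ a} (h : f ≫ g = 𝟙 a)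
    (h' : g ≫ f' = 𝟙 b) : f = f' := by
  rw [← Category.comp_id f, ← h', reassoc_of% h]

/-- Follows from `bs_ten_left` by passing to inverses, which symmetry provides. -/
theorem bs_ten_right (X Y Y' : Ob) (Q : List Srt) :
    bs ob X (.ten Y Y') Q = bs ob X Y (Y'.flat Q) ≫ wl Y (bs ob X Y' Q) := by
  have h := bs_symm (ob := ob) X (.ten Y Y') Q
  rw [bs_ten_left] at h
  have h' : (wl Y (bs ob Y' X Q) ≫ bs ob Y X (Y'.flat Q)) ≫
      (bs ob X Y (Y'.flat Q) ≫ wl Y (bs ob X Y' Q)) = 𝟙 _ := by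
    rw [Category.assoc, reassoc_of% (bs_symm (ob := ob) Y X (Y'.flat Q)), ← wl_comp, bs_symm,
      wl_id]
  exact eq_of_inverses h h'

theorem bs_at_at (s t : Srt) (Q : List Srt) :
    bs ob (.atom s) (.atom t) Q = bswap (ob s) (ob t) (obj ob Q) :=
  (by simp : 𝟙 _ ≫ (ob s ◁ 𝟙 _) ≫ bswap (ob s) (ob t) (obj ob Q) ≫ (ob t ◁ 𝟙 _) ≫ 𝟙 _ = _)

end

/-! ### Denotation of diagrams by morphisms -/

noncomputable section

variable {C : Type u} [Category.{v} C] [MonoidalCategory C] [SymmetricCategory C]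

section Words

variable {ob : Srt → C}

theorem map_ty_ten {X Y : Ob} {ins : List ℕ} (h : ins.map ty = (Ob.ten X Y).flat []) :
    ∃ i j, ins = i ++ j ∧ i.map ty = X.flat [] ∧ j.map ty = Y.flat [] := by
  rw [Ob.flat, Ob.flat_eq, List.map_eq_append_iff] at h
  obtain ⟨i, j, rfl, h1, h2⟩ := h
  exact ⟨i, j, rfl, h1, h2⟩

theorem map_ty_at {s : Srt} {ins : List ℕ} (h : ins.map ty = (Ob.atom s).flat []) :
    ∃ x, ins = [x] ∧ ty x = s := by
  rw [Ob.flat, List.map_eq_singleton_iff] at h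
  exact h

theorem map_ty_append {X : Ob} {ins : List ℕ} (h : ins.map ty = X.flat []) (l : List ℕ) :
    (ins ++ l).map ty = X.flat (l.map ty) := by
  rw [List.map_append, h, ← Ob.flat_eq]

theorem Sh.wl {X : Ob} {ins : List ℕ} (hi : ins.map ty = X.flat []) {l m : List ℕ}
    {L M : List Srt} {f : obj ob L ⟶ obj ob M} (h : Sh ob ty l m f) :
    Sh ob ty (ins ++ l) (ins ++ m) (wl X f) := by
  induction X generalizing ins l m L M with
  | unit =>
    rw [Ob.flat, List.map_eq_nil_iff] at hi
    subst hi
    exact (wl_unit f).symm ▸ h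
  | atom s =>
    obtain ⟨x, rfl, rfl⟩ := map_ty_at hi
    exact (wl_at (ty x) f).symm ▸ Sh.cons x h
  | ten X Y ih ih' =>
    obtain ⟨i, j, rfl, h1, h2⟩ := map_ty_ten hi
    have := ih h1 (ih' h2 h)
    rw [← List.append_assoc, ← List.append_assoc] at this
    exact (wl_ten X Y f).symm ▸ this

/-- The hexagon identities split both blocks until only swaps of adjacent single wires remain. -/
theorem Sh.bs {X Y : Ob} {xs ys : List ℕ} (hx : xs.map ty = X.flat []) (hy : ys.map ty = Y.flat [])
    (l : List ℕ) : Sh ob ty (xs ++ (ys ++ l)) (ys ++ (xs ++ l)) (bs ob X Y (l.map ty)) := by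
  induction X generalizing xs Y ys l with
  | unit =>
    rw [Ob.flat, List.map_eq_nil_iff] at hx
    subst hx
    rw [bs_unit_left]
    have := Sh.refl (ob := ob) (ty := ty) (ys ++ l)
    rwa [map_ty_append hy] at this
  | atom s =>
    induction Y generalizing ys l with
    | unit =>
      rw [Ob.flat, List.map_eq_nil_iff] at hy
      subst hy
      rw [bs_unit_right]
      have := Sh.refl (ob := ob) (ty := ty) (xs ++ l)
      rwa [map_ty_append hx] at this
    | atom t =>
      obtain ⟨x, rfl, rfl⟩ := map_ty_at hx
      obtain ⟨y, rfl, rfl⟩ := map_ty_at hy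
      rw [bs_at_at]
      exact Sh.swap x y l
    | ten Y Y' ih ih' =>
      obtain ⟨i, j, rfl, h1, h2⟩ := map_ty_ten hy
      have k1 := ih h1 (j ++ l)
      have k2 := Sh.wl h1 (ih' h2 l)
      rw [map_ty_append h2] at k1
      have k := k1.trans k2
      rw [← List.append_assoc i j l, ← List.append_assoc i] at k
      exact (bs_ten_right (ob := ob) _ _ _ _).symm ▸ k
  | ten X X' ih ih' =>
    obtain ⟨i, j, rfl, h1, h2⟩ := map_ty_ten hx
    have k1 := ih h1 hy (j ++ l)
    have k2 := Sh.wl h1 (ih' h2 hy l)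
    rw [map_ty_append h2] at k1
    have k := k2.trans k1
    rw [← List.append_assoc, ← List.append_assoc i] at k
    exact (bs_ten_left (ob := ob) _ _ _ _).symm ▸ k

end Words

variable (M : Model C)

/-- `Den M s D t f`: the diagram `D`, with inputs `s` and outputs `t`, denotes the
morphism `f`. -/
inductive Den : List ℕ → List Box → List ℕ → ∀ {S T : List Srt},
    (obj M.ob S ⟶ obj M.ob T) → Prop
  | nil {s t : List ℕ} {S T : List Srt} {f : obj M.ob S ⟶ obj M.ob T} (h : Sh M.ob ty s t f) :
      Den s [] t f
  | cons {s t r ins outs : List ℕ} {g : Gen} {D : List Box} {S T Q : List Srt}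
      {e : obj M.ob S ⟶ obj M.ob (g.dom.flat Q)} {k : obj M.ob (g.cod.flat Q) ⟶ obj M.ob T}
      (hi : ins.map ty = g.dom.flat []) (ho : outs.map ty = g.cod.flat [])
      (h : Sh M.ob ty s (ins ++ r) e) (hk : Den (outs ++ r) D t k) :
      Den s (⟨g, ins, outs⟩ :: D) t (e ≫ lift (M.hom g) Q ≫ k)

variable {M}

theorem Den.typed {s t : List ℕ} {D : List Box} {S T : List Srt} {f : obj M.ob S ⟶ obj M.ob T}
    (h : Den M s D t f) : S = s.map ty ∧ T = t.map ty := by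
  induction h with
  | nil h => exact h.typed
  | cons hi ho h hk ih => exact ⟨h.typed.1, ih.2⟩

theorem rest_typed {s r ins : List ℕ} {X : Ob} {S Q : List Srt}
    {e : obj M.ob S ⟶ obj M.ob (X.flat Q)} (hi : ins.map ty = X.flat [])
    (h : Sh M.ob ty s (ins ++ r) e) : Q = r.map ty := by
  have := h.typed.2
  rw [map_ty_append hi, Ob.flat_eq, Ob.flat_eq X (r.map ty)] at this
  exact List.append_cancel_left this

theorem Den.precomp {s s' t : List ℕ} {D : List Box} {S S' T : List Srt}
    {u : obj M.ob S' ⟶ obj M.ob S} {f : obj M.ob S ⟶ obj M.ob T} (hu : Sh M.ob ty s' s u)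
    (h : Den M s D t f) : Den M s' D t (u ≫ f) := by
  cases h with
  | nil h => exact .nil (hu.trans h)
  | cons hi ho h hk =>
    rw [← Category.assoc]
    exact .cons hi ho (hu.trans h) hk

theorem Den.postcomp {s t t' : List ℕ} {D : List Box} {S T T' : List Srt}
    {f : obj M.ob S ⟶ obj M.ob T} {u : obj M.ob T ⟶ obj M.ob T'} (h : Den M s D t f)
    (hu : Sh M.ob ty t t' u) : Den M s D t' (f ≫ u) := by
  induction h with
  | nil h => exact .nil (h.trans hu)
  | cons hi ho h hk ih =>
    rw [Category.assoc, Category.assoc]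
    exact .cons hi ho h (ih hu)

theorem Den.append {s m t : List ℕ} {D D' : List Box} {S Q T : List Srt}
    {f : obj M.ob S ⟶ obj M.ob Q} {f' : obj M.ob Q ⟶ obj M.ob T} (h : Den M s D m f)
    (h' : Den M m D' t f') : Den M s (D ++ D') t (f ≫ f') := by
  induction h with
  | nil h => exact h'.precomp h
  | cons hi ho h hk ih =>
    rw [Category.assoc, Category.assoc]
    exact .cons hi ho h (ih h')

theorem Den.split {s t : List ℕ} {D D' : List Box} {S T : List Srt}
    {f : obj M.ob S ⟶ obj M.ob T} (h : Den M s (D ++ D') t f) :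
    ∃ (m : List ℕ) (Q : List Srt) (f₁ : obj M.ob S ⟶ obj M.ob Q) (f₂ : obj M.ob Q ⟶ obj M.ob T),
      Den M s D m f₁ ∧ Den M m D' t f₂ ∧ f = f₁ ≫ f₂ := by
  induction D generalizing s S with
  | nil =>
    obtain ⟨rfl, -⟩ := h.typed
    exact ⟨s, _, _, _, .nil (.refl s), h, (Category.id_comp f).symm⟩
  | cons b D ih =>
    cases h with
    | cons hi ho h hk =>
      obtain ⟨m, Q, f₁, f₂, h₁, h₂, rfl⟩ := ih hk
      exact ⟨m, Q, _, f₂, .cons hi ho h h₁, h₂, by simp only [Category.assoc]⟩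

theorem Den.rename {s t : List ℕ} {D : List Box} {S T : List Srt}
    {f : obj M.ob S ⟶ obj M.ob T} (h : Den M s D t f) {σ : ℕ → ℕ} (hσ : ∀ x, ty (σ x) = ty x) :
    Den M (s.map σ) (D.map (Box.map σ)) (t.map σ) f := by
  have aux (l : List ℕ) : (l.map σ).map ty = l.map ty := by simp [hσ]
  induction h with
  | nil h => exact .nil (h.rename hσ)
  | cons hi ho h hk ih =>
    have h' := h.rename hσ
    rw [List.map_append] at h' ih
    exact .cons ((aux _).trans hi) ((aux _).trans ho) h' ih

/-- Every wire is produced at most once. -/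
def WF (s : List ℕ) (D : List Box) : Prop := (s ++ allOuts D).Nodup

theorem WF.tail {s ins outs r : List ℕ} {g : Gen} {D : List Box}
    (h : WF s (⟨g, ins, outs⟩ :: D)) (hs : s.Perm (ins ++ r)) : WF (outs ++ r) D := by
  unfold WF at *
  have : (s ++ allOuts (⟨g, ins, outs⟩ :: D)).Perm (ins ++ ((outs ++ r) ++ allOuts D)) := by
    refine (hs.append_right _).trans ?_
    simp only [allOuts, List.flatMap_cons, List.append_assoc]
    refine List.Perm.append_left _ ?_
    rw [← List.append_assoc, ← List.append_assoc]
    exact List.perm_append_comm.append_right _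
  exact (List.nodup_append.1 (this.nodup_iff.1 h)).2.1

/-- The morphism denoted by a diagram is determined by the diagram. -/
theorem Den.unique {s t : List ℕ} {D : List Box} {S T : List Srt}
    {f f' : obj M.ob S ⟶ obj M.ob T} (h : Den M s D t f) (h' : Den M s D t f') (hw : WF s D) :
    f = f' := by
  induction h with
  | nil h =>
    cases h' with
    | nil h' => exact h.unique h' (List.nodup_append.1 hw).1
  | @cons s t r ins outs g D S T Q e k hi ho h hk ih =>
    cases h' with
    | @cons _ _ r' _ _ _ _ _ _ Q' e' k' hi' ho' h' hk' =>
      obtain rfl := rest_typed hi h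
      obtain rfl := rest_typed hi h'
      -- The two denotations may keep the unused wires in different orders `r` and `r'`. The shuffle
      -- `u` between them slides through the box, and coherence identifies the rearrangements in
      -- front of it.
      obtain ⟨u, hu⟩ := Sh.exists_of_perm (ob := M.ob) (ty := ty)
        ((List.perm_append_left_iff ins).1 (h.perm.symm.trans h'.perm))
      have h1 : e ≫ wl g.dom u = e' :=
        (h.trans (hu.wl hi)).unique h' (List.nodup_append.1 hw).1
      have h2 : k = wl g.cod u ≫ k' := ih (hk'.precomp (hu.wl ho)) (hw.tail h.perm)
      rw [← h1, h2, Category.assoc, ← reassoc_of% (lift_wl (M.hom g) u)]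

/-- Conservation of wires: what is supplied or produced is either consumed or an output. All later
bookkeeping of available wires rests on this count. -/
theorem Den.perm {s t : List ℕ} {D : List Box} {S T : List Srt}
    {f : obj M.ob S ⟶ obj M.ob T} (h : Den M s D t f) :
    (s ++ allOuts D).Perm (t ++ allIns D) := by
  induction h with
  | nil h => simpa [allOuts, allIns] using h.perm
  | @cons s t r ins outs g D S T Q e k hi ho h hk ih =>
    simp only [allOuts, allIns, List.flatMap_cons] at ih ⊢
    have h1 := h.perm
    rw [List.perm_iff_count] at *
    intro a
    have := ih a
    have := h1 a
    simp only [List.count_append] at *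
    omega

/-- The spectator is swapped behind the inputs of each box and back in front of its outputs; by
naturality and symmetry these swaps cancel. -/
theorem Den.frame_cons {s t : List ℕ} {D : List Box} {S T : List Srt}
    {f : obj M.ob S ⟶ obj M.ob T} (x : ℕ) (h : Den M s D t f) :
    Den M (x :: s) D (x :: t) (wl (.atom (ty x)) f) := by
  induction h with
  | nil h => exact .nil (h.wl (X := .atom (ty x)) (ins := [x]) rfl)
  | @cons s t r ins outs g D S T Q e k hi ho h hk ih =>
    obtain rfl := rest_typed hi h
    have h1 := (h.wl (X := .atom (ty x)) (ins := [x]) rfl).trans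
      (Sh.bs (X := .atom (ty x)) (xs := [x]) rfl hi r)
    have h2 := ih.precomp (Sh.bs (Y := .atom (ty x)) (ys := [x]) ho rfl r)
    have h3 := Den.cons (Q := (Ob.atom (ty x)).flat (r.map ty)) hi ho h1 h2
    have : wl (.atom (ty x)) (e ≫ lift (M.hom g) (r.map ty) ≫ k) =
        (wl (.atom (ty x)) e ≫ bs M.ob (.atom (ty x)) g.dom (r.map ty)) ≫
          lift (M.hom g) ((Ob.atom (ty x)).flat (r.map ty)) ≫
            bs M.ob g.cod (.atom (ty x)) (r.map ty) ≫ wl (.atom (ty x)) k := by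
      rw [reassoc_of% (lift_bs (M.hom g) (.atom (ty x)) (r.map ty)), Category.assoc,
        reassoc_of% (bs_symm (ob := M.ob) (.atom (ty x)) g.dom (r.map ty)), wl_comp, wl_comp]
    rw [this]
    exact h3

/-- The point is that both diagrams receive the same `k`, so a rule may be applied to some of the
available wires. -/
theorem Den.frame {s t t' : List ℕ} {D D' : List Box} {S T : List Srt}
    {f : obj M.ob S ⟶ obj M.ob T} (h : Den M s D t f) (h' : Den M s D' t' f) (r : List ℕ) :
    ∃ (Q Q' : List Srt) (k : obj M.ob Q ⟶ obj M.ob Q'),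
      Den M (r ++ s) D (r ++ t) k ∧ Den M (r ++ s) D' (r ++ t') k := by
  induction r with
  | nil => exact ⟨_, _, f, h, h'⟩
  | cons x r ih =>
    obtain ⟨Q, Q', k, hk, hk'⟩ := ih
    exact ⟨_, _, _, hk.frame_cons x, hk'.frame_cons x⟩

theorem Den.cons_congr {b : Box} {D D' : List Box} {t : List ℕ}
    (H : ∀ {s : List ℕ} {S T : List Srt} {f : obj M.ob S ⟶ obj M.ob T}, WF s D →
      Den M s D t f → Den M s D' t f) {s : List ℕ} {S T : List Srt}
    {f : obj M.ob S ⟶ obj M.ob T} (hw : WF s (b :: D)) (h : Den M s (b :: D) t f) :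
    Den M s (b :: D') t f := by
  cases h with
  | cons hi ho h hk => exact .cons hi ho h (H (hw.tail h.perm) hk)

/-! The tests below are defined by recursors, since these are evaluated fast in the kernel. -/

/-- Case distinction. -/
abbrev sel {α : Type} (b : Bool) (x y : α) : α := Bool.rec (motive := fun _ => α) y x b

theorem sel_eq {α : Type} (b : Bool) (x y : α) : sel b x y = if b = true then x else y := by
  cases b <;> rfl

/-- Conjunction. -/
abbrev both (b c : Bool) : Bool := Bool.rec (motive := fun _ => Bool) false c b

theorem both_eq_true {b c : Bool} : both b c = true ↔ b = true ∧ c = true := by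
  cases b <;> simp [both]

/-- Membership test for wires. -/
def mem (x : ℕ) (l : List ℕ) : Bool :=
  List.rec false (fun y _ ih => sel (Nat.beq x y) true ih) l

theorem mem_iff {x : ℕ} {l : List ℕ} : mem x l = true ↔ x ∈ l := by
  induction l with
  | nil => simp [mem]
  | cons y l ih =>
    change sel (Nat.beq x y) true (mem x l) = true ↔ _
    simp [sel_eq, ih]

/-- Disjointness test. -/
def disj (l m : List ℕ) : Bool := List.rec true (fun x _ ih => sel (mem x m) false ih) l

theorem disj_iff {l m : List ℕ} : disj l m = true ↔ ∀ x ∈ l, x ∉ m := by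
  induction l with
  | nil => simp [disj]
  | cons x l ih =>
    change sel (mem x m) false (disj l m) = true ↔ _
    simp [sel_eq, ih, ← mem_iff]

/-- Whether all elements of the first list are elements of the second. -/
def subset (l m : List ℕ) : Bool := List.rec true (fun x _ ih => sel (mem x m) ih false) l

theorem subset_iff {l m : List ℕ} : subset l m = true ↔ ∀ x ∈ l, x ∈ m := by
  induction l with
  | nil => simp [subset]
  | cons x l ih =>
    change sel (mem x m) (subset l m) false = true ↔ _
    simp [sel_eq, ih, ← mem_iff]

/-- The box `q` does not consume an output of `p`. -/
def indep (p q : Box) : Bool := disj p.outs q.ins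

/-- The interchange law. As `q` uses no output of `p`, its inputs are present before `p`; what is
left, `s₃`, consists of spectators for both boxes. -/
theorem Den.swap {s t : List ℕ} {p q : Box} {D : List Box} {S T : List Srt}
    {f : obj M.ob S ⟶ obj M.ob T} (hpq : indep p q = true) (hw : WF s (p :: q :: D))
    (h : Den M s (p :: q :: D) t f) : Den M s (q :: p :: D) t f := by
  have hpq' : ∀ x ∈ p.outs, x ∉ q.ins := by
    exact disj_iff.1 hpq
  cases h with
  | @cons _ _ s₁ ins outs g _ _ _ Q e k hi ho h hk =>
    have hw1 := hw.tail h.perm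
    cases hk with
    | @cons _ _ s₂ ins' outs' g' _ _ _ Q' e' k' hi' ho' h' hk' =>
      obtain rfl := rest_typed hi h
      have hn : (outs ++ s₁).Nodup := (List.nodup_append.1 hw1).1
      have hsub : ∀ x ∈ ins', x ∈ s₁ := by
        intro x hx
        have : x ∈ outs ++ s₁ := h'.perm.mem_iff.2 (List.mem_append_left _ hx)
        rcases List.mem_append.1 this with h0 | h0
        · exact absurd hx (hpq' x h0)
        · exact h0
      have hni : ins'.Nodup := (List.nodup_append.1 (h'.perm.nodup_iff.1 hn)).1
      obtain ⟨l, hl, hl'⟩ := List.subperm_of_subset hni hsub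
      obtain ⟨s₃, hs⟩ := hl'.exists_perm_append
      have hs₃ : s₁.Perm (ins' ++ s₃) := hs.trans (hl.append_right _)
      obtain ⟨v, hv⟩ := Sh.exists_of_perm (ob := M.ob) (ty := ty) hs₃
      have hs₂ : (outs ++ s₃).Perm s₂ := by
        have h1 := h'.perm
        rw [List.perm_iff_count] at h1 hs₃ ⊢
        intro a
        have := h1 a
        have := hs₃ a
        simp only [List.count_append] at *
        omega
      obtain ⟨u, hu⟩ := Sh.exists_of_perm (ob := M.ob) (ty := ty) hs₂
      obtain rfl := rest_typed hi' h'
      revert v u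
      rw [map_ty_append hi', map_ty_append ho]
      intro v hv u hu
      have he' : wl g.cod v ≫ bs M.ob g.cod g'.dom (s₃.map ty) ≫ wl g'.dom u = e' :=
        ((hv.wl ho).trans ((Sh.bs ho hi' s₃).trans (hu.wl hi'))).unique h' hn
      have k1 := hk'.precomp ((Sh.bs ho ho' s₃).trans (hu.wl ho'))
      have k2 := Den.cons (Q := g'.cod.flat (s₃.map ty)) hi ho (Sh.bs ho' hi s₃) k1
      have k3 := Den.cons (Q := g.dom.flat (s₃.map ty)) hi' ho'
        (h.trans ((hv.wl hi).trans (Sh.bs hi hi' s₃))) k2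
      convert k3 using 1
      rw [← he']
      simp only [Category.assoc]
      rw [reassoc_of% (lift_bs (M.hom g) g'.cod (s₃.map ty)),
        reassoc_of% (bs_symm (ob := M.ob) g'.cod g.dom (s₃.map ty)),
        reassoc_of% (lift_wl (M.hom g') (lift (M.hom g) (s₃.map ty))),
        ← reassoc_of% (lift_bs (M.hom g) g'.dom (s₃.map ty)),
        ← reassoc_of% (lift_wl (M.hom g) v), ← reassoc_of% (lift_wl (M.hom g') u)]

end

/-! ### A verified rewriting engine -/

noncomputable section

/-- Equality test for lists of wires. -/
def leq (l : List ℕ) : List ℕ → Bool :=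
  List.rec (fun m => List.rec true (fun _ _ _ => false) m)
    (fun x _ ih m => List.rec false (fun y m _ => sel (Nat.beq x y) (ih m) false) m) l

theorem eq_of_leq {l m : List ℕ} (h : leq l m = true) : l = m := by
  induction l generalizing m with
  | nil =>
    cases m with
    | nil => rfl
    | cons y m => cases h
  | cons x l ih =>
    cases m with
    | nil => cases h
    | cons y m =>
      change sel (Nat.beq x y) (leq l m) false = true at h
      simp only [sel_eq, Bool.if_false_right, Bool.and_eq_true, decide_eq_true_eq] at h
      rw [Nat.eq_of_beq_eq_true h.1, ih h.2]

/-- Test for the absence of repetitions. -/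
def nodup (l : List ℕ) : Bool := List.rec true (fun x l ih => sel (mem x l) false ih) l

theorem nodup_iff {l : List ℕ} : nodup l = true ↔ l.Nodup := by
  induction l with
  | nil => simp [nodup]
  | cons x l ih =>
    change sel (mem x l) false (nodup l) = true ↔ _
    simp [sel_eq, ih, ← mem_iff]

/-- Equality test for boxes. -/
def Box.beq (b c : Box) : Bool :=
  both (b.g.beq c.g) (both (leq b.ins c.ins) (leq b.outs c.outs))

theorem Box.eq_of_beq {b c : Box} (h : b.beq c = true) : b = c := by
  simp only [Box.beq, both_eq_true] at h
  obtain ⟨h1, h2, h3⟩ := h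
  have := Gen.eq_of_beq h1
  have := eq_of_leq h2
  have := eq_of_leq h3
  cases b; cases c
  simp_all

/-- Remove the box `q` from a diagram, provided it can be moved to the front, and pass the result
to a continuation. -/
def pull (q : Box) (D : List Box) : (List Box → Bool) → Bool :=
  List.rec (fun _ => false)
    (fun p D ih k => sel (p.beq q) (k D) (sel (indep p q) (ih fun D => k (p :: D)) false)) D

/-- Equality test for diagrams modulo exchange of independent boxes. -/
def eqv (X : List Box) : List Box → Bool :=
  List.rec (fun D => List.rec true (fun _ _ _ => false) D) (fun q _ ih D => pull q D ih) X

/-- `D'` arises from `D` by moving the box `q` to the front and removing it. -/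
inductive Pulled (q : Box) : List Box → List Box → Prop
  | here (D : List Box) : Pulled q (q :: D) D
  | there {p : Box} {D D' : List Box} (hp : indep p q = true) (h : Pulled q D D') :
    Pulled q (p :: D) (p :: D')

theorem pulled_of_pull {q : Box} {D : List Box} {k : List Box → Bool} (h : pull q D k = true) :
    ∃ D', Pulled q D D' ∧ k D' = true := by
  induction D generalizing k with
  | nil => cases h
  | cons p D ih =>
    change sel (p.beq q) (k D) (sel (indep p q) (pull q D fun D => k (p :: D)) false) = true at h
    simp only [sel_eq] at h
    split_ifs at h with h1 h2
    · exact ⟨D, Box.eq_of_beq h1 ▸ .here D, h⟩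
    · obtain ⟨D', hD, hk⟩ := ih h
      exact ⟨_, .there h2 hD, hk⟩

theorem Pulled.perm {q : Box} {D D' : List Box} (h : Pulled q D D') : D.Perm (q :: D') := by
  induction h with
  | here D => rfl
  | there _ _ ih => exact (ih.cons _).trans (.swap _ _ _)

theorem eqv_nil {D : List Box} (h : eqv [] D = true) : D = [] := by
  cases D with
  | nil => rfl
  | cons => cases h

theorem eqv_perm {D X : List Box} (h : eqv X D = true) : D.Perm X := by
  induction X generalizing D with
  | nil => rw [eqv_nil h]
  | cons q X ih =>
    obtain ⟨D', hD, hk⟩ := pulled_of_pull (k := eqv X) h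
    exact hD.perm.trans ((ih hk).cons q)

theorem WF.of_perm {s : List ℕ} {D X : List Box} (h : D.Perm X) (hw : WF s D) : WF s X :=
  ((h.flatMap_right _).append_left s).nodup_iff.1 hw

section

variable {C : Type u} [Category.{v} C] [MonoidalCategory C] [SymmetricCategory C] {M : Model C}

theorem Den.pulled {q : Box} {D D' : List Box} (h : Pulled q D D') {s t : List ℕ}
    {S T : List Srt} {f : obj M.ob S ⟶ obj M.ob T} (hw : WF s D) (hD : Den M s D t f) :
    Den M s (q :: D') t f := by
  induction h generalizing s S T with
  | here => exact hD
  | there hp h ih =>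
    exact (hD.cons_congr (fun hw h => ih hw h) hw).swap hp (hw.of_perm (h.perm.cons _))

/-- The boxes of `X` are moved to the front one after the other, each passing only boxes on which it
does not depend. -/
theorem Den.eqv {D X : List Box} (h : eqv X D = true) {s t : List ℕ} {S T : List Srt}
    {f : obj M.ob S ⟶ obj M.ob T} (hw : WF s D) (hD : Den M s D t f) : Den M s X t f := by
  induction X generalizing D s S T with
  | nil => rwa [← eqv_nil h]
  | cons q X ih =>
    obtain ⟨D', hq, hk⟩ := pulled_of_pull (k := Sweedler.eqv X) h
    exact Den.cons_congr (fun hw hd => ih hk hw hd) (hw.of_perm hq.perm) (hD.pulled hq hw)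

end

/-- Substitutions of wires for wires. -/
abbrev Subst := List (ℕ × ℕ)

/-- Look up a wire. -/
def Subst.find (σ : Subst) (x : ℕ) : Option ℕ :=
  List.rec none (fun p _ ih => sel (Nat.beq x p.1) (some p.2) ih) σ

/-- Apply a substitution; wires outside of its domain are fixed. -/
def Subst.app (σ : Subst) (x : ℕ) : ℕ :=
  List.rec x (fun p _ ih => sel (Nat.beq x p.1) p.2 ih) σ

/-- The substitution preserves sorts. -/
def Subst.ok (σ : Subst) : Bool :=
  List.rec true (fun p _ ih => sel (Nat.beq (Nat.mod p.1 2) (Nat.mod p.2 2)) ih false) σ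

theorem Subst.app_cons (p : ℕ × ℕ) (σ : Subst) (x : ℕ) :
    Subst.app (p :: σ) x = if x = p.1 then p.2 else Subst.app σ x := by
  change sel (Nat.beq x p.1) p.2 (Subst.app σ x) = _
  simp [sel_eq]

theorem Subst.ty_app {σ : Subst} (h : σ.ok = true) (x : ℕ) : ty (σ.app x) = ty x := by
  induction σ with
  | nil => rfl
  | cons p σ ih =>
    change sel (Nat.beq (p.1 % 2) (p.2 % 2)) (Subst.ok σ) false = true at h
    simp only [sel_eq, Bool.if_false_right, Bool.and_eq_true, decide_eq_true_eq] at h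
    rw [app_cons]
    split_ifs with h1
    · subst h1
      have := Nat.eq_of_beq_eq_true h.1
      simp [ty, this]
    · exact ih h.2

theorem Subst.app_zip {l m : List ℕ} {x : ℕ} (h : x ∉ l) : Subst.app (l.zip m) x = x := by
  induction l generalizing m with
  | nil => rfl
  | cons y l ih =>
    cases m with
    | nil => rfl
    | cons z m =>
      simp only [List.mem_cons, not_or] at h
      rw [List.zip_cons_cons, app_cons, if_neg h.1, ih h.2]

/-- A rewrite rule: with inputs `xs`, the diagram `L` with outputs `ysL` may be replaced by the
diagram `R` with outputs `ysR`. -/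
structure Rule where
  /-- inputs -/
  xs : List ℕ
  /-- left-hand side -/
  L : List Box
  /-- outputs of the left-hand side -/
  ysL : List ℕ
  /-- right-hand side -/
  R : List Box
  /-- outputs of the right-hand side -/
  ysR : List ℕ

/-- The reversed rule. -/
def Rule.rev (r : Rule) : Rule := ⟨r.xs, r.R, r.ysR, r.L, r.ysL⟩

/-- A diagram with its outputs, and a bound for the names used so far. -/
structure State where
  /-- the boxes -/
  D : List Box
  /-- the outputs -/
  t : List ℕ
  /-- names below `2 * n` are in use -/
  n : ℕ

/-- Fast evaluation of `List.map`. -/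
def fmap {α β : Type} (f : α → β) (l : List α) : List β := List.rec [] (fun x _ ih => f x :: ih) l

/-- Fast evaluation of `++`. -/
def fapp {α : Type} (l m : List α) : List α := List.rec m (fun x _ ih => x :: ih) l

/-- Fast evaluation of `List.zip`. -/
def fzip (l : List ℕ) : List ℕ → Subst :=
  List.rec (fun _ => []) (fun x _ ih m => List.rec [] (fun y m _ => (x, y) :: ih m) m) l

/-- Fast evaluation of `allOuts`. -/
def fouts (D : List Box) : List ℕ := List.rec [] (fun b _ ih => fapp b.outs ih) D

/-- Fast evaluation of `allIns`. -/
def fins (D : List Box) : List ℕ := List.rec [] (fun b _ ih => fapp b.ins ih) D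

/-- Fast evaluation of `Box.map`. -/
def Box.fmap (σ : ℕ → ℕ) (b : Box) : Box := ⟨b.g, Sweedler.fmap σ b.ins, Sweedler.fmap σ b.outs⟩

theorem fmap_eq {α β : Type} : @fmap α β = List.map := by
  funext f l
  induction l with
  | nil => rfl
  | cons x l ih => exact congrArg (f x :: ·) ih

theorem fapp_eq {α : Type} (l m : List α) : fapp l m = l ++ m := by
  induction l with
  | nil => rfl
  | cons x l ih => exact congrArg (x :: ·) ih

theorem fzip_eq (l m : List ℕ) : fzip l m = l.zip m := by
  induction l generalizing m with
  | nil => rfl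
  | cons x l ih =>
    cases m with
    | nil => rfl
    | cons y m => exact congrArg ((x, y) :: ·) (ih m)

theorem fouts_eq (D : List Box) : fouts D = allOuts D := by
  induction D with
  | nil => rfl
  | cons b D ih => exact (fapp_eq _ _).trans (congrArg (b.outs ++ ·) ih)

theorem fins_eq (D : List Box) : fins D = allIns D := by
  induction D with
  | nil => rfl
  | cons b D ih => exact (fapp_eq _ _).trans (congrArg (b.ins ++ ·) ih)

theorem Box.fmap_eq : Box.fmap = Box.map := by
  funext σ ⟨g, i, o⟩
  simp [fmap, map, Sweedler.fmap_eq]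

/-! Continuations that receive fully evaluated data. -/

/-- Evaluate a number. -/
def forceNat {α : Type} (n : ℕ) (k : ℕ → α) : α :=
  Nat.rec (motive := fun _ => α) (k 0) (fun n _ => k (Nat.succ n)) n

/-- Evaluate a list of numbers. -/
def forceList {α : Type} (l : List ℕ) : (List ℕ → α) → α :=
  List.rec (motive := fun _ => (List ℕ → α) → α) (fun k => k [])
    (fun x _ ih k => forceNat x fun x => ih fun l => k (x :: l)) l

/-- Evaluate a box. -/
def forceBox {α : Type} (b : Box) (k : Box → α) : α :=
  Box.rec (motive := fun _ => α)
    (fun g i o => forceList i fun i => forceList o fun o => k ⟨g, i, o⟩) b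

/-- Evaluate a diagram. -/
def forceBoxes {α : Type} (D : List Box) : (List Box → α) → α :=
  List.rec (motive := fun _ => (List Box → α) → α) (fun k => k [])
    (fun b _ ih k => forceBox b fun b => ih fun D => k (b :: D)) D

/-- Evaluate a rule. -/
def Rule.force {α : Type} (r : Rule) (k : Rule → α) : α :=
  Rule.rec (motive := fun _ => α) (fun xs L ysL R ysR =>
    forceList xs fun xs => forceBoxes L fun L => forceList ysL fun ysL => forceBoxes R fun R =>
      forceList ysR fun ysR => k ⟨xs, L, ysL, R, ysR⟩) r

/-- Evaluate a state. -/
def State.force {α : Type} (st : State) (k : State → α) : α :=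
  State.rec (motive := fun _ => α) (fun D t n =>
    forceBoxes D fun D => forceList t fun t => forceNat n fun n => k ⟨D, t, n⟩) st

@[simp] theorem forceNat_eq {α : Type} (n : ℕ) (k : ℕ → α) : forceNat n k = k n := by
  cases n <;> rfl

@[simp] theorem forceList_eq {α : Type} (l : List ℕ) (k : List ℕ → α) : forceList l k = k l := by
  induction l generalizing k with
  | nil => rfl
  | cons x l ih => exact (forceNat_eq x fun x => forceList l fun l => k (x :: l)).trans (ih _)

@[simp] theorem forceBox_eq {α : Type} (b : Box) (k : Box → α) : forceBox b k = k b := by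
  simp [forceBox]

@[simp] theorem forceBoxes_eq {α : Type} (D : List Box) (k : List Box → α) :
    forceBoxes D k = k D := by
  induction D generalizing k with
  | nil => rfl
  | cons b D ih => exact (forceBox_eq b fun b => forceBoxes D fun D => k (b :: D)).trans (ih _)

@[simp] theorem Rule.force_eq {α : Type} (r : Rule) (k : Rule → α) : r.force k = k r := by
  simp [force]

@[simp] theorem State.force_eq {α : Type} (st : State) (k : State → α) : st.force k = k st := by
  simp [force]

/-- The conditions for replacing the left-hand side of `r` in the diagram `B ++ L ++ A` by its
right-hand side. -/
def applicable (s : List ℕ) (r : Rule) (B A : List Box) (θ : Subst) (st : State) : Bool :=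
  both θ.ok <| both (eqv (fapp B (fapp r.L A)) st.D) <| both (nodup r.xs) <|
    both (disj r.xs (fins B)) <| both (subset r.xs (fapp s (fouts B))) <|
    both (nodup (fouts r.R)) <| both (disj (fouts r.R) (fapp s (fapp (fouts B) (fouts A)))) <|
    leq (fmap θ.app r.ysL) r.ysR

/-- Replace the left-hand side of `r` in the diagram `B ++ L ++ A` by its right-hand side. -/
def applyAt (s : List ℕ) (r : Rule) (B A : List Box) (n : ℕ) (st : State) : Option State :=
  let θ : Subst := fzip r.ysL r.ysR
  sel (applicable s r B A θ st)
    (some ⟨fapp B (fapp r.R (fmap (Box.fmap θ.app) A)), fmap θ.app st.t, n⟩) none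

/-- Substitution in a rule. -/
def Rule.map (σ : ℕ → ℕ) (r : Rule) : Rule :=
  ⟨fmap σ r.xs, fmap (Box.fmap σ) r.L, fmap σ r.ysL, fmap (Box.fmap σ) r.R, fmap σ r.ysR⟩

theorem allOuts_append (D D' : List Box) : allOuts (D ++ D') = allOuts D ++ allOuts D' := by
  simp [allOuts]

theorem allOuts_map (D : List Box) (σ : ℕ → ℕ) :
    allOuts (D.map (Box.map σ)) = (allOuts D).map σ := by
  induction D with
  | nil => rfl
  | cons b D ih => simp_all [allOuts, Box.map]

section

variable {C : Type u} [Category.{v} C] [MonoidalCategory C] [SymmetricCategory C] {M : Model C}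

/-- Both sides of the rule denote the same morphism. -/
def Rule.Valid (M : Model C) (r : Rule) : Prop :=
  ∃ (S T : List Srt) (f : obj M.ob S ⟶ obj M.ob T),
    Den M r.xs r.L r.ysL f ∧ Den M r.xs r.R r.ysR f

theorem Rule.Valid.rev {r : Rule} (h : r.Valid M) : r.rev.Valid M := by
  obtain ⟨S, T, f, h, h'⟩ := h
  exact ⟨S, T, f, h', h⟩

theorem Rule.Valid.map {r : Rule} (h : r.Valid M) {σ : Subst} (hσ : σ.ok = true) :
    (r.map σ.app).Valid M := by
  obtain ⟨_, _, f, hL, hR⟩ := h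
  refine ⟨_, _, f, ?_, ?_⟩ <;> simp only [Rule.map, fmap_eq, Box.fmap_eq]
  · exact hL.rename (Subst.ty_app hσ)
  · exact hR.rename (Subst.ty_app hσ)

/-- The core of the engine. The diagram, reordered as `B ++ L ++ A`, is cut in three. The middle
segment is the left-hand side next to some spectators, so by `Den.frame` it may be replaced by the
right-hand side next to the same spectators, after which `A` is renamed to consume the new outputs.
-/
theorem applyAt_sound {s : List ℕ} {r : Rule} {B A : List Box} {n : ℕ}
    {st st' : State} (hr : r.Valid M) (h : applyAt s r B A n st = some st') {S T : List Srt}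
    {f : obj M.ob S ⟶ obj M.ob T} (hw : WF s st.D) (hD : Den M s st.D st.t f) :
    WF s st'.D ∧ Den M s st'.D st'.t f := by
  obtain ⟨xs, L, ysL, R, ysR⟩ := r
  obtain ⟨_, _, l, hL, hR⟩ := hr
  simp only [applyAt, applicable, fmap_eq, fapp_eq, fzip_eq, fouts_eq, fins_eq, Box.fmap_eq] at h
  set θ : Subst := ysL.zip ysR with hθ0
  rw [sel_eq] at h
  split_ifs at h with hc
  cases h
  simp only [both_eq_true, nodup_iff, disj_iff, subset_iff] at hc
  obtain ⟨hθ, he, hxs, hxB, hxs', hnR, hRBA, hθy⟩ := hc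
  dsimp only at hL hR hθy hxs' he hxs hxB hnR hRBA ⊢
  have hRB : ∀ x ∈ allOuts R, x ∉ s ++ allOuts B := fun x hx h =>
    hRBA x hx (by rw [← List.append_assoc]; exact List.mem_append_left _ h)
  have hRA : ∀ x ∈ allOuts R, x ∉ allOuts A := fun x hx h =>
    hRBA x hx (by rw [← List.append_assoc]; exact List.mem_append_right _ h)
  have hθy := eq_of_leq hθy
  have hw := hw.of_perm (eqv_perm he)
  have hD := hD.eqv he ‹_›
  obtain ⟨s₁, Q, f₁, f₂, hB, hLA, rfl⟩ := hD.split
  obtain ⟨s₂, Q', f₃, f₄, hL', hA, rfl⟩ := hLA.split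
  have hBp := hB.perm
  have hLp := hL.perm
  have hLp' := hL'.perm
  -- An input of the rule is still available at the cut: it has been supplied or produced, and `B`
  -- does not consume it.
  have hxs₁ : ∀ x ∈ xs, x ∈ s₁ := by
    intro x hx
    have h1 : x ∈ s ++ allOuts B := hxs' x hx
    rcases List.mem_append.1 (hBp.mem_iff.1 h1) with h2 | h2
    · exact h2
    · exact absurd h2 (hxB x hx)
  simp only [WF, allOuts_append] at hw
  have hw₁ : WF s₁ L := by
    have h1 : (s ++ allOuts B ++ (allOuts L ++ allOuts A)).Nodup := by
      simpa only [List.append_assoc] using hw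
    have h2 : (s ++ (allOuts B ++ (allOuts L ++ allOuts A))).Perm
        ((s₁ ++ allOuts L) ++ (allIns B ++ allOuts A)) := by
      rw [List.perm_iff_count] at hBp ⊢
      intro a
      have := hBp a
      simp only [List.count_append] at *
      omega
    exact (List.nodup_append.1 (h2.nodup_iff.1 hw)).1
  have hs₁ : s₁.Nodup := (List.nodup_append.1 hw₁).1
  -- The list `c` found here consists of the wires at the cut that the rule does not touch.
  obtain ⟨l', hl, hl'⟩ := List.subperm_of_subset hxs hxs₁
  obtain ⟨c, hc⟩ := hl'.exists_perm_append
  have hs₁c : s₁.Perm (c ++ xs) :=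
    (hc.trans (hl.append_right _)).trans List.perm_append_comm
  have hs₂ : (c ++ ysL).Perm s₂ := by
    rw [List.perm_iff_count] at hLp hLp' hs₁c ⊢
    intro a
    have := hLp a
    have := hLp' a
    have := hs₁c a
    simp only [List.count_append] at *
    omega
  obtain ⟨P, P', k, hk, hk'⟩ := hL.frame hR c
  obtain ⟨e, he⟩ := Sh.exists_of_perm (ob := M.ob) (ty := ty) hs₁c
  obtain ⟨u, hu⟩ := Sh.exists_of_perm (ob := M.ob) (ty := ty) hs₂
  obtain ⟨rfl, rfl⟩ := hk.typed
  obtain ⟨rfl, rfl⟩ := hL'.typed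
  have hf₃ : e ≫ k ≫ u = f₃ := ((hk.postcomp hu).precomp he).unique hL' hw₁
  have hs₂n : (c ++ ysL).Nodup := by
    refine hs₂.nodup_iff.2 ?_
    exact (List.nodup_append.1 (hLp'.nodup_iff.1 hw₁)).1
  -- No spectator is an output of the left-hand side, so the renaming fixes all of them.
  have hfix : c.map θ.app = c := by
    refine (List.map_congr_left fun x hx => ?_).trans (List.map_id c)
    exact Subst.app_zip fun h => (List.nodup_append.1 hs₂n).2.2 x hx x h rfl
  have hA' := (hA.precomp hu).rename (Subst.ty_app hθ)
  rw [List.map_append, hfix, hθy] at hA'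
  have hA₂ := (hk'.precomp he).append hA'
  refine ⟨?_, ?_⟩
  -- Wires created in `A` are not outputs of the left-hand side either. They keep their names and
  -- stay distinct from the new ones.
  · have hxA : ∀ x ∈ allOuts A, x ∉ ysL := by
      intro x hx hy
      rcases List.mem_append.1 (hLp.mem_iff.2 (List.mem_append_left _ hy)) with h | h
      · have : x ∈ s ++ allOuts B := hBp.mem_iff.2 (List.mem_append_left _ (hxs₁ x h))
        grind [List.nodup_append]
      · grind [List.nodup_append]
    have hA₃ : (allOuts A).map θ.app = allOuts A :=
      (List.map_congr_left fun x hx => Subst.app_zip (hxA x hx)).trans (List.map_id _)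
    simp only [WF, allOuts_append, allOuts_map, hA₃]
    clear * - hw hnR hRB hRA
    grind [List.nodup_append]
  · have := hB.append hA₂
    rw [← hf₃]
    simpa only [Category.assoc] using this

end

end

/-! ### Search for rewriting steps, scripts, and comparison of diagrams -/

noncomputable section

/-- Case distinction. -/
abbrev onSome {α β : Type} (o : Option α) (x : β) (f : α → β) : β :=
  Option.rec (motive := fun _ => β) x f o

/-- The value `y` is in the range of the substitution. -/
def Subst.hits (y : ℕ) (σ : Subst) : Bool :=
  List.rec false (fun p _ ih => sel (Nat.beq y p.2) true ih) σ

/-- Extend an injective substitution so that it carries the first list to the second. -/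
def unify {α : Type} (l : List ℕ) : List ℕ → Subst → (Subst → Option α) → Option α :=
  List.rec (fun m σ k => List.rec (k σ) (fun _ _ _ => none) m)
    (fun x _ ih m σ k => List.rec none (fun y m _ =>
      onSome (σ.find x) (sel (σ.hits y) none (ih m ((x, y) :: σ) k))
        (fun z => sel (Nat.beq z y) (ih m σ k) none)) m) l

/-- The first success of `f` on a list. -/
def firstSome {α β : Type} (f : α → Option β) (l : List α) : Option β :=
  List.rec none (fun b _ ih => onSome (f b) ih some) l

/-- Extend the substitution so that it carries the boxes in the list to boxes of `D`, until the
continuation succeeds. -/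
def matching {α : Type} (D L : List Box) : Subst → (Subst → Option α) → Option α :=
  List.rec (fun σ k => k σ)
    (fun b _ ih σ k => firstSome (fun c => sel (b.g.beq c.g)
      (unify b.ins c.ins σ fun σ => unify b.outs c.outs σ fun σ => ih σ k) none) D) L

/-- The box is a member of the list. -/
def memBox (b : Box) (L : List Box) : Bool :=
  List.rec false (fun c _ ih => sel (b.beq c) true ih) L

/-- Split the boxes that are not in `L` into those that do not depend on `L` and the others;
`T` collects the wires that depend on `L`. -/
def partition {α : Type} (L D : List Box) : List ℕ → (List Box → List Box → α) → α :=
  List.rec (fun _ k => k [] [])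
    (fun b _ ih T k => sel (memBox b L) (ih (fapp b.outs T) k)
      (sel (disj b.ins T) (ih T fun B A => k (b :: B) A)
        (ih (fapp b.outs T) fun B A => k B (b :: A)))) D

/-- Assign fresh names to the wires that have none. -/
def freshen {α : Type} (l : List ℕ) : Subst → ℕ → (Subst → ℕ → α) → α :=
  List.rec (fun σ n k => k σ n)
    (fun x _ ih σ n k => onSome (σ.find x)
      -- The summand `x mod 2` gives the new name the sort of `x`.
      (ih ((x, Nat.add (Nat.mul 2 n) (Nat.mod x 2)) :: σ) (Nat.succ n) k) (fun _ => ih σ n k)) l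

/-- Rewrite the occurrence of the left-hand side of `r` given by `σ`. -/
def applySubst (s : List ℕ) (r : Rule) (st : State) (σ : Subst) : Option State :=
  freshen (fouts r.R) σ st.n fun σ n => sel σ.ok ((r.map σ.app).force fun r =>
    -- Starting from `r.xs` matters when a wire passes straight through the left-hand side, as in a
    -- rule with empty left-hand side: the box consuming that wire must come after the rule.
    partition r.L st.D r.xs fun B A => applyAt s r B A n st) none

/-- Instructions for rewriting. -/
inductive Instr
  /-- apply the rule at a place that extends the partial substitution `pre` -/
  | one (r : Rule) (pre : Subst)
  /-- apply the rules as often as possible, in a number of rounds -/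
  | norm (rs : List Rule) (rounds : ℕ)

instance : Coe Rule Instr := ⟨fun r => .one r []⟩

/-- Apply a rule. -/
def Rule.run (s : List ℕ) (r : Rule) (pre : Subst) (st : State) : Option State :=
  matching st.D r.L.reverse pre (applySubst s r st)

/-- Apply a rule as often as possible, and pass the result to a continuation. -/
def exhaust {α : Type} (s : List ℕ) (r : Rule) (n : ℕ) : State → (State → Option α) → Option α :=
  Nat.rec (fun st k => k st)
    (fun _ ih st k => onSome (r.run s [] st) (k st) fun st => st.force fun st => ih st k) n

/-- Apply each rule of a list as often as possible. -/
def exhaustAll {α : Type} (s : List ℕ) (rs : List Rule) :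
    State → (State → Option α) → Option α :=
  List.rec (fun st k => k st)
    -- The number 100 is only fuel; soundness does not depend on it.
    (fun r _ ih st k => r.force fun r => exhaust s r 100 st fun st => ih st k) rs

/-- Apply rules as often as possible, in `n` rounds. -/
def normalize {α : Type} (s : List ℕ) (rs : List Rule) (n : ℕ) :
    State → (State → Option α) → Option α :=
  Nat.rec (fun st k => k st) (fun _ ih st k => exhaustAll s rs st fun st => ih st k) n

/-- Run a script. -/
def run {α : Type} (s : List ℕ) (is : List Instr) : State → (State → Option α) → Option α :=
  List.rec (fun st k => k st)
    (fun i _ ih st k => Instr.rec (motive := fun _ => Option α)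
      (fun r pre => onSome (r.run s pre st) none fun st => st.force fun st => ih st k)
      (fun rs n => normalize s rs n st fun st => ih st k) i) is

/-- The box of `D` that corresponds to `b` under the renaming `φ`. -/
def findBox (φ : Subst) (b : Box) (D : List Box) : Option Box :=
  firstSome (fun c => sel (both (b.g.beq c.g) (leq (fmap φ.app b.ins) c.ins)) (some c) none) D

/-- Remove a box from a list. -/
def dropBox (b : Box) (D : List Box) : List Box :=
  List.rec [] (fun c D ih => sel (c.beq b) D (c :: ih)) D

/-- A renaming that carries the first diagram to the second, as far as possible. -/
def wireMap {α : Type} (X : List Box) : List Box → Subst → (Subst → α) → α :=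
  List.rec (fun _ φ k => k φ)
    (fun b _ ih D φ k => onSome (findBox φ b D) (k φ) fun c =>
      ih (dropBox c D) (fapp (fzip b.outs c.outs) φ) k) X

/-- Equality test for diagrams modulo exchange of independent boxes and renaming. -/
def iso (s : List ℕ) (st st' : State) : Bool :=
  wireMap st'.D st.D (fzip s s) fun φ =>
    both φ.ok (both (leq (fmap φ.app s) s) (both (leq (fmap φ.app st'.t) st.t)
      (forceBoxes (fmap (Box.fmap φ.app) st'.D) fun X => eqv X st.D)))

/-- Remove the wires in `l` from `s`. -/
def removeAll : List ℕ → List ℕ → Option (List ℕ)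
  | [], s => some s
  | x :: l, s => if mem x s then removeAll l (s.erase x) else none

/-- Well-typedness of a diagram. -/
def check : List ℕ → List Box → List ℕ → Bool
  | s, [], t => match removeAll t s with
    | some [] => true
    | _ => false
  | s, b :: D, t => decide (b.ins.map ty = b.g.dom.flat []) &&
    decide (b.outs.map ty = b.g.cod.flat []) && match removeAll b.ins s with
      | some r => check (b.outs ++ r) D t
      | none => false

theorem removeAll_perm {l s r : List ℕ} (h : removeAll l s = some r) : s.Perm (l ++ r) := by
  induction l generalizing s with
  | nil => cases h; rfl
  | cons x l ih =>
    rw [removeAll] at h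
    split_ifs at h with hx
    exact (List.perm_cons_erase (mem_iff.1 hx)).trans ((ih h).cons x)

section

variable {C : Type u} [Category.{v} C] [MonoidalCategory C] [SymmetricCategory C] (M : Model C)

/-- Validity of a rule, for instance resolution. -/
class IsValid (r : Rule) : Prop where
  valid : r.Valid M

instance (r : Rule) [h : IsValid M r] : IsValid M r.rev := ⟨h.valid.rev⟩

/-- Validity of all rules of a list. -/
class AllValid (rs : List Rule) : Prop where
  valid : ∀ r ∈ rs, r.Valid M

instance : AllValid M [] := ⟨by simp⟩

instance (r : Rule) (rs : List Rule) [h : IsValid M r] [h' : AllValid M rs] :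
    AllValid M (r :: rs) := ⟨by simpa using ⟨h.valid, h'.valid⟩⟩

instance (rs rs' : List Rule) [h : AllValid M rs] [h' : AllValid M rs'] :
    AllValid M (rs ++ rs') :=
  ⟨fun r hr => (List.mem_append.1 hr).elim (h.valid r) (h'.valid r)⟩

/-- Validity of an instruction. -/
class InstrValid (i : Instr) : Prop where
  valid : match i with
    | .one r _ => r.Valid M
    | .norm rs _ => ∀ r ∈ rs, r.Valid M

instance (r : Rule) (pre : Subst) [h : IsValid M r] :
    InstrValid M (.one r pre) := ⟨h.valid⟩

instance (rs : List Rule) (n : ℕ) [h : AllValid M rs] :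
    InstrValid M (.norm rs n) := ⟨h.valid⟩

/-- Validity of a script. -/
class ScriptValid (is : List Instr) : Prop where
  valid : ∀ i ∈ is, InstrValid M i

instance : ScriptValid M [] := ⟨by simp⟩

instance (i : Instr) (is : List Instr) [h : InstrValid M i] [h' : ScriptValid M is] :
    ScriptValid M (i :: is) := ⟨by simpa using ⟨h, h'.valid⟩⟩

variable {M}

theorem onSome_eq {α β : Type} {o : Option α} {f : α → Option β} {y : β}
    (h : onSome o none f = some y) : ∃ x, o = some x ∧ f x = some y := by
  cases o with
  | none => cases h
  | some x => exact ⟨x, rfl, h⟩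

theorem sel_none_eq {α : Type} {b : Bool} {o : Option α} {y : α} (h : sel b o none = some y) :
    b = true ∧ o = some y := by
  cases b with
  | false => cases h
  | true => exact ⟨rfl, h⟩

/-- The search is not trusted: all that is needed is that a success comes from a call of the
continuation on some substitution. The same holds for the lemmas on `matching`, `partition` and
`freshen`; the actual conditions are tested in `applyAt`. -/
theorem unify_eq {α : Type} {l m : List ℕ} {σ : Subst} {k : Subst → Option α} {y : α}
    (h : unify l m σ k = some y) : ∃ σ, k σ = some y := by
  induction l generalizing m σ with
  | nil =>
    cases m with
    | nil => exact ⟨σ, h⟩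
    | cons => cases h
  | cons x l ih =>
    cases m with
    | nil => cases h
    | cons z m =>
      change onSome (σ.find x) (sel (σ.hits z) none (unify l m ((x, z) :: σ) k))
        (fun w => sel (Nat.beq w z) (unify l m σ k) none) = some y at h
      cases hx : σ.find x with
      | none =>
        rw [hx] at h
        change sel (σ.hits z) none (unify l m ((x, z) :: σ) k) = some y at h
        rw [sel_eq] at h
        split_ifs at h
        exact ih h
      | some w =>
        rw [hx] at h
        exact ih (sel_none_eq h).2

theorem firstSome_eq {α β : Type} {f : α → Option β} {l : List α} {y : β}
    (h : firstSome f l = some y) : ∃ b, f b = some y := by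
  induction l with
  | nil => cases h
  | cons b l ih =>
    change onSome (f b) (firstSome f l) some = some y at h
    cases hb : f b with
    | none =>
      rw [hb] at h
      exact ih h
    | some z =>
      rw [hb] at h
      exact ⟨b, hb.trans h⟩

theorem matching_eq {α : Type} {D L : List Box} {σ : Subst} {k : Subst → Option α} {y : α}
    (h : matching D L σ k = some y) : ∃ σ, k σ = some y := by
  induction L generalizing σ with
  | nil => exact ⟨σ, h⟩
  | cons p L ih =>
    obtain ⟨b, hb⟩ := firstSome_eq h
    obtain ⟨σ, h⟩ := unify_eq (sel_none_eq hb).2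
    obtain ⟨σ, h⟩ := unify_eq h
    exact ih h

theorem partition_eq {α : Type} {L D : List Box} {T : List ℕ}
    {k : List Box → List Box → Option α} {y : α} (h : partition L D T k = some y) :
    ∃ B A, k B A = some y := by
  induction D generalizing T k with
  | nil => exact ⟨_, _, h⟩
  | cons b D ih =>
    change sel (memBox b L) (partition L D (fapp b.outs T) k)
      (sel (disj b.ins T) (partition L D T fun B A => k (b :: B) A)
        (partition L D (fapp b.outs T) fun B A => k B (b :: A))) = some y at h
    simp only [sel_eq] at h
    split_ifs at h
    · exact ih h
    · obtain ⟨B, A, h⟩ := ih h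
      exact ⟨_, _, h⟩
    · obtain ⟨B, A, h⟩ := ih h
      exact ⟨_, _, h⟩

theorem freshen_eq {α : Type} {l : List ℕ} {σ : Subst} {n : ℕ} {k : Subst → ℕ → Option α} {y : α}
    (h : freshen l σ n k = some y) : ∃ σ n, k σ n = some y := by
  induction l generalizing σ n with
  | nil => exact ⟨σ, n, h⟩
  | cons x l ih =>
    change onSome (σ.find x) (freshen l ((x, Nat.add (Nat.mul 2 n) (Nat.mod x 2)) :: σ)
      (Nat.succ n) k) (fun _ => freshen l σ n k) = some y at h
    cases hx : σ.find x with
    | none =>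
      rw [hx] at h
      exact ih h
    | some z =>
      rw [hx] at h
      exact ih h

theorem Rule.run_sound {s : List ℕ} {r : Rule} (hr : r.Valid M) {pre : Subst}
    {st st' : State} (h : r.run s pre st = some st') {S T : List Srt}
    {f : obj M.ob S ⟶ obj M.ob T} (hw : WF s st.D) (hD : Den M s st.D st.t f) :
    WF s st'.D ∧ Den M s st'.D st'.t f := by
  obtain ⟨σ, h⟩ := matching_eq h
  obtain ⟨σ, n, h⟩ := freshen_eq h
  obtain ⟨hσ, h⟩ := sel_none_eq h
  rw [Rule.force_eq] at h
  obtain ⟨B, A, h⟩ := partition_eq h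
  exact applyAt_sound (hr.map hσ) h hw hD

section

variable {s : List ℕ} {α : Type} {y : α} {S T : List Srt} {f : obj M.ob S ⟶ obj M.ob T}

theorem exhaust_sound {r : Rule} (hr : r.Valid M) {n : ℕ} {st : State}
    {k : State → Option α} (h : exhaust s r n st k = some y) (hw : WF s st.D)
    (hD : Den M s st.D st.t f) :
    ∃ st', k st' = some y ∧ WF s st'.D ∧ Den M s st'.D st'.t f := by
  induction n generalizing st with
  | zero => exact ⟨st, h, hw, hD⟩
  | succ n ih =>
    change onSome (r.run s [] st) (k st) (fun st => st.force fun st => exhaust s r n st k) =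
      some y at h
    cases hr' : r.run s [] st with
    | none =>
      rw [hr'] at h
      exact ⟨st, h, hw, hD⟩
    | some st' =>
      rw [hr'] at h
      obtain ⟨h1, h2⟩ := Rule.run_sound hr hr' hw hD
      exact ih ((State.force_eq _ _).symm.trans h) h1 h2

theorem exhaustAll_sound {rs : List Rule} (hr : ∀ r ∈ rs, r.Valid M) {st : State}
    {k : State → Option α} (h : exhaustAll s rs st k = some y) (hw : WF s st.D)
    (hD : Den M s st.D st.t f) :
    ∃ st', k st' = some y ∧ WF s st'.D ∧ Den M s st'.D st'.t f := by
  induction rs generalizing st with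
  | nil => exact ⟨st, h, hw, hD⟩
  | cons r rs ih =>
    simp only [List.forall_mem_cons] at hr
    change (r.force fun r => exhaust s r 100 st fun st => exhaustAll s rs st k) = some y at h
    rw [Rule.force_eq] at h
    obtain ⟨st', h, h1, h2⟩ := exhaust_sound hr.1 h hw hD
    exact ih hr.2 h h1 h2

theorem normalize_sound {rs : List Rule} (hr : ∀ r ∈ rs, r.Valid M) {n : ℕ} {st : State}
    {k : State → Option α} (h : normalize s rs n st k = some y) (hw : WF s st.D)
    (hD : Den M s st.D st.t f) :
    ∃ st', k st' = some y ∧ WF s st'.D ∧ Den M s st'.D st'.t f := by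
  induction n generalizing st with
  | zero => exact ⟨st, h, hw, hD⟩
  | succ n ih =>
    obtain ⟨st', h, h1, h2⟩ := exhaustAll_sound hr h hw hD
    exact ih h h1 h2

theorem run_sound {is : List Instr} [hi : ScriptValid M is] {st : State}
    {k : State → Option α} (h : run s is st k = some y) (hw : WF s st.D)
    (hD : Den M s st.D st.t f) :
    ∃ st', k st' = some y ∧ WF s st'.D ∧ Den M s st'.D st'.t f := by
  obtain ⟨hi⟩ := hi
  induction is generalizing st with
  | nil => exact ⟨st, h, hw, hD⟩
  | cons i is ih =>
    simp only [List.forall_mem_cons] at hi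
    cases i with
    | one r pre =>
      obtain ⟨st', h', h⟩ := onSome_eq h
      obtain ⟨h1, h2⟩ := Rule.run_sound hi.1.valid h' hw hD
      exact ih ((State.force_eq _ _).symm.trans h) h1 h2 hi.2
    | norm rs n =>
      obtain ⟨st', h, h1, h2⟩ := normalize_sound hi.1.valid h hw hD
      exact ih h h1 h2 hi.2

end

theorem wireMap_eq {X D : List Box} {φ : Subst} {k : Subst → Bool}
    (h : wireMap X D φ k = true) : ∃ φ, k φ = true := by
  induction X generalizing D φ with
  | nil => exact ⟨φ, h⟩
  | cons b X ih =>
    change onSome (findBox φ b D) (k φ)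
      (fun c => wireMap X (dropBox c D) (fapp (fzip b.outs c.outs) φ) k) =
      true at h
    cases hb : findBox φ b D with
    | none =>
      rw [hb] at h
      exact ⟨φ, h⟩
    | some c =>
      rw [hb] at h
      exact ih h

/-- Renaming does not change denotations, and after it the two diagrams differ by exchanges only, so
`Den.unique` applies. That `φ` is injective need not be checked, since distinctness is inherited
from `st.D`. -/
theorem iso_sound {s : List ℕ} {st st' : State} (h : iso s st st' = true) {S T : List Srt}
    {f f' : obj M.ob S ⟶ obj M.ob T} (hw : WF s st.D) (hD : Den M s st.D st.t f)
    (hD' : Den M s st'.D st'.t f') : f = f' := by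
  obtain ⟨φ, h⟩ := wireMap_eq h
  simp only [both_eq_true, forceBoxes_eq, fmap_eq, Box.fmap_eq] at h
  obtain ⟨h1, h2, h3, h4⟩ := h
  have hD' := hD'.rename (Subst.ty_app h1)
  rw [eq_of_leq h2, eq_of_leq h3] at hD'
  exact (hD.eqv h4 hw).unique hD' (hw.of_perm (eqv_perm h4))

/-- `Den` is a relation, so a rule written by hand needs a proof that its sides denote anything at
all. -/
theorem check_sound {s t : List ℕ} {D : List Box} (h : check s D t = true) :
    ∃ f : obj M.ob (s.map ty) ⟶ obj M.ob (t.map ty), Den M s D t f := by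
  induction D generalizing s with
  | nil =>
    rw [check] at h
    split at h
    · rename_i h'
      obtain ⟨f, hf⟩ := Sh.exists_of_perm (ob := M.ob) (ty := ty) (removeAll_perm h')
      revert f
      rw [List.append_nil]
      exact fun f hf => ⟨f, .nil hf⟩
    · cases h
  | cons b D ih =>
    obtain ⟨g, ins, outs⟩ := b
    rw [check] at h
    simp only [Bool.and_eq_true, decide_eq_true_eq] at h
    obtain ⟨⟨hi, ho⟩, h⟩ := h
    split at h
    · rename_i r hr
      obtain ⟨e, he⟩ := Sh.exists_of_perm (ob := M.ob) (ty := ty) (removeAll_perm hr)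
      obtain ⟨k, hk⟩ := ih h
      revert e k
      rw [map_ty_append hi, map_ty_append ho]
      intro e he k hk
      exact ⟨_, .cons hi ho he hk⟩
    · cases h

/-- Compare two diagrams after running scripts on them. -/
def compare (s : List ℕ) (st st' : State) (is is' : List Instr) : Bool :=
  forceList s fun s => st.force fun st => st'.force fun st' =>
    nodup (s ++ allOuts st.D) && nodup (s ++ allOuts st'.D) &&
      (run s is st fun u => run s is' st' fun u' => if iso s u u' then some () else none).isSome

theorem compare_sound {s : List ℕ} {st st' : State} {is is' : List Instr} [ScriptValid M is]
    [ScriptValid M is'] (h : compare s st st' is is' = true) {S T : List Srt}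
    {f f' : obj M.ob S ⟶ obj M.ob T} (hD : Den M s st.D st.t f) (hD' : Den M s st'.D st'.t f') :
    f = f' := by
  simp only [compare, forceList_eq, State.force_eq, Bool.and_eq_true, nodup_iff,
    Option.isSome_iff_exists] at h
  obtain ⟨⟨hw, hw'⟩, _, h⟩ := h
  obtain ⟨u, h, h1, h2⟩ := run_sound h hw hD
  obtain ⟨u', h, -, h4⟩ := run_sound h hw' hD'
  split_ifs at h with hi
  exact iso_sound hi h1 h2 h4

/-- A bound for the names in a list. -/
def bound (l : List ℕ) : ℕ := l.foldr (fun x n => Nat.max x n) 0 / 2 + 1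

/-- Test that scripts prove a rule. -/
def Rule.test (r : Rule) (is is' : List Instr) : Bool :=
  check r.xs r.L r.ysL && check r.xs r.R r.ysR && decide (r.ysL.map ty = r.ysR.map ty) &&
    compare r.xs ⟨r.L, r.ysL, bound (r.xs ++ allOuts r.L)⟩
      ⟨r.R, r.ysR, bound (r.xs ++ allOuts r.R)⟩ is is'

theorem Rule.valid_of_test {r : Rule} (is is' : List Instr) (h : r.test is is' = true)
    [ScriptValid M is] [ScriptValid M is'] : IsValid M r := by
  simp only [test, Bool.and_eq_true, decide_eq_true_eq] at h
  obtain ⟨⟨⟨h1, h2⟩, h3⟩, h4⟩ := h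
  obtain ⟨f, hf⟩ := check_sound (M := M) h1
  obtain ⟨f', hf'⟩ := check_sound (M := M) h2
  revert f'
  rw [← h3]
  intro f' hf'
  obtain rfl := compare_sound h4 hf hf'
  exact ⟨_, _, f, hf, hf'⟩

end

end

/-! ### Compiling expressions of symmetric monoidal categories to diagrams -/

/-- Morphisms built from the generators. -/
inductive Expr : Ob → Ob → Type
  | id (X : Ob) : Expr X X
  | comp {X Y Z : Ob} (f : Expr X Y) (g : Expr Y Z) : Expr X Z
  | whiskerLeft (X : Ob) {Y Z : Ob} (f : Expr Y Z) : Expr (.ten X Y) (.ten X Z)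
  | whiskerRight {X Y : Ob} (f : Expr X Y) (Z : Ob) : Expr (.ten X Z) (.ten Y Z)
  | tensor {X Y Z W : Ob} (f : Expr X Y) (g : Expr Z W) : Expr (.ten X Z) (.ten Y W)
  | assoc (X Y Z : Ob) : Expr (.ten (.ten X Y) Z) (.ten X (.ten Y Z))
  | assocInv (X Y Z : Ob) : Expr (.ten X (.ten Y Z)) (.ten (.ten X Y) Z)
  | left (X : Ob) : Expr (.ten .unit X) X
  | leftInv (X : Ob) : Expr X (.ten .unit X)
  | right (X : Ob) : Expr (.ten X .unit) X
  | rightInv (X : Ob) : Expr X (.ten X .unit)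
  | braid (X Y : Ob) : Expr (.ten X Y) (.ten Y X)
  | gen (g : Gen) : Expr g.dom g.cod

/-- Fresh names for the wires of an object. -/
def freshNames : List Srt → ℕ → List ℕ
  | [], _ => []
  | .A :: l, n => (2 * n) :: freshNames l (n + 1)
  | .H :: l, n => (2 * n + 1) :: freshNames l (n + 1)

/-- The diagram of an expression on given input wires, its outputs, and a bound for the names. -/
def Expr.compile : ∀ {X Y : Ob}, Expr X Y → List ℕ → ℕ → State
  | _, _, .id _, xs, n => ⟨[], xs, n⟩
  | _, _, .comp f g, xs, n =>
    let p := f.compile xs n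
    let q := g.compile p.t p.n
    ⟨p.D ++ q.D, q.t, q.n⟩
  | _, _, .whiskerLeft X f, xs, n =>
    let p := f.compile (xs.drop X.size) n
    ⟨p.D, xs.take X.size ++ p.t, p.n⟩
  | _, _, @Expr.whiskerRight X _ f _, xs, n =>
    let p := f.compile (xs.take X.size) n
    ⟨p.D, p.t ++ xs.drop X.size, p.n⟩
  | _, _, @Expr.tensor X _ _ _ f g, xs, n =>
    let p := f.compile (xs.take X.size) n
    let q := g.compile (xs.drop X.size) p.n
    ⟨p.D ++ q.D, p.t ++ q.t, q.n⟩
  | _, _, .assoc _ _ _, xs, n => ⟨[], xs, n⟩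
  | _, _, .assocInv _ _ _, xs, n => ⟨[], xs, n⟩
  | _, _, .left _, xs, n => ⟨[], xs, n⟩
  | _, _, .leftInv _, xs, n => ⟨[], xs, n⟩
  | _, _, .right _, xs, n => ⟨[], xs, n⟩
  | _, _, .rightInv _, xs, n => ⟨[], xs, n⟩
  | _, _, .braid X _, xs, n => ⟨[], xs.drop X.size ++ xs.take X.size, n⟩
  | _, _, .gen g, xs, n =>
    let ys := freshNames (g.cod.flat []) n
    ⟨[⟨g, xs, ys⟩], ys, n + ys.length⟩

/-! ### Interpretation of expressions and correctness of the compiler -/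

noncomputable section

variable {C : Type u} [Category.{v} C] [MonoidalCategory C] [SymmetricCategory C] (M : Model C)

/-- Interpretation of expressions. -/
def Expr.eval : ∀ {X Y : Ob}, Expr X Y → (X.ev M.ob ⟶ Y.ev M.ob)
  | _, _, .id X => 𝟙 (X.ev M.ob)
  | _, _, .comp f g => f.eval ≫ g.eval
  | _, _, .whiskerLeft X f => X.ev M.ob ◁ f.eval
  | _, _, .whiskerRight f Z => f.eval ▷ Z.ev M.ob
  | _, _, .tensor f g => f.eval ⊗ₘ g.eval
  | _, _, .assoc X Y Z => (α_ (X.ev M.ob) (Y.ev M.ob) (Z.ev M.ob)).hom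
  | _, _, .assocInv X Y Z => (α_ (X.ev M.ob) (Y.ev M.ob) (Z.ev M.ob)).inv
  | _, _, .left X => (λ_ (X.ev M.ob)).hom
  | _, _, .leftInv X => (λ_ (X.ev M.ob)).inv
  | _, _, .right X => (ρ_ (X.ev M.ob)).hom
  | _, _, .rightInv X => (ρ_ (X.ev M.ob)).inv
  | _, _, .braid X Y => (β_ (X.ev M.ob) (Y.ev M.ob)).hom
  | _, _, .gen g => M.hom g

variable {M}

theorem lift_whiskerRight {X Y : Ob} (f : X.ev M.ob ⟶ Y.ev M.ob) (Z : Ob) (Q : List Srt) :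
    lift (X := .ten X Z) (Y := .ten Y Z) (f ▷ Z.ev M.ob) Q = lift f (Z.flat Q) := by
  have h : lift (X := .ten X Z) (Y := .ten Y Z) (f ▷ Z.ev M.ob) Q =
      (((fl M.ob X (Z.flat Q)).inv ≫ (X.ev M.ob ◁ (fl M.ob Z Q).inv)) ≫ (α_ _ _ _).inv) ≫
        ((f ▷ Z.ev M.ob) ▷ obj M.ob Q) ≫
        ((α_ _ _ _).hom ≫ (Y.ev M.ob ◁ (fl M.ob Z Q).hom) ≫ (fl M.ob Y (Z.flat Q)).hom) := rfl
  rw [h]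
  simp only [lift, Category.assoc]
  rw [associator_naturality_left_assoc, Iso.inv_hom_id_assoc, whisker_exchange_assoc,
    whiskerLeft_inv_hom_assoc]

theorem lift_whiskerLeft (X : Ob) {Y Z : Ob} (f : Y.ev M.ob ⟶ Z.ev M.ob) (Q : List Srt) :
    lift (X := .ten X Y) (Y := .ten X Z) (X.ev M.ob ◁ f) Q = wl X (lift f Q) := by
  have h : lift (X := .ten X Y) (Y := .ten X Z) (X.ev M.ob ◁ f) Q =
      (((fl M.ob X (Y.flat Q)).inv ≫ (X.ev M.ob ◁ (fl M.ob Y Q).inv)) ≫ (α_ _ _ _).inv) ≫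
        ((X.ev M.ob ◁ f) ▷ obj M.ob Q) ≫
        ((α_ _ _ _).hom ≫ (X.ev M.ob ◁ (fl M.ob Z Q).hom) ≫ (fl M.ob X (Z.flat Q)).hom) := rfl
  rw [h]
  simp [lift, wl]
  rfl

/-- Words are strictly associative, so flattening turns the associator into an identity. This, and
its analogue for unitors, is why structural morphisms compile to empty diagrams. -/
theorem lift_assoc (X Y Z : Ob) (Q : List Srt) :
    lift (X := .ten (.ten X Y) Z) (Y := .ten X (.ten Y Z))
      (α_ (X.ev M.ob) (Y.ev M.ob) (Z.ev M.ob)).hom Q = 𝟙 _ := by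
  have h : lift (X := .ten (.ten X Y) Z) (Y := .ten X (.ten Y Z))
      (α_ (X.ev M.ob) (Y.ev M.ob) (Z.ev M.ob)).hom Q =
      (((((fl M.ob X _).inv ≫ (X.ev M.ob ◁ (fl M.ob Y _).inv)) ≫ (α_ _ _ _).inv) ≫
        ((X.ev M.ob ⊗ Y.ev M.ob) ◁ (fl M.ob Z Q).inv)) ≫ (α_ _ _ _).inv) ≫
        ((α_ (X.ev M.ob) (Y.ev M.ob) (Z.ev M.ob)).hom ▷ obj M.ob Q) ≫
        ((α_ _ _ _).hom ≫ (X.ev M.ob ◁ ((α_ _ _ _).hom ≫ (Y.ev M.ob ◁ (fl M.ob Z Q).hom) ≫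
          (fl M.ob Y (Z.flat Q)).hom)) ≫ (fl M.ob X (Y.flat (Z.flat Q))).hom) := rfl
  rw [h]
  simp
  rfl

theorem lift_left (X : Ob) (Q : List Srt) :
    lift (X := .ten .unit X) (Y := X) (λ_ (X.ev M.ob)).hom Q = 𝟙 _ := by
  have h : lift (X := .ten .unit X) (Y := X) (λ_ (X.ev M.ob)).hom Q =
      (((λ_ _).inv ≫ (𝟙_ C ◁ (fl M.ob X Q).inv)) ≫ (α_ _ _ _).inv) ≫
        ((λ_ (X.ev M.ob)).hom ▷ obj M.ob Q) ≫ (fl M.ob X Q).hom := rfl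
  rw [h]
  simp
  rfl

theorem lift_right (X : Ob) (Q : List Srt) :
    lift (X := .ten X .unit) (Y := X) (ρ_ (X.ev M.ob)).hom Q = 𝟙 _ := by
  have h : lift (X := .ten X .unit) (Y := X) (ρ_ (X.ev M.ob)).hom Q =
      (((fl M.ob X Q).inv ≫ (X.ev M.ob ◁ (λ_ _).inv)) ≫ (α_ _ _ _).inv) ≫
        ((ρ_ (X.ev M.ob)).hom ▷ obj M.ob Q) ≫ (fl M.ob X Q).hom := rfl
  rw [h]
  simp
  rfl

theorem lift_braid (X Y : Ob) (Q : List Srt) :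
    lift (X := .ten X Y) (Y := .ten Y X) (β_ (X.ev M.ob) (Y.ev M.ob)).hom Q =
      bs M.ob X Y Q := by
  have h : lift (X := .ten X Y) (Y := .ten Y X) (β_ (X.ev M.ob) (Y.ev M.ob)).hom Q =
      (((fl M.ob X (Y.flat Q)).inv ≫ (X.ev M.ob ◁ (fl M.ob Y Q).inv)) ≫ (α_ _ _ _).inv) ≫
        ((β_ (X.ev M.ob) (Y.ev M.ob)).hom ▷ obj M.ob Q) ≫
        ((α_ _ _ _).hom ≫ (Y.ev M.ob ◁ (fl M.ob X Q).hom) ≫ (fl M.ob Y (X.flat Q)).hom) := rfl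
  rw [h]
  simp [bs, bswap]
  rfl

theorem lift_hom_inv {X Y : Ob} (e : X.ev M.ob ≅ Y.ev M.ob) (Q : List Srt) :
    lift e.hom Q ≫ lift e.inv Q = 𝟙 _ := by
  rw [← lift_comp, Iso.hom_inv_id]
  exact lift_id _ _

theorem eq_id_of_comp_eq_id {a : C} {f g : a ⟶ a} (hf : f = 𝟙 a) (h : f ≫ g = 𝟙 a) :
    g = 𝟙 a := by
  rwa [hf, Category.id_comp] at h

theorem lift_assocInv (X Y Z : Ob) (Q : List Srt) :
    lift (X := .ten X (.ten Y Z)) (Y := .ten (.ten X Y) Z)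
      (α_ (X.ev M.ob) (Y.ev M.ob) (Z.ev M.ob)).inv Q = 𝟙 _ :=
  eq_id_of_comp_eq_id (lift_assoc X Y Z Q)
    (lift_hom_inv (X := .ten (.ten X Y) Z) (Y := .ten X (.ten Y Z)) (α_ _ _ _) Q)

theorem lift_leftInv (X : Ob) (Q : List Srt) :
    lift (X := X) (Y := .ten .unit X) (λ_ (X.ev M.ob)).inv Q = 𝟙 _ :=
  eq_id_of_comp_eq_id (lift_left X Q)
    (lift_hom_inv (X := .ten .unit X) (Y := X) (λ_ _) Q)

theorem lift_rightInv (X : Ob) (Q : List Srt) :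
    lift (X := X) (Y := .ten X .unit) (ρ_ (X.ev M.ob)).inv Q = 𝟙 _ :=
  eq_id_of_comp_eq_id (lift_right X Q)
    (lift_hom_inv (X := .ten X .unit) (Y := X) (ρ_ _) Q)

theorem bs_lift_bs {X Y Z : Ob} (f : X.ev M.ob ⟶ Y.ev M.ob) (Q : List Srt) {T : C}
    (k : obj M.ob (Z.flat (Y.flat Q)) ⟶ T) :
    bs M.ob Z X Q ≫ lift f (Z.flat Q) ≫ bs M.ob Y Z Q ≫ k = wl Z (lift f Q) ≫ k := by
  rw [reassoc_of% (lift_bs f Z Q), reassoc_of% (bs_symm (ob := M.ob) Z X)]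

/-- The diagram `E` from `xs` to `ys` simulates `f`, in every context. -/
def Sim (M : Model C) {X Y : Ob} (f : X.ev M.ob ⟶ Y.ev M.ob) (xs : List ℕ) (E : List Box)
    (ys : List ℕ) : Prop :=
  xs.map ty = X.flat [] ∧ ys.map ty = Y.flat [] ∧
    ∀ {r : List ℕ} {D : List Box} {t : List ℕ} {Q T : List Srt}
      {k : obj M.ob (Y.flat Q) ⟶ obj M.ob T}, Q = r.map ty →
      Den M (ys ++ r) D t k → Den M (xs ++ r) (E ++ D) t (lift f Q ≫ k)

theorem Sim.comp {X Y Z : Ob} {f : X.ev M.ob ⟶ Y.ev M.ob} {g : Y.ev M.ob ⟶ Z.ev M.ob}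
    {xs ys zs : List ℕ} {E F : List Box} (hf : Sim M f xs E ys) (hg : Sim M g ys F zs) :
    Sim M (f ≫ g) xs (E ++ F) zs := by
  refine ⟨hf.1, hg.2.1, fun hQ h => ?_⟩
  rw [lift_comp, Category.assoc, List.append_assoc]
  exact hf.2.2 hQ (hg.2.2 hQ h)

theorem Sim.whiskerRight {X Y : Ob} {f : X.ev M.ob ⟶ Y.ev M.ob} {xs ys zs : List ℕ}
    {E : List Box} (hf : Sim M f xs E ys) {Z : Ob} (hz : zs.map ty = Z.flat []) :
    Sim M (X := .ten X Z) (Y := .ten Y Z) (f ▷ Z.ev M.ob) (xs ++ zs) E (ys ++ zs) := by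
  refine ⟨?_, ?_, fun {r D t Q T k} hQ h => ?_⟩
  · rw [map_ty_append hf.1, hz]; rfl
  · rw [map_ty_append hf.2.1, hz]; rfl
  · rw [lift_whiskerRight]
    rw [List.append_assoc] at h ⊢
    exact hf.2.2 (by rw [hQ, map_ty_append hz]) h

/-- `Sim` allows spectators on the right only. A factor on the left is therefore moved behind the
inputs before `E` and back afterwards. -/
theorem Sim.whiskerLeft {X Y : Ob} {f : X.ev M.ob ⟶ Y.ev M.ob} {xs ys zs : List ℕ}
    {E : List Box} (hf : Sim M f xs E ys) {Z : Ob} (hz : zs.map ty = Z.flat []) :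
    Sim M (X := .ten Z X) (Y := .ten Z Y) (Z.ev M.ob ◁ f) (zs ++ xs) E (zs ++ ys) := by
  refine ⟨?_, ?_, fun {r D t Q T k} hQ h => ?_⟩
  · rw [map_ty_append hz, hf.1]; rfl
  · rw [map_ty_append hz, hf.2.1]; rfl
  · rw [lift_whiskerLeft]
    rw [List.append_assoc] at h ⊢
    subst hQ
    have h1 := h.precomp (Sh.bs hf.2.1 hz r)
    have h2 := hf.2.2 (r := zs ++ r) (by rw [map_ty_append hz]) h1
    have h3 := h2.precomp (Sh.bs hz hf.1 r)
    exact cast (congrArg (Den M _ _ _) (bs_lift_bs f (r.map ty) k)) h3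

theorem Sim.nop {X Y : Ob} {f : X.ev M.ob ⟶ Y.ev M.ob} {xs : List ℕ}
    (hx : xs.map ty = X.flat []) (hy : xs.map ty = Y.flat [])
    (h : ∀ {Q T : List Srt} (k : obj M.ob (Y.flat Q) ⟶ obj M.ob T) (s : List ℕ) (D : List Box)
      (t : List ℕ), Den M s D t k → Den M s D t (lift f Q ≫ k)) : Sim M f xs [] xs :=
  ⟨hx, hy, fun _ hk => h _ _ _ _ hk⟩

theorem Den.id_comp {s t : List ℕ} {D : List Box} {S T : List Srt}
    {k : obj M.ob S ⟶ obj M.ob T} {e : obj M.ob S ⟶ obj M.ob S} (h : e = 𝟙 _)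
    (hk : Den M s D t k) : Den M s D t (e ≫ k) := by
  rwa [h, Category.id_comp]

theorem Sim.braid {X Y : Ob} {xs ys : List ℕ} (hx : xs.map ty = X.flat [])
    (hy : ys.map ty = Y.flat []) :
    Sim M (X := .ten X Y) (Y := .ten Y X) (β_ (X.ev M.ob) (Y.ev M.ob)).hom (xs ++ ys) []
      (ys ++ xs) := by
  refine ⟨?_, ?_, fun {r D t Q T k} hQ hk => ?_⟩
  · rw [map_ty_append hx, hy]; rfl
  · rw [map_ty_append hy, hx]; rfl
  · subst hQ
    rw [lift_braid]
    rw [List.append_assoc] at hk ⊢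
    exact hk.precomp (Sh.bs hx hy r)

theorem Sim.gen {g : Gen} {xs ys : List ℕ} (hx : xs.map ty = g.dom.flat [])
    (hy : ys.map ty = g.cod.flat []) : Sim M (M.hom g) xs [⟨g, xs, ys⟩] ys := by
  refine ⟨hx, hy, fun {r D t Q T k} hQ hk => ?_⟩
  subst hQ
  have h := Sh.refl (ob := M.ob) (ty := ty) (xs ++ r)
  rw [map_ty_append hx] at h
  have := Den.cons (g := g) (Q := r.map ty) hx hy h hk
  rwa [Category.id_comp] at this

theorem freshNames_map_ty (l : List Srt) (n : ℕ) : (freshNames l n).map ty = l := by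
  induction l generalizing n with
  | nil => rfl
  | cons s l ih =>
    cases s
    · simp [freshNames, ih, ty]
    · have : (2 * n + 1) % 2 = 1 := by omega
      simp [freshNames, ih, ty, this]

theorem take_drop_of_map_ty {X Y : Ob} {xs : List ℕ} (h : xs.map ty = (Ob.ten X Y).flat []) :
    (xs.take X.size).map ty = X.flat [] ∧ (xs.drop X.size).map ty = Y.flat [] ∧
      xs = xs.take X.size ++ xs.drop X.size := by
  obtain ⟨i, j, rfl, h1, h2⟩ := map_ty_ten h
  have : X.size = i.length := by rw [← Ob.flat_length, ← h1, List.length_map]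
  rw [this, List.take_left, List.drop_left]
  exact ⟨h1, h2, rfl⟩

/-- Induction closes because `Sim` quantifies over the spectators and over the rest of the diagram:
whiskering enlarges the former, composition the latter. -/
theorem Expr.compile_sim {X Y : Ob} (e : Expr X Y) (xs : List ℕ) (n : ℕ)
    (hx : xs.map ty = X.flat []) :
    Sim M (e.eval M) xs (e.compile xs n).D (e.compile xs n).t := by
  induction e generalizing xs n with
  | id X => exact Sim.nop hx hx fun k _ _ _ hk => Den.id_comp (lift_id _ _) hk
  | comp f g ih ih' =>
    have h := ih xs n hx
    exact h.comp (ih' _ _ h.2.1)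
  | whiskerLeft X f ih =>
    obtain ⟨h1, h2, h3⟩ := take_drop_of_map_ty hx
    have := (ih _ n h2).whiskerLeft h1
    rwa [← h3] at this
  | whiskerRight f Z ih =>
    obtain ⟨h1, h2, h3⟩ := take_drop_of_map_ty hx
    have := (ih _ n h1).whiskerRight h2
    rwa [← h3] at this
  | @tensor X Y Z W f g ih ih' =>
    obtain ⟨h1, h2, h3⟩ := take_drop_of_map_ty hx
    have h := ih _ n h1
    have := (h.whiskerRight h2).comp ((ih' _ (f.compile (xs.take X.size) n).n h2).whiskerLeft h.2.1)
    rw [← h3] at this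
    have e : (Expr.tensor f g).eval M = (f.eval M ▷ Z.ev M.ob) ≫ (Y.ev M.ob ◁ g.eval M) :=
      tensorHom_def _ _
    rw [e]
    exact this
  | assoc X Y Z =>
    exact Sim.nop hx hx fun k _ _ _ hk => Den.id_comp (lift_assoc _ _ _ _) hk
  | assocInv X Y Z =>
    exact Sim.nop hx hx fun k _ _ _ hk => Den.id_comp (lift_assocInv _ _ _ _) hk
  | left X =>
    exact Sim.nop hx hx fun k _ _ _ hk => Den.id_comp (lift_left _ _) hk
  | leftInv X =>
    exact Sim.nop hx hx fun k _ _ _ hk => Den.id_comp (lift_leftInv _ _) hk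
  | right X =>
    exact Sim.nop hx hx fun k _ _ _ hk => Den.id_comp (lift_right _ _) hk
  | rightInv X =>
    exact Sim.nop hx hx fun k _ _ _ hk => Den.id_comp (lift_rightInv _ _) hk
  | braid X Y =>
    obtain ⟨h1, h2, h3⟩ := take_drop_of_map_ty hx
    have := Sim.braid (M := M) h1 h2
    rwa [← h3] at this
  | gen g => exact Sim.gen hx (freshNames_map_ty _ _)

/-- The input wires of an expression. -/
def inputs (X : Ob) : List ℕ := freshNames (X.flat []) 0

/-- The diagram of an expression. -/
def Expr.state {X Y : Ob} (e : Expr X Y) : State := e.compile (inputs X) X.size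

theorem Expr.den {X Y : Ob} (e : Expr X Y) :
    Den M (inputs X) e.state.D e.state.t (lift (e.eval M) []) := by
  have h := e.compile_sim (M := M) (inputs X) X.size (freshNames_map_ty _ _)
  -- Simulation is used with no spectators and with the identity as continuation.
  have h0 := Den.nil (M := M) (Sh.refl (ob := M.ob) (ty := ty) (e.state.t ++ []))
  have h1 : (e.state.t ++ []).map ty = Y.flat [] := by rw [List.append_nil]; exact h.2.1
  rw [h1] at h0
  have h2 := h.2.2 (Q := []) rfl h0
  rw [Category.comp_id, List.append_nil, List.append_nil, List.append_nil] at h2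
  exact h2

/-- On the empty word, lifting is whiskering with the unit object up to isomorphisms, and that is
faithful. -/
theorem lift_injective {X Y : Ob} {f g : X.ev M.ob ⟶ Y.ev M.ob} (h : lift f [] = lift g []) :
    f = g := by
  simp only [lift, Iso.cancel_iso_inv_left, Iso.cancel_iso_hom_right] at h
  exact (cancel_mono (ρ_ _).inv).1 (by
    have : f ▷ 𝟙_ C = g ▷ 𝟙_ C := h
    rw [rightUnitor_inv_naturality, rightUnitor_inv_naturality, this])

/-- Two expressions have equal values if scripts transform their diagrams into the same diagram. -/
theorem Expr.eval_eq {X Y : Ob} {e e' : Expr X Y} (is is' : List Instr)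
    (h : compare (inputs X) e.state e'.state is is' = true)
    [ScriptValid M is] [ScriptValid M is'] : e.eval M = e'.eval M :=
  lift_injective (compare_sound h e.den e'.den)

/-- The rule given by two expressions. -/
def Expr.rule {X Y : Ob} (e e' : Expr X Y) : Rule :=
  ⟨inputs X, e.state.D, e.state.t, e'.state.D, e'.state.t⟩

theorem Expr.rule_valid {X Y : Ob} {e e' : Expr X Y} (h : e.eval M = e'.eval M) :
    IsValid M (e.rule e') :=
  ⟨_, _, _, e.den, h ▸ e'.den⟩

end

/-! ### Rules that hold in every Hopf quasigroup -/

/-- The `n`-th wire of sort `s`. -/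
abbrev wire : Srt → ℕ → ℕ
  | .A, n => 2 * n
  | .H, n => 2 * n + 1

/-- The box of the product. -/
abbrev mu : Srt → ℕ → ℕ → ℕ → Box
  | .A, x, y, z => ⟨.mulA, [2 * x, 2 * y], [2 * z]⟩
  | .H, x, y, z => ⟨.mulH, [2 * x + 1, 2 * y + 1], [2 * z + 1]⟩

/-- The box of the unit. -/
abbrev eta : Srt → ℕ → Box
  | .A, x => ⟨.oneA, [], [2 * x]⟩
  | .H, x => ⟨.oneH, [], [2 * x + 1]⟩

/-- The box of the coproduct. -/
abbrev de : Srt → ℕ → ℕ → ℕ → Box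
  | .A, x, y, z => ⟨.comulA, [2 * x], [2 * y, 2 * z]⟩
  | .H, x, y, z => ⟨.comulH, [2 * x + 1], [2 * y + 1, 2 * z + 1]⟩

/-- The box of the counit. -/
abbrev ep : Srt → ℕ → Box
  | .A, x => ⟨.counitA, [2 * x], []⟩
  | .H, x => ⟨.counitH, [2 * x + 1], []⟩

/-- The box of the antipode. -/
abbrev an : Srt → ℕ → ℕ → Box
  | .A, x, y => ⟨.antA, [2 * x], [2 * y]⟩
  | .H, x, y => ⟨.antH, [2 * x + 1], [2 * y + 1]⟩

namespace Expr

/-- The product. -/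
def mul : ∀ s, Expr (.ten (.atom s) (.atom s)) (.atom s)
  | .A => .gen .mulA
  | .H => .gen .mulH

/-- The unit. -/
def one : ∀ s, Expr .unit (.atom s)
  | .A => .gen .oneA
  | .H => .gen .oneH

/-- The coproduct. -/
def comul : ∀ s, Expr (.atom s) (.ten (.atom s) (.atom s))
  | .A => .gen .comulA
  | .H => .gen .comulH

/-- The counit. -/
def counit : ∀ s, Expr (.atom s) .unit
  | .A => .gen .counitA
  | .H => .gen .counitH

/-- The antipode. -/
def ant : ∀ s, Expr (.atom s) (.atom s)
  | .A => .gen .antA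
  | .H => .gen .antH

/-- The exchange of the middle factors. -/
def tensorμ (X Y Z W : Ob) : Expr (.ten (.ten X Y) (.ten Z W)) (.ten (.ten X Z) (.ten Y W)) :=
  .comp (.assoc X Y (.ten Z W)) (.comp (.whiskerLeft X (.assocInv Y Z W))
    (.comp (.whiskerLeft X (.whiskerRight (.braid Y Z) W))
      (.comp (.whiskerLeft X (.assoc Z Y W)) (.assocInv X Z (.ten Y W)))))

/-- The coproduct of a tensor product. -/
def tensorComul (s s' : Srt) :
    Expr (.ten (.atom s) (.atom s')) (.ten (.ten (.atom s) (.atom s')) (.ten (.atom s) (.atom s'))) :=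
  .comp (.tensor (.comul s) (.comul s')) (tensorμ (.atom s) (.atom s) (.atom s') (.atom s'))

end Expr

/-- Composition of expressions. -/
infixr:80 " ⊚ " => Expr.comp

noncomputable section

variable {C : Type u} [Category.{v} C] [MonoidalCategory C] [SymmetricCategory C] {M : Model C}

/-- Transfers an equation of morphisms, as it occurs in the hypotheses, to a rule with readable
wires: one application of the compiled equation must turn the left-hand side of `r` into its
right-hand side. -/
theorem valid_of_expr {r : Rule} {X Y : Ob} {e e' : Expr X Y} (h : e.eval M = e'.eval M)
    (ht : r.test [e.rule e'] [] = true) : IsValid M r :=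
  haveI := Expr.rule_valid h
  r.valid_of_test _ _ ht

/-- A test can be evaluated only on closed terms, so it is run for both sorts before `s` is
specialized. -/
theorem valid_of_exprs {r : Srt → Rule} {X Y : Srt → Ob} (e e' : ∀ s, Expr (X s) (Y s)) {s : Srt}
    (h : (e s).eval M = (e' s).eval M)
    (ht : ((r .A).test [(e .A).rule (e' .A)] [] && (r .H).test [(e .H).rule (e' .H)] []) = true) :
    IsValid M (r s) := by
  rw [Bool.and_eq_true] at ht
  cases s
  · exact valid_of_expr h ht.1
  · exact valid_of_expr h ht.2

theorem valid_of_tests {r : Srt → Rule} (is is' : Srt → List Instr) {s : Srt}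
    (ht : ((r .A).test (is .A) (is' .A) && (r .H).test (is .H) (is' .H)) = true)
    [ScriptValid M (is s)] [ScriptValid M (is' s)] : IsValid M (r s) := by
  rw [Bool.and_eq_true] at ht
  cases s
  · exact Rule.valid_of_test _ _ ht.1
  · exact Rule.valid_of_test _ _ ht.2

/-- The structure on the sort `s` is a Hopf quasigroup. -/
class IsHQ (M : Model C) (s : Srt) : Prop where
  law : HopfQG.IsHopfQuasigroup (M.dat s)

end

section Rules

variable (s : Srt)

def oneMul : Rule := ⟨[wire s 0], [eta s 1, mu s 1 0 2], [wire s 2], [], [wire s 0]⟩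

def mulOne : Rule := ⟨[wire s 0], [eta s 1, mu s 0 1 2], [wire s 2], [], [wire s 0]⟩

def counitComul : Rule := ⟨[wire s 0], [de s 0 1 2, ep s 1], [wire s 2], [], [wire s 0]⟩

def comulCounit : Rule := ⟨[wire s 0], [de s 0 1 2, ep s 2], [wire s 1], [], [wire s 0]⟩

/-- Oriented towards right combs x₁ ⊗ (x₂ ⊗ (x₃ ⊗ …)), the form in which iterated coproducts are
compared. -/
def coassoc : Rule :=
  ⟨[wire s 0], [de s 0 1 2, de s 1 3 4], [wire s 3, wire s 4, wire s 2],
    [de s 0 3 5, de s 5 4 2], [wire s 3, wire s 4, wire s 2]⟩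

def oneCounit : Rule := ⟨[], [eta s 0, ep s 0], [], [], []⟩

def mulCounit : Rule := ⟨[wire s 0, wire s 1], [mu s 0 1 2, ep s 2], [], [ep s 0, ep s 1], []⟩

def oneComul : Rule :=
  ⟨[], [eta s 0, de s 0 1 2], [wire s 1, wire s 2], [eta s 1, eta s 2], [wire s 1, wire s 2]⟩

def mulComul : Rule :=
  ⟨[wire s 0, wire s 1], [mu s 0 1 2, de s 2 3 4], [wire s 3, wire s 4],
    [de s 0 5 6, de s 1 7 8, mu s 5 7 3, mu s 6 8 4], [wire s 3, wire s 4]⟩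

/-- `S(x₁)(x₂y) = ε(x)y` -/
def antMul : Rule :=
  ⟨[wire s 0, wire s 1], [de s 0 2 3, an s 2 4, mu s 3 1 5, mu s 4 5 6], [wire s 6], [ep s 0],
    [wire s 1]⟩

/-- `x₁(S(x₂)y) = ε(x)y` -/
def mulAnt : Rule :=
  ⟨[wire s 0, wire s 1], [de s 0 2 3, an s 3 4, mu s 4 1 5, mu s 2 5 6], [wire s 6], [ep s 0],
    [wire s 1]⟩

/-- `(yS(x₁))x₂ = yε(x)` -/
def mulAntMul : Rule :=
  ⟨[wire s 1, wire s 0], [de s 0 2 3, an s 2 4, mu s 1 4 5, mu s 5 3 6], [wire s 6], [ep s 0],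
    [wire s 1]⟩

/-- `(yx₁)S(x₂) = yε(x)` -/
def mulMulAnt : Rule :=
  ⟨[wire s 1, wire s 0], [de s 0 2 3, an s 3 4, mu s 1 2 5, mu s 5 4 6], [wire s 6], [ep s 0],
    [wire s 1]⟩

end Rules

section

variable {C : Type u} [Category.{v} C] [MonoidalCategory C] [SymmetricCategory C] {M : Model C}
  {s : Srt} [h : IsHQ M s]

instance : IsValid M (oneMul s) :=
  valid_of_exprs (r := oneMul) (fun s => .whiskerRight (.one s) (.atom s) ⊚ .mul s)
    (fun s => .left (.atom s))
    (by cases s <;> exact h.law.bimonoid.magma.one_mul) (by decide +kernel)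

instance : IsValid M (mulOne s) :=
  valid_of_exprs (r := mulOne) (fun s => .whiskerLeft (.atom s) (.one s) ⊚ .mul s)
    (fun s => .right (.atom s))
    (by cases s <;> exact h.law.bimonoid.magma.mul_one) (by decide +kernel)

instance : IsValid M (counitComul s) :=
  valid_of_exprs (r := counitComul) (fun s => .comul s ⊚ .whiskerRight (.counit s) (.atom s))
    (fun s => .leftInv (.atom s))
    (by cases s <;> exact h.law.bimonoid.comonoid.counit_comul) (by decide +kernel)

instance : IsValid M (comulCounit s) :=
  valid_of_exprs (r := comulCounit) (fun s => .comul s ⊚ .whiskerLeft (.atom s) (.counit s))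
    (fun s => .rightInv (.atom s))
    (by cases s <;> exact h.law.bimonoid.comonoid.comul_counit) (by decide +kernel)

instance : IsValid M (coassoc s) :=
  valid_of_exprs (r := coassoc) (fun s => .comul s ⊚ .whiskerRight (.comul s) (.atom s) ⊚ .assoc (.atom s) (.atom s) (.atom s))
    (fun s => .comul s ⊚ .whiskerLeft (.atom s) (.comul s))
    (by cases s <;> exact h.law.bimonoid.comonoid.comul_assoc.symm) (by decide +kernel)

instance : IsValid M (oneCounit s) :=
  valid_of_exprs (r := oneCounit) (fun s => .one s ⊚ .counit _)
    (fun s => .id .unit)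
    (by cases s <;> exact h.law.bimonoid.one_counit) (by decide +kernel)

instance : IsValid M (mulCounit s) :=
  valid_of_exprs (r := mulCounit) (fun s => .mul s ⊚ .counit _)
    (fun s => .tensor (.counit s) (.counit s) ⊚ .left .unit)
    (by cases s <;> exact h.law.bimonoid.mul_counit) (by decide +kernel)

instance : IsValid M (oneComul s) :=
  valid_of_exprs (r := oneComul) (fun s => .one s ⊚ .comul s)
    (fun s => .leftInv .unit ⊚ .tensor (.one s) (.one s))
    (by cases s <;> exact h.law.bimonoid.one_comul) (by decide +kernel)

instance : IsValid M (mulComul s) :=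
  valid_of_exprs (r := mulComul) (fun s => .mul s ⊚ .comul s)
    (fun s => .tensorComul s s ⊚ .tensor (.mul s) (.mul s))
    (by cases s <;> exact h.law.bimonoid.mul_comul) (by decide +kernel)

instance : IsValid M (antMul s) :=
  valid_of_exprs (r := antMul) (fun s => .whiskerRight (.comul s) (.atom s) ⊚
      .assoc (.atom s) (.atom s) (.atom s) ⊚ .tensor (.ant s) (.mul s) ⊚ .mul s)
    (fun s => .whiskerRight (.counit s) (.atom s) ⊚ .left (.atom s))
    (by cases s <;> exact h.law.hasAntipode.left₁) (by decide +kernel)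

instance : IsValid M (mulAnt s) :=
  valid_of_exprs (r := mulAnt) (fun s => .whiskerRight (.comul s) (.atom s) ⊚
      .assoc (.atom s) (.atom s) (.atom s) ⊚ .whiskerLeft (.atom s) (.whiskerRight (.ant s) (.atom s)) ⊚
      .whiskerLeft (.atom s) (.mul s) ⊚ .mul s)
    (fun s => .whiskerRight (.counit s) (.atom s) ⊚ .left (.atom s))
    (by cases s <;> exact h.law.hasAntipode.left₂) (by decide +kernel)

instance : IsValid M (mulAntMul s) :=
  valid_of_exprs (r := mulAntMul) (fun s => .whiskerLeft (.atom s) (.comul s) ⊚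
      .assocInv (.atom s) (.atom s) (.atom s) ⊚ .whiskerRight (.whiskerLeft (.atom s) (.ant s)) (.atom s) ⊚
      .whiskerRight (.mul s) (.atom s) ⊚ .mul s)
    (fun s => .whiskerLeft (.atom s) (.counit s) ⊚ .right (.atom s))
    (by cases s <;> exact h.law.hasAntipode.right₁) (by decide +kernel)

instance : IsValid M (mulMulAnt s) :=
  valid_of_exprs (r := mulMulAnt) (fun s => .whiskerLeft (.atom s) (.comul s) ⊚
      .assocInv (.atom s) (.atom s) (.atom s) ⊚ .tensor (.mul s) (.ant s) ⊚ .mul s)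
    (fun s => .whiskerLeft (.atom s) (.counit s) ⊚ .right (.atom s))
    (by cases s <;> exact h.law.hasAntipode.right₂) (by decide +kernel)

end

/-! ### Consequences of the Hopf quasigroup axioms -/

section Rules

variable (s : Srt)

/-- `x = x₁ε(x₂)` -/
def pad : Rule := ⟨[wire s 0], [], [wire s 0], [de s 0 1 2, ep s 2], [wire s 1]⟩

/-- In a right comb two consecutive legs are not the outputs of a single coproduct unless they are
the last ones. The rules ending in `Mid` cancel such legs and keep the remainder; writing an input
as x₁ε(x₂) beforehand supplies a remainder everywhere. -/
def antMulMid : Rule :=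
  ⟨[wire s 0, wire s 1], [de s 0 2 7, de s 7 3 8, an s 2 4, mu s 3 1 5, mu s 4 5 6],
    [wire s 6, wire s 8], [], [wire s 1, wire s 0]⟩

def mulAntMid : Rule :=
  ⟨[wire s 0, wire s 1], [de s 0 2 7, de s 7 3 8, an s 3 4, mu s 4 1 5, mu s 2 5 6],
    [wire s 6, wire s 8], [], [wire s 1, wire s 0]⟩

def mulAntMulMid : Rule :=
  ⟨[wire s 0, wire s 1], [de s 0 2 7, de s 7 3 8, an s 2 4, mu s 1 4 5, mu s 5 3 6],
    [wire s 6, wire s 8], [], [wire s 1, wire s 0]⟩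

def mulMulAntMid : Rule :=
  ⟨[wire s 0, wire s 1], [de s 0 2 7, de s 7 3 8, an s 3 4, mu s 1 2 5, mu s 5 4 6],
    [wire s 6, wire s 8], [], [wire s 1, wire s 0]⟩

/-- `S(x₁)x₂ = ε(x)1` -/
def antConv : Rule :=
  ⟨[wire s 0], [de s 0 2 3, an s 2 4, mu s 4 3 5], [wire s 5], [ep s 0, eta s 1], [wire s 1]⟩

/-- `x₁S(x₂) = ε(x)1` -/
def convAnt : Rule :=
  ⟨[wire s 0], [de s 0 2 3, an s 3 4, mu s 2 4 5], [wire s 5], [ep s 0, eta s 1], [wire s 1]⟩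

def antConvMid : Rule :=
  ⟨[wire s 0], [de s 0 2 7, de s 7 3 8, an s 2 4, mu s 4 3 5], [wire s 5, wire s 8],
    [eta s 1], [wire s 1, wire s 0]⟩

def convAntMid : Rule :=
  ⟨[wire s 0], [de s 0 2 7, de s 7 3 8, an s 3 4, mu s 2 4 5], [wire s 5, wire s 8],
    [eta s 1], [wire s 1, wire s 0]⟩

def oneAnt : Rule := ⟨[], [eta s 0, an s 0 1], [wire s 1], [eta s 0], [wire s 0]⟩

def antCounit : Rule := ⟨[wire s 0], [an s 0 1, ep s 1], [], [ep s 0], []⟩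

/-- `δ(S(x)) = S(x₂) ⊗ S(x₁)` -/
def antComul : Rule :=
  ⟨[wire s 0], [an s 0 1, de s 1 2 3], [wire s 2, wire s 3], [de s 0 4 5, an s 5 2, an s 4 3],
    [wire s 2, wire s 3]⟩

/-- `S(x₁y)x₂ = ε(x)S(y)` -/
def antMulConv : Rule :=
  ⟨[wire s 0, wire s 1], [de s 0 2 3, mu s 2 1 4, an s 4 5, mu s 5 3 6], [wire s 6],
    [ep s 0, an s 1 2], [wire s 2]⟩

def antMulConvMid : Rule :=
  ⟨[wire s 0, wire s 1], [de s 0 2 7, de s 7 3 8, mu s 2 1 4, an s 4 5, mu s 5 3 6],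
    [wire s 6, wire s 8], [an s 1 2], [wire s 2, wire s 0]⟩

/-- `S(xy) = S(y)S(x)` -/
def mulAntipode : Rule :=
  ⟨[wire s 0, wire s 1], [mu s 0 1 2, an s 2 3], [wire s 3], [an s 0 2, an s 1 4, mu s 4 2 3],
    [wire s 3]⟩

/-- Rules for units, counits and coproducts. -/
def bialgebraRules : List Rule :=
  [counitComul s, oneMul s, mulOne s, oneCounit s, mulCounit s, oneComul s,
    mulComul s, coassoc s]

/-- The antipode identities. -/
def antipodeRules : List Rule :=
  [antMul s, mulAnt s, mulAntMul s, mulMulAnt s, antMulMid s, mulAntMid s, mulAntMulMid s,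
    mulMulAntMid s, antConv s, convAnt s, antConvMid s, convAntMid s]

end Rules

section

variable {C : Type u} [Category.{v} C] [MonoidalCategory C] [SymmetricCategory C] {M : Model C}
  {s : Srt} [h : IsHQ M s]

instance : AllValid M (bialgebraRules s) := by
  unfold bialgebraRules; infer_instance

instance : IsValid M (pad s) :=
  valid_of_tests (r := pad) (fun _ => []) (fun s => [comulCounit s]) (by decide +kernel)

instance : IsValid M (antMulMid s) :=
  valid_of_tests (r := antMulMid) (fun s => [(coassoc s).rev, antMul s, counitComul s])
    (fun _ => []) (by decide +kernel)

instance : IsValid M (mulAntMid s) :=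
  valid_of_tests (r := mulAntMid) (fun s => [(coassoc s).rev, mulAnt s, counitComul s])
    (fun _ => []) (by decide +kernel)

instance : IsValid M (mulAntMulMid s) :=
  valid_of_tests (r := mulAntMulMid) (fun s => [(coassoc s).rev, mulAntMul s, counitComul s])
    (fun _ => []) (by decide +kernel)

instance : IsValid M (mulMulAntMid s) :=
  valid_of_tests (r := mulMulAntMid) (fun s => [(coassoc s).rev, mulMulAnt s, counitComul s])
    (fun _ => []) (by decide +kernel)

instance : IsValid M (antConv s) :=
  valid_of_tests (r := antConv) (fun s => [.one (mulOne s).rev [(wire s 0, wire s 3)], antMul s])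
    (fun _ => []) (by decide +kernel)

instance : IsValid M (convAnt s) :=
  valid_of_tests (r := convAnt) (fun s => [.one (mulOne s).rev [(wire s 0, wire s 4)], mulAnt s])
    (fun _ => []) (by decide +kernel)

instance : IsValid M (antConvMid s) :=
  valid_of_tests (r := antConvMid) (fun s => [(coassoc s).rev, antConv s, counitComul s])
    (fun _ => []) (by decide +kernel)

instance : IsValid M (convAntMid s) :=
  valid_of_tests (r := convAntMid) (fun s => [(coassoc s).rev, convAnt s, counitComul s])
    (fun _ => []) (by decide +kernel)

instance : AllValid M (antipodeRules s) := by
  unfold antipodeRules; infer_instance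

/-- 1 = ε(1)1 = S(1)(1·1). -/
instance : IsValid M (oneAnt s) :=
  valid_of_tests (r := oneAnt) (fun _ => [])
    (fun s => [(oneCounit s).rev, .one (antMul s).rev [(wire s 1, wire s 0)],
      .norm (comulCounit s :: bialgebraRules s) 2]) (by decide +kernel)

/-- Apply ε to ε(x)1 = S(x₁)(x₂1). -/
instance : IsValid M (antCounit s) :=
  valid_of_tests (r := antCounit) (fun _ => [])
    (fun s => [(oneCounit s).rev, .one (antMul s).rev [(wire s 0, wire s 0), (wire s 1, wire s 1)],
      .norm (comulCounit s :: bialgebraRules s) 2]) (by decide +kernel)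

/-- With z = xy₁, ε(x)S(y) = ε(z)S(y₂) = S(z₁)(z₂S(y₂)) = S(x₁y₁)((x₂y₂)S(y₃)) = S(x₁y)x₂. No
associativity is involved. -/
instance : IsValid M (antMulConv s) :=
  valid_of_tests (r := antMulConv) (fun s => [.norm (comulCounit s :: bialgebraRules s ++ antipodeRules s) 2])
    (fun s => [.one (counitComul s).rev [(wire s 0, wire s 1)],
      .one (mulCounit s).rev [(wire s 0, wire s 0), (wire s 1, wire s 3)],
      .one (antMul s).rev [(wire s 0, wire s 5), (wire s 1, wire s 2)],
      .norm (comulCounit s :: bialgebraRules s ++ antipodeRules s) 2]) (by decide +kernel)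

instance : IsValid M (antMulConvMid s) :=
  valid_of_tests (r := antMulConvMid)
    (fun s => [(coassoc s).rev, antMulConv s, counitComul s]) (fun _ => []) (by decide +kernel)

/-- S(xy) = (S(x₁y)x₂)S(x₃) = S(y)S(x), by `antMulConv`. -/
instance : IsValid M (mulAntipode s) :=
  valid_of_tests (r := mulAntipode)
    (fun s => [.one (pad s) [(wire s 0, wire s 0)], .one (mulMulAnt s).rev [(wire s 1, wire s 3)],
      antMulConvMid s]) (fun _ => []) (by decide +kernel)

/-- Multiply S(x₂) ⊗ S(x₁) from the right by δ(x₃S(x₄)) = ε(x₃)1 ⊗ 1. Each tensor factor then has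
the form S(u)(vz), and the legs cancel from the inside, leaving δ(S(x)). -/
instance : IsValid M (antComul s) :=
  valid_of_tests (r := antComul) (fun _ => [])
    (fun s => [.one (mulOne s).rev [(wire s 0, wire s 2)],
      .one (mulOne s).rev [(wire s 0, wire s 3)], .one (oneComul s).rev [(wire s 1, wire s 6)],
      .one (pad s) [(wire s 0, wire s 0)], (convAnt s).rev,
      .norm (comulCounit s :: bialgebraRules s ++ antipodeRules s) 2, .norm [(coassoc s).rev] 1,
      .one (coassoc s) [(wire s 0, wire s 25)], .one (coassoc s) [(wire s 0, wire s 25)],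
      .norm [antMul s, antMulMid s, counitComul s] 2]) (by decide +kernel)

end

/-! ### Rules for the pairing, the quasitriangular structure and the morphism `q` -/

/-- The box of the pairing. -/
abbrev ta (a h : ℕ) : Box := ⟨.tau, [2 * a, 2 * h + 1], []⟩

/-- The box of `q`. -/
abbrev qu (a h : ℕ) : Box := ⟨.q, [2 * a], [2 * h + 1]⟩

/-- The box of the quasitriangular structure. -/
abbrev rm (h k : ℕ) : Box := ⟨.rmat, [], [2 * h + 1, 2 * k + 1]⟩

def tauMulLeft : Rule :=
  ⟨[wire .A 0, wire .A 1, wire .H 2], [mu .A 0 1 3, ta 3 2], [], [de .H 2 4 5, ta 0 4, ta 1 5], []⟩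

def tauMulRight : Rule :=
  ⟨[wire .A 0, wire .H 1, wire .H 2], [mu .H 1 2 3, ta 0 3], [], [de .A 0 4 5, ta 5 1, ta 4 2], []⟩

def tauOneRight : Rule := ⟨[wire .A 0], [eta .H 1, ta 0 1], [], [ep .A 0], []⟩

def tauOneLeft : Rule := ⟨[wire .H 0], [eta .A 1, ta 1 0], [], [ep .H 0], []⟩

def rComulLeft : Rule :=
  ⟨[], [rm 0 1, de .H 0 2 3], [wire .H 2, wire .H 3, wire .H 1], [rm 2 4, rm 3 5, mu .H 4 5 1],
    [wire .H 2, wire .H 3, wire .H 1]⟩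

def rComulRight : Rule :=
  ⟨[], [rm 0 1, de .H 1 2 3], [wire .H 0, wire .H 2, wire .H 3], [rm 4 3, rm 5 2, mu .H 4 5 0],
    [wire .H 0, wire .H 2, wire .H 3]⟩

def rComulComm : Rule :=
  ⟨[wire .H 0], [de .H 0 1 2, rm 3 4, mu .H 2 3 5, mu .H 1 4 6], [wire .H 5, wire .H 6],
    [de .H 0 1 2, rm 3 4, mu .H 3 1 5, mu .H 4 2 6], [wire .H 5, wire .H 6]⟩

def rCounitLeft : Rule := ⟨[], [rm 0 1, ep .H 0], [wire .H 1], [eta .H 1], [wire .H 1]⟩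

def rCounitRight : Rule := ⟨[], [rm 0 1, ep .H 1], [wire .H 0], [eta .H 0], [wire .H 0]⟩

def qDef : Rule := ⟨[wire .A 0], [qu 0 1], [wire .H 1], [rm 2 1, ta 0 2], [wire .H 1]⟩

def oneQ : Rule := ⟨[], [eta .A 0, qu 0 1], [wire .H 1], [eta .H 1], [wire .H 1]⟩

def mulQ : Rule :=
  ⟨[wire .A 0, wire .A 1], [mu .A 0 1 2, qu 2 3], [wire .H 3], [qu 0 2, qu 1 4, mu .H 2 4 3],
    [wire .H 3]⟩

def qCounit : Rule := ⟨[wire .A 0], [qu 0 1, ep .H 1], [], [ep .A 0], []⟩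

def qComul : Rule :=
  ⟨[wire .A 0], [qu 0 1, de .H 1 2 3], [wire .H 2, wire .H 3], [de .A 0 4 5, qu 4 2, qu 5 3],
    [wire .H 2, wire .H 3]⟩

/-- `q(S(a)) = S(q(a))` -/
def antQ : Rule :=
  ⟨[wire .A 0], [an .A 0 1, qu 1 2], [wire .H 2], [qu 0 3, an .H 3 2], [wire .H 2]⟩

/-- `(q(a)h)k = q(a)(hk)` -/
def qAssocLeft : Rule :=
  ⟨[wire .A 0, wire .H 1, wire .H 2], [qu 0 3, mu .H 3 1 4, mu .H 4 2 5], [wire .H 5],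
    [qu 0 3, mu .H 1 2 4, mu .H 3 4 5], [wire .H 5]⟩

/-- `(hq(a))k = h(q(a)k)` -/
def qAssocMid : Rule :=
  ⟨[wire .A 0, wire .H 1, wire .H 2], [qu 0 3, mu .H 1 3 4, mu .H 4 2 5], [wire .H 5],
    [qu 0 3, mu .H 3 2 4, mu .H 1 4 5], [wire .H 5]⟩

/-- `h₁q(a₁)τ(a₂, h₂) = τ(a₁, h₁)q(a₂)h₂` -/
def qTwist : Rule :=
  ⟨[wire .A 0, wire .H 1], [de .H 1 2 3, de .A 0 4 5, qu 4 6, mu .H 2 6 7, ta 5 3], [wire .H 7],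
    [de .H 1 2 3, de .A 0 4 5, ta 4 2, qu 5 6, mu .H 6 3 7], [wire .H 7]⟩

variable {C : Type u} [Category.{v} C] [MonoidalCategory C] [SymmetricCategory C]

/-- The pairing is a skew pairing. -/
class IsPairing (M : Model C) : Prop where
  law : HopfQG.IsSkewPairing (M.dat .A) (M.dat .H) M.tau

/-- The morphism `q` is a morphism of Hopf quasigroups. -/
class IsHom (M : Model C) : Prop where
  law : HopfQG.IsHopfQuasigroupHom (M.dat .A) (M.dat .H) M.q

/-- The morphism `q` is induced by the pairing and the quasitriangular structure. -/
class IsInduced (M : Model C) : Prop where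
  law : HopfQG.IsQuasitriangular (M.dat .H) M.R
  q_eq : M.q = HopfQG.pairingR M.tau M.R

/-- The image of `q` associates with all elements. -/
class IsNuclear (M : Model C) : Prop where
  left : (((M.q ▷ M.ob .H) ≫ (M.dat .H).mul) ▷ M.ob .H) ≫ (M.dat .H).mul =
    (α_ (M.ob .A) (M.ob .H) (M.ob .H)).hom ≫ (M.ob .A ◁ (M.dat .H).mul) ≫
      (M.q ▷ M.ob .H) ≫ (M.dat .H).mul
  mid : (M.ob .H ◁ ((M.q ▷ M.ob .H) ≫ (M.dat .H).mul)) ≫ (M.dat .H).mul =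
    (M.ob .H ◁ (M.q ▷ M.ob .H)) ≫ (α_ (M.ob .H) (M.ob .H) (M.ob .H)).inv ≫
      ((M.dat .H).mul ▷ M.ob .H) ≫ (M.dat .H).mul

variable {M : Model C}

/-- The object `A`. -/
abbrev Ob.A : Ob := .atom .A

/-- The object `H`. -/
abbrev Ob.H : Ob := .atom .H

namespace Expr

open Ob

/-- The pairing. -/
abbrev tau : Expr (.ten A H) .unit := .gen .tau

/-- The morphism `q`. -/
abbrev q : Expr A H := .gen .q

/-- The quasitriangular structure. -/
abbrev rmat : Expr .unit (.ten H H) := .gen .rmat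

/-- The product of a tensor product. -/
def tensorMul (s s' : Srt) :
    Expr (.ten (.ten (.atom s) (.atom s')) (.ten (.atom s) (.atom s'))) (.ten (.atom s) (.atom s')) :=
  tensorμ (.atom s) (.atom s') (.atom s) (.atom s') ⊚ .tensor (.mul s) (.mul s')

end Expr

section

variable [h : IsPairing M]

instance : IsValid M tauMulLeft :=
  valid_of_expr (e := .whiskerRight (.mul .A) .H ⊚ .tau)
    (e' := .whiskerLeft (.ten .A .A) (.comul .H) ⊚ .tensorμ .A .A .H .H ⊚ .tensor .tau .tau ⊚
      .left .unit) h.law.mul_left (by decide +kernel)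

instance : IsValid M tauMulRight :=
  valid_of_expr (e := .whiskerLeft .A (.mul .H) ⊚ .tau)
    (e' := .whiskerRight (.comul .A ⊚ .braid .A .A) (.ten .H .H) ⊚ .tensorμ .A .A .H .H ⊚
      .tensor .tau .tau ⊚ .left .unit) h.law.mul_right (by decide +kernel)

instance : IsValid M tauOneRight :=
  valid_of_expr (e := .whiskerLeft .A (.one .H) ⊚ .tau) (e' := .right .A ⊚ .counit .A)
    h.law.one_right (by decide +kernel)

instance : IsValid M tauOneLeft :=
  valid_of_expr (e := .whiskerRight (.one .A) .H ⊚ .tau) (e' := .left .H ⊚ .counit .H)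
    h.law.one_left (by decide +kernel)

end

section

variable [h : IsInduced M]

instance : IsValid M rComulLeft :=
  valid_of_expr (e := .rmat ⊚ .whiskerRight (.comul .H) .H)
    (e' := .leftInv .unit ⊚ .tensor .rmat .rmat ⊚ .tensorμ .H .H .H .H ⊚
      .whiskerLeft (.ten .H .H) (.mul .H)) h.law.comul_left (by decide +kernel)

instance : IsValid M rComulRight :=
  valid_of_expr (e := .rmat ⊚ .whiskerLeft .H (.comul .H))
    (e' := .leftInv .unit ⊚ .tensor .rmat .rmat ⊚ .tensorμ .H .H .H .H ⊚
      .tensor (.mul .H) (.braid .H .H)) h.law.comul_right (by decide +kernel)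

instance : IsValid M rComulComm :=
  valid_of_expr (e := .rightInv .H ⊚ .tensor (.comul .H ⊚ .braid .H .H) .rmat ⊚ .tensorMul .H .H)
    (e' := .leftInv .H ⊚ .tensor .rmat (.comul .H) ⊚ .tensorMul .H .H)
    h.law.comul_comm (by decide +kernel)

instance : IsValid M rCounitLeft :=
  valid_of_expr (e := .rmat ⊚ .whiskerRight (.counit .H) .H ⊚ .left .H) (e' := .one .H)
    h.law.counit_left (by decide +kernel)

instance : IsValid M rCounitRight :=
  valid_of_expr (e := .rmat ⊚ .whiskerLeft .H (.counit .H) ⊚ .right .H) (e' := .one .H)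
    h.law.counit_right (by decide +kernel)

instance : IsValid M qDef :=
  valid_of_expr (e := .q) (e' := .rightInv .A ⊚ .whiskerLeft .A .rmat ⊚ .assocInv .A .H .H ⊚
    .whiskerRight .tau .H ⊚ .left .H) h.q_eq (by decide +kernel)

end

section

variable [h : IsHom M]

instance : IsValid M oneQ :=
  valid_of_expr (e := .one .A ⊚ .q) (e' := .one .H) h.law.one (by decide +kernel)

instance : IsValid M mulQ :=
  valid_of_expr (e := .mul .A ⊚ .q) (e' := .tensor .q .q ⊚ .mul .H) h.law.mul (by decide +kernel)

instance : IsValid M qCounit :=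
  valid_of_expr (e := .q ⊚ .counit .H) (e' := .counit .A) h.law.counit (by decide +kernel)

instance : IsValid M qComul :=
  valid_of_expr (e := .q ⊚ .comul .H) (e' := .comul .A ⊚ .tensor .q .q) h.law.comul
    (by decide +kernel)

end

section

variable [h : IsNuclear M]

instance : IsValid M qAssocLeft :=
  valid_of_expr (e := .whiskerRight (.whiskerRight .q .H ⊚ .mul .H) .H ⊚ .mul .H)
    (e' := .assoc .A .H .H ⊚ .whiskerLeft .A (.mul .H) ⊚ .whiskerRight .q .H ⊚ .mul .H)
    h.left (by decide +kernel)

instance : IsValid M qAssocMid :=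
  haveI : IsValid M qAssocMid.rev :=
    valid_of_expr (e := .whiskerLeft .H (.whiskerRight .q .H ⊚ .mul .H) ⊚ .mul .H)
      (e' := .whiskerLeft .H (.whiskerRight .q .H) ⊚ .assocInv .H .H .H ⊚
        .whiskerRight (.mul .H) .H ⊚ .mul .H)
      h.mid (by decide +kernel)
  inferInstanceAs (IsValid M qAssocMid.rev.rev)

end

section

variable [IsHQ M .A] [IsHQ M .H] [IsPairing M] [IsInduced M]

/-- Multiplicativity: τ(ab, R¹)R² = τ(a, R¹₁)τ(b, R¹₂)R², and the axiom for δ(R¹) ⊗ R² splits this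
into q(a)q(b). The coproduct is dual: the axiom for R¹ ⊗ δ(R²) and the reversal in τ(a, hk) combine
to the unreversed q(a₁) ⊗ q(a₂). -/
theorem IsHom.of_isInduced : IsHom M where
  law := {
    one := Expr.eval_eq (e := .one .A ⊚ .q) (e' := .one .H) [qDef, tauOneLeft, rCounitLeft] []
      (by decide +kernel)
    mul := Expr.eval_eq (e := .mul .A ⊚ .q) (e' := .tensor .q .q ⊚ .mul .H)
      [qDef, tauMulLeft, rComulLeft] [qDef, qDef] (by decide +kernel)
    counit := Expr.eval_eq (e := .q ⊚ .counit .H) (e' := .counit .A)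
      [qDef, rCounitRight, tauOneRight] [] (by decide +kernel)
    comul := Expr.eval_eq (e := .q ⊚ .comul .H) (e' := .comul .A ⊚ .tensor .q .q)
      [qDef, rComulRight, tauMulRight] [.one qDef [(0, 4)], qDef] (by decide +kernel) }

/-- Apply τ(a, –) to the first leg of h₂R¹ ⊗ h₁R² = R¹h₁ ⊗ R²h₂ and expand by τ(a, hk) = τ(a₂,
h)τ(a₁, k). -/
instance : IsValid M qTwist :=
  Rule.valid_of_test [qDef, tauMulRight.rev, rComulComm] [qDef, tauMulRight.rev] (by decide +kernel)

end

section

variable [IsHQ M .A] [IsHQ M .H] [IsHom M]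

/-- Morphisms are not assumed to preserve antipodes. Here q(S(a)) = (q(S(a₁))q(a₂))S(q(a₃)) =
q(S(a₁)a₂)S(q(a₃)) = S(q(a)). -/
instance : IsValid M antQ :=
  Rule.valid_of_test [.one (pad .A) [(0, 0)], qCounit.rev, .one (mulMulAnt .H).rev [(3, 5)], qComul,
    mulQ.rev, antConvMid .A, oneQ, oneMul .H] []
    (by decide +kernel)

end

/-! ### Convolution invertibility of the pairing -/

/-- `τ(a₁, h₁)τ(S(a₂), h₂) = ε(a)ε(h)` -/
def tauInv : Rule :=
  ⟨[wire .A 0, wire .H 1], [de .A 0 2 3, de .H 1 4 5, ta 2 4, an .A 3 6, ta 6 5], [],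
    [ep .A 0, ep .H 1], []⟩

/-- `τ(S(a₁), h₁)τ(a₂, h₂) = ε(a)ε(h)` -/
def invTau : Rule :=
  ⟨[wire .A 0, wire .H 1], [de .A 0 2 3, de .H 1 4 5, an .A 2 6, ta 6 4, ta 3 5], [],
    [ep .A 0, ep .H 1], []⟩

/-- `τ(a₁, h₂)τ(a₂, S(h₁)) = ε(a)ε(h)` -/
def tauInvOp : Rule :=
  ⟨[wire .A 0, wire .H 1], [de .A 0 2 3, de .H 1 4 5, ta 2 5, an .H 4 6, ta 3 6], [],
    [ep .A 0, ep .H 1], []⟩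

/-- `τ(a₁, S(h₂))τ(a₂, h₁) = ε(a)ε(h)` -/
def invTauOp : Rule :=
  ⟨[wire .A 0, wire .H 1], [de .A 0 2 3, de .H 1 4 5, an .H 5 6, ta 2 6, ta 3 4], [],
    [ep .A 0, ep .H 1], []⟩

/-- `τ(S(a), S(h)) = τ(a, h)` -/
def tauAnt : Rule :=
  ⟨[wire .A 0, wire .H 1], [an .A 0 2, an .H 1 3, ta 2 3], [], [ta 0 1], []⟩

/-- `τ(S(a₂), h₁)τ(S(S(a₁)), h₂) = ε(a)ε(h)` -/
def tauInvAnt : Rule :=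
  ⟨[wire .A 0, wire .H 1],
    [de .A 0 2 3, de .H 1 4 5, an .A 3 6, ta 6 4, an .A 2 7, an .A 7 8, ta 8 5], [],
    [ep .A 0, ep .H 1], []⟩

/-- `τ(S(S(a₂)), h₁)τ(S(a₁), h₂) = ε(a)ε(h)` -/
def invTauAnt : Rule :=
  ⟨[wire .A 0, wire .H 1],
    [de .A 0 2 3, de .H 1 4 5, an .A 2 6, ta 6 5, an .A 3 7, an .A 7 8, ta 8 4], [],
    [ep .A 0, ep .H 1], []⟩

/-- Cancellation inside combs in both arguments; the remainders a₃ and h₃ are passed on. -/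
def tauInvMid : Rule :=
  ⟨[wire .A 0, wire .H 1],
    [de .A 0 2 7, de .A 7 3 8, de .H 1 4 9, de .H 9 5 10, ta 2 4, an .A 3 6, ta 6 5],
    [wire .A 8, wire .H 10], [], [wire .A 0, wire .H 1]⟩

def invTauMid : Rule :=
  ⟨[wire .A 0, wire .H 1],
    [de .A 0 2 7, de .A 7 3 8, de .H 1 4 9, de .H 9 5 10, an .A 2 6, ta 6 4, ta 3 5],
    [wire .A 8, wire .H 10], [], [wire .A 0, wire .H 1]⟩

def tauInvOpMid : Rule :=
  ⟨[wire .A 0, wire .H 1],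
    [de .A 0 2 7, de .A 7 3 8, de .H 1 4 9, de .H 9 5 10, ta 2 5, an .H 4 6, ta 3 6],
    [wire .A 8, wire .H 10], [], [wire .A 0, wire .H 1]⟩

def invTauOpMid : Rule :=
  ⟨[wire .A 0, wire .H 1],
    [de .A 0 2 7, de .A 7 3 8, de .H 1 4 9, de .H 9 5 10, an .H 5 6, ta 2 6, ta 3 4],
    [wire .A 8, wire .H 10], [], [wire .A 0, wire .H 1]⟩

def tauInvAntMid : Rule :=
  ⟨[wire .A 0, wire .H 1],
    [de .A 0 2 9, de .A 9 3 10, de .H 1 4 11, de .H 11 5 12, an .A 3 6, ta 6 4, an .A 2 7,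
      an .A 7 8, ta 8 5], [wire .A 10, wire .H 12], [], [wire .A 0, wire .H 1]⟩

def invTauAntMid : Rule :=
  ⟨[wire .A 0, wire .H 1],
    [de .A 0 2 9, de .A 9 3 10, de .H 1 4 11, de .H 11 5 12, an .A 2 6, ta 6 5, an .A 3 7,
      an .A 7 8, ta 8 4], [wire .A 10, wire .H 12], [], [wire .A 0, wire .H 1]⟩

/-- Rules that express everything in terms of coproducts of the inputs. -/
def expandRules : List Rule :=
  [mulComul .A, mulComul .H, mulAntipode .A, mulAntipode .H, tauMulLeft, mulComul .H, tauMulRight,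
    mulComul .A, antComul .A, antComul .H, coassoc .A, coassoc .H]

/-- Rules for units and counits. -/
def unitRules (s : Srt) : List Rule :=
  [oneComul s, oneAnt s, oneMul s, mulOne s, mulCounit s, antCounit s, oneCounit s, counitComul s,
    comulCounit s]

/-- Cancellation of the pairing with its inverse. -/
def cancelRules : List Rule :=
  [tauInvMid, invTauMid, tauInvOpMid, invTauOpMid, tauAnt, tauInvAntMid, invTauAntMid]

variable {C : Type u} [Category.{v} C] [MonoidalCategory C] [SymmetricCategory C] {M : Model C}
  [IsHQ M .A] [IsHQ M .H] [IsPairing M]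

instance : AllValid M expandRules := by
  unfold expandRules; infer_instance

instance (s : Srt) [IsHQ M s] : AllValid M (unitRules s) := by
  unfold unitRules; infer_instance

instance : IsValid M tauInv :=
  Rule.valid_of_test [tauMulLeft.rev, convAnt .A, tauOneLeft] [] (by decide +kernel)

instance : IsValid M invTau :=
  Rule.valid_of_test [tauMulLeft.rev, antConv .A, tauOneLeft] [] (by decide +kernel)

/-- As τ reverses products in its second argument, the left-hand side is τ(a, S(h₁)h₂). -/
instance : IsValid M tauInvOp :=
  Rule.valid_of_test [tauMulRight.rev, antConv .H, tauOneRight] [] (by decide +kernel)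

instance : IsValid M invTauOp :=
  Rule.valid_of_test [tauMulRight.rev, convAnt .H, tauOneRight] [] (by decide +kernel)

instance : IsValid M tauInvMid :=
  Rule.valid_of_test [(coassoc .A).rev, (coassoc .H).rev, tauInv, counitComul .A, counitComul .H] []
    (by decide +kernel)

instance : IsValid M invTauMid :=
  Rule.valid_of_test [(coassoc .A).rev, (coassoc .H).rev, invTau, counitComul .A, counitComul .H] []
    (by decide +kernel)

instance : IsValid M tauInvOpMid :=
  Rule.valid_of_test [(coassoc .A).rev, (coassoc .H).rev, tauInvOp, counitComul .A, counitComul .H]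
    [] (by decide +kernel)

instance : IsValid M invTauOpMid :=
  Rule.valid_of_test [(coassoc .A).rev, (coassoc .H).rev, invTauOp, counitComul .A, counitComul .H]
    [] (by decide +kernel)

/-- Both sides are convolution inverses of τ(S(a), h): insert τ(S(a₂), h₂S(h₃)) = ε(a₂)ε(h₂)ε(h₃)
after τ(a₁, h₁), expand, and cancel τ(a₁, h₁)τ(S(a₂), h₂). -/
instance : IsValid M tauAnt :=
  Rule.valid_of_test [] [.one (pad .A) [(0, 0)], .one (pad .H) [(1, 3)], (antCounit .A).rev,
    tauOneRight.rev, (convAnt .H).rev, .norm expandRules 2,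
    tauInvMid] (by decide +kernel)

/-- `tauInv` at S(a), whose coproduct is S(a₂) ⊗ S(a₁). -/
instance : IsValid M tauInvAnt :=
  Rule.valid_of_test [(antComul .A).rev, tauInv, antCounit .A] [] (by decide +kernel)

instance : IsValid M invTauAnt :=
  Rule.valid_of_test [(antComul .A).rev, invTau, antCounit .A] [] (by decide +kernel)

instance : IsValid M tauInvAntMid :=
  Rule.valid_of_test [(coassoc .A).rev, (coassoc .H).rev, tauInvAnt, counitComul .A, counitComul .H]
    [] (by decide +kernel)

instance : IsValid M invTauAntMid :=
  Rule.valid_of_test [(coassoc .A).rev, (coassoc .H).rev, invTauAnt, counitComul .A, counitComul .H]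
    [] (by decide +kernel)

instance : AllValid M cancelRules := by
  unfold cancelRules; infer_instance

/-! ### Expressions for the structures of the main theorem -/

open Ob

/-- Expressions for the structure morphisms of a Hopf quasigroup. -/
structure Data (X : Ob) where
  /-- the unit -/
  one : Expr .unit X
  /-- the product -/
  mul : Expr (.ten X X) X
  /-- the counit -/
  counit : Expr X .unit
  /-- the coproduct -/
  comul : Expr X (.ten X X)
  /-- the antipode -/
  ant : Expr X X

namespace Expr

/-- The inverse of the pairing. -/
def tauInverse : Expr (.ten A H) .unit := .whiskerRight (.ant .A) H ⊚ .tau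

/-- `x ↦ φ(x₁)x₂ψ(x₃)` -/
def sandwich (φ ψ : Expr (.ten A H) .unit) : Expr (.ten A H) (.ten A H) :=
  .tensorComul .A .H ⊚ .tensor φ (.tensorComul .A .H) ⊚ .left (.ten (.ten A H) (.ten A H)) ⊚
    .whiskerLeft (.ten A H) ψ ⊚ .right (.ten A H)

/-- `X ⊗ f ⊗ Y` -/
def mid (X Y : Ob) {P Q P' Q' : Ob} (f : Expr (.ten P Q) (.ten P' Q')) :
    Expr (.ten (.ten X P) (.ten Q Y)) (.ten (.ten X P') (.ten Q' Y)) :=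
  .assoc X P (.ten Q Y) ⊚
    .whiskerLeft X (.assocInv P Q Y ⊚ .whiskerRight f Y ⊚ .assoc P' Q' Y) ⊚
    .assocInv X P' (.ten Q' Y)

/-- The action of `H` on `A`. -/
abbrev act : Expr (.ten H A) A := .gen .act

/-- The action of `H` on `A`, in terms of the other generators. -/
def actionA : Expr (.ten H A) A :=
  .braid H A ⊚ .tensorComul .A .H ⊚ .tensor .tau (.whiskerRight (.comul .A) H) ⊚
    .left (.ten (.ten A A) H) ⊚ .assoc A A H ⊚ .whiskerLeft A .tauInverse ⊚ .right A

/-- The morphism `i`. -/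
def inclA : Expr A (.ten A H) := .comul .A ⊚ .whiskerLeft A (.q ⊚ .ant .H)

/-- Right multiplication on the first factor. -/
def mulPast (X : Ob) : Expr (.ten (.ten H X) H) (.ten H X) :=
  .assoc H X H ⊚ .whiskerLeft H (.braid X H) ⊚ .assocInv H H X ⊚ .whiskerRight (.mul .H) X

/-- The coaction of `H` on `A`. -/
def coact : Expr A (.ten H A) :=
  .inclA ⊚ .whiskerRight (.comul .A) H ⊚ .whiskerRight (.whiskerRight .q A) H ⊚ .mulPast A

/-- The map `Γ`. -/
def coactMap : Expr (.ten A H) (.ten H A) := .whiskerRight .coact H ⊚ .mulPast A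

/-- The map `Ψ`. -/
def actMap : Expr (.ten H A) (.ten A H) :=
  .whiskerRight (.comul .H) A ⊚ .assoc H H A ⊚ .whiskerLeft H (.braid H A) ⊚ .assocInv H A H ⊚
    .whiskerRight .act H

/-- The braiding of Yetter–Drinfeld modules. -/
def ydBraiding : Expr (.ten A A) (.ten A A) :=
  .whiskerRight .coact A ⊚ .assoc H A A ⊚ .whiskerLeft H (.braid A A) ⊚ .assocInv H A A ⊚
    .whiskerRight .act A

/-- The diagonal action. -/
def diagAction : Expr (.ten H (.ten A A)) (.ten A A) :=
  .whiskerRight (.comul .H) (.ten A A) ⊚ .tensorμ H H A A ⊚ .tensor .act .act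

/-- The codiagonal coaction. -/
def codiagCoaction : Expr (.ten A A) (.ten H (.ten A A)) :=
  .tensor .coact .coact ⊚ .tensorμ H A H A ⊚ .whiskerRight (.mul .H) (.ten A A)

/-- The modified product of `A`. -/
abbrev tmul : Expr (.ten A A) A := .gen .tmul

/-- The modified product of `A`, in terms of the other generators. -/
def modifiedMul : Expr (.ten A A) A :=
  .whiskerRight .inclA A ⊚ .assoc A H A ⊚ .whiskerLeft A .act ⊚ .mul .A

/-- The modified antipode of `A`. -/
abbrev tant : Expr A A := .gen .tant

/-- The modified antipode of `A`, in terms of the other generators. -/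
def modifiedAnt : Expr A A := .comul .A ⊚ .tensor .q (.ant .A) ⊚ .act

/-- The isomorphism from the bosonization to the double cross product. -/
def isoW : Expr (.ten A H) (.ten A H) :=
  .whiskerRight .inclA H ⊚ .assoc A H H ⊚ .whiskerLeft A (.mul .H)

/-- The inverse of `isoW`. -/
def isoWInv : Expr (.ten A H) (.ten A H) :=
  .whiskerRight (.comul .A) H ⊚ .whiskerRight (.whiskerLeft A .q) H ⊚ .assoc A H H ⊚
    .whiskerLeft A (.mul .H)

end Expr

namespace Data

variable {X : Ob} (D : Data X)

/-- The coproduct of `X ⊗ X`. -/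
def comul₂ : Expr (.ten X X) (.ten (.ten X X) (.ten X X)) :=
  .tensor D.comul D.comul ⊚ .tensorμ X X X X

/-- The counit of `X ⊗ X`. -/
def counit₂ : Expr (.ten X X) .unit := .tensor D.counit D.counit ⊚ .left .unit

/-- The unit of `X ⊗ X`. -/
def one₂ : Expr .unit (.ten X X) := .leftInv .unit ⊚ .tensor D.one D.one

/-- `S(x₁)(x₂y)` -/
def left₁ : Expr (.ten X X) X :=
  .whiskerRight D.comul X ⊚ .assoc X X X ⊚ .tensor D.ant D.mul ⊚ D.mul

/-- `x₁(S(x₂)y)` -/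
def left₂ : Expr (.ten X X) X :=
  .whiskerRight D.comul X ⊚ .assoc X X X ⊚ .whiskerLeft X (.whiskerRight D.ant X) ⊚
    .whiskerLeft X D.mul ⊚ D.mul

/-- `ε(x)y` -/
def leftCounit : Expr (.ten X X) X := .whiskerRight D.counit X ⊚ .left X

/-- `(yS(x₁))x₂` -/
def right₁ : Expr (.ten X X) X :=
  .whiskerLeft X D.comul ⊚ .assocInv X X X ⊚ .whiskerRight (.whiskerLeft X D.ant) X ⊚
    .whiskerRight D.mul X ⊚ D.mul

/-- `(yx₁)S(x₂)` -/
def right₂ : Expr (.ten X X) X :=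
  .whiskerLeft X D.comul ⊚ .assocInv X X X ⊚ .tensor D.mul D.ant ⊚ D.mul

/-- `yε(x)` -/
def rightCounit : Expr (.ten X X) X := .whiskerLeft X D.counit ⊚ .right X

end Data

/-- The given structure. -/
def baseData (s : Srt) : Data (.atom s) := ⟨.one s, .mul s, .counit s, .comul s, .ant s⟩

/-- The modified structure on `A`. -/
def modifiedData : Data A := ⟨.one .A, .tmul, .counit .A, .comul .A, .tant⟩

/-- The double cross product. -/
def doubleCross : Data (.ten A H) where
  one := .leftInv .unit ⊚ .tensor (.one .A) (.one .H)
  mul := .mid A H (.braid H A ⊚ .sandwich .tau .tauInverse) ⊚ .tensor (.mul .A) (.mul .H)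
  counit := .tensor (.counit .A) (.counit .H) ⊚ .left .unit
  comul := .tensorComul .A .H
  ant := .sandwich .tauInverse .tau ⊚ .tensor (.ant .A) (.ant .H)

/-- The bosonization. -/
def bosonization : Data (.ten A H) where
  one := .leftInv .unit ⊚ .tensor (.one .A) (.one .H)
  mul := .mid A H .actMap ⊚ .tensor .tmul (.mul .H)
  counit := .tensor (.counit .A) (.counit .H) ⊚ .left .unit
  comul := .tensor (.comul .A) (.comul .H) ⊚ .mid A H .coactMap
  ant := .coactMap ⊚ .tensor (.ant .H) .tant ⊚ .actMap

/-! ### Rules for the derived generators -/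

/-- The box of the action. -/
abbrev ac (h a b : ℕ) : Box := ⟨.act, [2 * h + 1, 2 * a], [2 * b]⟩

/-- The box of the modified product. -/
abbrev tm (a b c : ℕ) : Box := ⟨.tmul, [2 * a, 2 * b], [2 * c]⟩

/-- The box of the modified antipode. -/
abbrev tn (a b : ℕ) : Box := ⟨.tant, [2 * a], [2 * b]⟩

/-- `h ▷ a = τ(a₁, h₁)a₂τ(S(a₃), h₂)` -/
def actDef : Rule :=
  ⟨[wire .H 0, wire .A 1], [ac 0 1 2], [wire .A 2],
    [de .H 0 3 4, de .A 1 5 6, de .A 6 2 7, ta 5 3, an .A 7 8, ta 8 4], [wire .A 2]⟩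

/-- The modified product is `a₁(S(q(a₂)) ▷ b)`. -/
def tmulDef : Rule :=
  ⟨[wire .A 0, wire .A 1], [tm 0 1 2], [wire .A 2],
    [de .A 0 3 4, qu 4 5, an .H 5 6, ac 6 1 7, mu .A 3 7 2], [wire .A 2]⟩

/-- The modified antipode is `q(a₁) ▷ S(a₂)`. -/
def tantDef : Rule :=
  ⟨[wire .A 0], [tn 0 1], [wire .A 1], [de .A 0 2 3, qu 2 4, an .A 3 5, ac 4 5 1], [wire .A 1]⟩

variable {C : Type u} [Category.{v} C] [MonoidalCategory C] [SymmetricCategory C] {M : Model C}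

instance : IsValid M actDef :=
  valid_of_expr (e := .act) (e' := .actionA) rfl (by decide +kernel)

instance : IsValid M tmulDef :=
  valid_of_expr (e := .tmul) (e' := .modifiedMul) rfl (by decide +kernel)

instance : IsValid M tantDef :=
  valid_of_expr (e := .tant) (e' := .modifiedAnt) rfl (by decide +kernel)

/-! ### The double cross product -/

/-- Cancellation of the pairing with its inverse, and the antipode identities. -/
def reduceRules : List Rule := cancelRules ++ antipodeRules .A ++ antipodeRules .H

/-- Write the wire `n` of sort `A` as `a₁ε(a₂)`. -/
abbrev padA (n : ℕ) : Instr := .one (pad .A) [(0, 2 * n)]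

/-- Write the wire `n` of sort `H` as `h₁ε(h₂)`. -/
abbrev padH (n : ℕ) : Instr := .one (pad .H) [(1, 2 * n + 1)]

/-- Remove the counits. -/
abbrev tidy : Instr := .norm [comulCounit .A, comulCounit .H] 1

variable {C : Type u} [Category.{v} C] [MonoidalCategory C] [SymmetricCategory C] {M : Model C}
  [IsHQ M .A] [IsHQ M .H] [IsPairing M]

instance : AllValid M reduceRules := by
  unfold reduceRules; infer_instance

theorem isConvolutionInverse : HopfQG.IsConvolutionInverse (M.dat .A) (M.dat .H) M.tau
    (HopfQG.skewPairingInv (M.dat .A) M.tau) where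
  conv_inv := Expr.eval_eq (e := .tensorComul .A .H ⊚ .tensor .tau .tauInverse ⊚ .left .unit)
    (e' := doubleCross.counit) [tauInv] [] (by decide +kernel)
  inv_conv := Expr.eval_eq (e := .tensorComul .A .H ⊚ .tensor .tauInverse .tau ⊚ .left .unit)
    (e' := doubleCross.counit) [invTau] [] (by decide +kernel)

variable (M) in
theorem doubleCross_isUnitalMagma :
    HopfQG.IsUnitalMagma (HopfQG.doubleCross (M.dat .A) (M.dat .H) M.tau) where
  one_mul := Expr.eval_eq (e := .whiskerRight doubleCross.one (.ten .A .H) ⊚ doubleCross.mul)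
    (e' := .left (.ten .A .H))
    [.norm [oneComul .A, oneComul .H, oneAnt .A, oneAnt .H, tauOneLeft, tauOneRight] 1,
      .norm (unitRules .A ++ unitRules .H) 1] [] (by decide +kernel)
  mul_one := Expr.eval_eq (e := .whiskerLeft (.ten .A .H) doubleCross.one ⊚ doubleCross.mul)
    (e' := .right (.ten .A .H))
    [.norm [oneComul .A, oneComul .H, oneAnt .A, oneAnt .H, tauOneLeft, tauOneRight] 1,
      .norm (unitRules .A ++ unitRules .H) 1] [] (by decide +kernel)

variable (M) in
theorem doubleCross_isComonoid :
    HopfQG.IsComonoid (HopfQG.doubleCross (M.dat .A) (M.dat .H) M.tau) where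
  counit_comul := Expr.eval_eq
    (e := doubleCross.comul ⊚ .whiskerRight doubleCross.counit (.ten .A .H))
    (e' := .leftInv (.ten .A .H)) [counitComul .A, counitComul .H] [] (by decide +kernel)
  comul_counit := Expr.eval_eq
    (e := doubleCross.comul ⊚ .whiskerLeft (.ten .A .H) doubleCross.counit)
    (e' := .rightInv (.ten .A .H)) [comulCounit .A, comulCounit .H] [] (by decide +kernel)
  comul_assoc := Expr.eval_eq
    (e := doubleCross.comul ⊚ .whiskerLeft (.ten .A .H) doubleCross.comul)
    (e' := doubleCross.comul ⊚ .whiskerRight doubleCross.comul (.ten .A .H) ⊚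
      .assoc (.ten .A .H) (.ten .A .H) (.ten .A .H))
    [] [coassoc .A, coassoc .H] (by decide +kernel)

variable (M) in
theorem doubleCross_isNonassocBimonoid :
    HopfQG.IsNonassocBimonoid (HopfQG.doubleCross (M.dat .A) (M.dat .H) M.tau) where
  magma := doubleCross_isUnitalMagma M
  comonoid := doubleCross_isComonoid M
  one_counit := Expr.eval_eq (e := doubleCross.one ⊚ doubleCross.counit) (e' := .id .unit)
    [oneCounit .A, oneCounit .H] [] (by decide +kernel)
  mul_counit := Expr.eval_eq (e := doubleCross.mul ⊚ doubleCross.counit) (e' := doubleCross.counit₂)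
    [mulCounit .A, mulCounit .H, .norm [counitComul .A, counitComul .H] 1, tauInv] []
    (by decide +kernel)
  one_comul := Expr.eval_eq (e := doubleCross.one ⊚ doubleCross.comul) (e' := doubleCross.one₂)
    [oneComul .A, oneComul .H] [] (by decide +kernel)
  mul_comul := Expr.eval_eq (e := doubleCross.mul ⊚ doubleCross.comul)
    (e' := doubleCross.comul₂ ⊚ .tensor doubleCross.mul doubleCross.mul)
    [mulComul .A, mulComul .H, .norm [coassoc .A, coassoc .H] 1]
    -- In the product of the coproducts, τ⁻¹ from the first factor meets τ from the second on
    -- consecutive legs of b and h, and they cancel.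
    [.norm [coassoc .A, coassoc .H, invTauMid] 1] (by decide +kernel)

variable (M) in
-- Once all coproducts are pushed to the four padded inputs, pairings cancel with their inverses and
-- elements with their antipodes. Products are never rebracketed: the quasigroup identities have the
-- required brackets.
theorem doubleCross_hasAntipode :
    HopfQG.HasAntipode (HopfQG.doubleCross (M.dat .A) (M.dat .H) M.tau) where
  left₁ := Expr.eval_eq (e := doubleCross.left₁) (e' := doubleCross.leftCounit)
    [padA 0, padH 1, padA 2, padH 3, .norm expandRules 1, .norm reduceRules 2, tidy] []
    (by decide +kernel)
  left₂ := Expr.eval_eq (e := doubleCross.left₂) (e' := doubleCross.leftCounit)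
    -- One pair of τ⁻¹ and τ is left without a remainder once the counits are removed, hence the
    -- final `invTau`.
    [padA 0, padH 1, padA 2, padH 3, .norm expandRules 1, .norm reduceRules 3, tidy, invTau] []
    (by decide +kernel)
  right₁ := Expr.eval_eq (e := doubleCross.right₁) (e' := doubleCross.rightCounit)
    [padA 0, padH 1, padA 2, padH 3, .norm expandRules 1, .norm reduceRules 3, tidy, invTau] []
    (by decide +kernel)
  right₂ := Expr.eval_eq (e := doubleCross.right₂) (e' := doubleCross.rightCounit)
    [padA 0, padH 1, padA 2, padH 3, .norm expandRules 1, .norm reduceRules 2, tidy] []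
    (by decide +kernel)

variable (M) in
theorem doubleCross_isHopfQuasigroup :
    HopfQG.IsHopfQuasigroup (HopfQG.doubleCross (M.dat .A) (M.dat .H) M.tau) :=
  ⟨doubleCross_isNonassocBimonoid M, doubleCross_hasAntipode M⟩

/-! ### Rules for the action and the morphism `q` -/

/-- `1 ▷ a = a` -/
def oneAct : Rule := ⟨[wire .A 0], [eta .H 1, ac 1 0 2], [wire .A 2], [], [wire .A 0]⟩

/-- `h ▷ 1 = ε(h)1` -/
def actOne : Rule :=
  ⟨[wire .H 0], [eta .A 1, ac 0 1 2], [wire .A 2], [ep .H 0, eta .A 1], [wire .A 1]⟩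

/-- `h ▷ (k ▷ a) = hk ▷ a` -/
def actAct : Rule :=
  ⟨[wire .H 0, wire .H 1, wire .A 2], [ac 1 2 3, ac 0 3 4], [wire .A 4], [mu .H 0 1 3, ac 3 2 4],
    [wire .A 4]⟩

/-- `ε(h ▷ a) = ε(h)ε(a)` -/
def actCounit : Rule :=
  ⟨[wire .H 0, wire .A 1], [ac 0 1 2, ep .A 2], [], [ep .H 0, ep .A 1], []⟩

/-- `δ(h ▷ a) = h₁ ▷ a₁ ⊗ h₂ ▷ a₂` -/
def actComul : Rule :=
  ⟨[wire .H 0, wire .A 1], [ac 0 1 2, de .A 2 3 4], [wire .A 3, wire .A 4],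
    [de .H 0 5 6, de .A 1 7 8, ac 5 7 3, ac 6 8 4], [wire .A 3, wire .A 4]⟩

/-- `h ▷ ab = τ(a₁, h₁)a₂(h₂ ▷ b)τ(S(a₃), h₃)` -/
def actMul : Rule :=
  ⟨[wire .H 0, wire .A 1, wire .A 2], [mu .A 1 2 3, ac 0 3 4], [wire .A 4],
    [de .H 0 5 6, de .H 6 7 8, de .A 1 9 10, de .A 10 11 12, ta 9 5, ac 7 2 13, mu .A 11 13 4,
      an .A 12 14, ta 14 8], [wire .A 4]⟩

/-- `h₁S(q(a₂))τ(S(a₁), h₂) = τ(S(a₂), h₁)S(q(a₁))h₂` -/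
def qTwistAnt : Rule :=
  ⟨[wire .A 0, wire .H 1],
    [de .H 1 2 3, de .A 0 4 5, qu 5 8, an .H 8 6, mu .H 2 6 7, an .A 4 9, ta 9 3], [wire .H 7],
    [de .H 1 2 3, de .A 0 4 5, an .A 5 9, ta 9 2, qu 4 8, an .H 8 6, mu .H 6 3 7], [wire .H 7]⟩

/-- The exchange law inside combs; the remainders a₃ and h₃ are passed on. -/
def qTwistMid : Rule :=
  ⟨[wire .A 0, wire .H 1],
    [de .H 1 2 10, de .H 10 3 11, de .A 0 4 12, de .A 12 5 13, qu 4 6, mu .H 2 6 7, ta 5 3],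
    [wire .H 7, wire .A 13, wire .H 11],
    [de .H 1 2 10, de .H 10 3 11, de .A 0 4 12, de .A 12 5 13, ta 4 2, qu 5 6, mu .H 6 3 7],
    [wire .H 7, wire .A 13, wire .H 11]⟩

def qTwistAntMid : Rule :=
  ⟨[wire .A 0, wire .H 1],
    [de .H 1 2 10, de .H 10 3 11, de .A 0 4 12, de .A 12 5 13, qu 5 8, an .H 8 6, mu .H 2 6 7,
      an .A 4 9, ta 9 3], [wire .H 7, wire .A 13, wire .H 11],
    [de .H 1 2 10, de .H 10 3 11, de .A 0 4 12, de .A 12 5 13, an .A 5 9, ta 9 2, qu 4 8, an .H 8 6,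
      mu .H 6 3 7], [wire .H 7, wire .A 13, wire .H 11]⟩

/-- `S(q(b₂))q(a₁)τ(a₂, S(q(b₁))) = τ(a₁, S(q(b₂)))q(a₂)S(q(b₁))` -/
def qTwistQMid : Rule :=
  ⟨[wire .A 0, wire .A 1],
    [de .A 1 2 10, de .A 10 3 11, de .A 0 4 12, de .A 12 5 13, qu 2 14, an .H 14 15, qu 3 16,
      an .H 16 17, qu 4 6, mu .H 17 6 7, ta 5 15], [wire .H 7, wire .A 13, wire .A 11],
    [de .A 1 2 10, de .A 10 3 11, de .A 0 4 12, de .A 12 5 13, qu 2 14, an .H 14 15, qu 3 16,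
      an .H 16 17, ta 4 17, qu 5 6, mu .H 6 15 7], [wire .H 7, wire .A 13, wire .A 11]⟩

/-- `S(q(b₂))S(q(a₂))τ(S(a₁), S(q(b₁))) = τ(S(a₂), S(q(b₂)))S(q(a₁))S(q(b₁))` -/
def qTwistAntQMid : Rule :=
  ⟨[wire .A 0, wire .A 1],
    [de .A 1 2 10, de .A 10 3 11, de .A 0 4 12, de .A 12 5 13, qu 2 14, an .H 14 15, qu 3 16,
      an .H 16 17, qu 5 8, an .H 8 6, mu .H 17 6 7, an .A 4 9, ta 9 15],
    [wire .H 7, wire .A 13, wire .A 11],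
    [de .A 1 2 10, de .A 10 3 11, de .A 0 4 12, de .A 12 5 13, qu 2 14, an .H 14 15, qu 3 16,
      an .H 16 17, an .A 5 9, ta 9 17, qu 4 8, an .H 8 6, mu .H 6 15 7],
    [wire .H 7, wire .A 13, wire .A 11]⟩

/-- `S(q(a₁))(q(a₂)h) = ε(a)h` -/
def antMulQMid : Rule :=
  ⟨[wire .A 0, wire .H 1],
    [de .A 0 2 7, de .A 7 3 8, qu 2 9, an .H 9 4, qu 3 10, mu .H 10 1 5, mu .H 4 5 6],
    [wire .H 6, wire .A 8], [], [wire .H 1, wire .A 0]⟩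

/-- `q(a₁)(S(q(a₂))h) = ε(a)h` -/
def mulAntQMid : Rule :=
  ⟨[wire .A 0, wire .H 1],
    [de .A 0 2 7, de .A 7 3 8, qu 2 9, qu 3 10, an .H 10 4, mu .H 4 1 5, mu .H 9 5 6],
    [wire .H 6, wire .A 8], [], [wire .H 1, wire .A 0]⟩

/-- `(hS(q(a₁)))q(a₂) = ε(a)h` -/
def mulAntMulQMid : Rule :=
  ⟨[wire .A 0, wire .H 1],
    [de .A 0 2 7, de .A 7 3 8, qu 2 9, an .H 9 4, qu 3 10, mu .H 1 4 5, mu .H 5 10 6],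
    [wire .H 6, wire .A 8], [], [wire .H 1, wire .A 0]⟩

/-- `(hq(a₁))S(q(a₂)) = ε(a)h` -/
def mulMulAntQMid : Rule :=
  ⟨[wire .A 0, wire .H 1],
    [de .A 0 2 7, de .A 7 3 8, qu 2 9, qu 3 10, an .H 10 4, mu .H 1 9 5, mu .H 5 4 6],
    [wire .H 6, wire .A 8], [], [wire .H 1, wire .A 0]⟩

/-- `(S(q(a))h)k = S(q(a))(hk)` -/
def antQAssocLeft : Rule :=
  ⟨[wire .A 0, wire .H 1, wire .H 2], [qu 0 6, an .H 6 3, mu .H 3 1 4, mu .H 4 2 5], [wire .H 5],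
    [qu 0 6, an .H 6 3, mu .H 1 2 4, mu .H 3 4 5], [wire .H 5]⟩

/-- `(hS(q(a)))k = h(S(q(a))k)` -/
def antQAssocMid : Rule :=
  ⟨[wire .A 0, wire .H 1, wire .H 2], [qu 0 6, an .H 6 3, mu .H 1 3 4, mu .H 4 2 5], [wire .H 5],
    [qu 0 6, an .H 6 3, mu .H 3 2 4, mu .H 1 4 5], [wire .H 5]⟩

/-- Nuclearity. -/
def assocRules : List Rule := [qAssocLeft, qAssocMid, antQAssocLeft, antQAssocMid]

/-- Cancellation of `q` with its convolution inverse. -/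
def qCancelRules : List Rule := [antMulQMid, mulAntQMid, mulAntMulQMid, mulMulAntQMid]

/-- Rules for units and counits of composite expressions. -/
def allUnitRules : List Rule :=
  [oneComul .A, oneAnt .A, oneQ, oneComul .H, oneAnt .H, oneAct, actOne, tauOneLeft, tauOneRight,
    actCounit, mulCounit .H, antCounit .H, qCounit] ++ unitRules .A ++ unitRules .H

/-- Rules that express everything in terms of coproducts of the inputs. -/
def expandQRules : List Rule :=
  [mulComul .A, actComul, mulComul .H, mulQ, mulAntipode .H, antComul .H, qComul, antComul .A,
    coassoc .A, coassoc .H]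

variable {C : Type u} [Category.{v} C] [MonoidalCategory C] [SymmetricCategory C] {M : Model C}
  [IsHQ M .A] [IsHQ M .H]

section

variable [IsPairing M]

instance : IsValid M oneAct :=
  Rule.valid_of_test [actDef, oneComul .H, .norm (tauOneRight :: unitRules .A) 1] []
    (by decide +kernel)

instance : IsValid M actOne :=
  Rule.valid_of_test [actDef, .norm [oneComul .A, oneAnt .A, tauOneLeft, counitComul .H] 1] []
    (by decide +kernel)

/-- Both τ(–, h) and τ(S(–), h) turn products of H into products of pairings, with the orders needed
for a left action because S reverses coproducts. -/
instance : IsValid M actAct :=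
  Rule.valid_of_test [.norm [actDef] 1, .norm expandRules 1] [actDef, .norm expandRules 1]
    (by decide +kernel)

instance : IsValid M actCounit :=
  Rule.valid_of_test [actDef, counitComul .A, tauInv] [] (by decide +kernel)

/-- On the right, τ⁻¹ of the first factor and τ of the second meet on consecutive legs and cancel.
-/
instance : IsValid M actComul :=
  Rule.valid_of_test [actDef, .norm [coassoc .A] 1]
    [.norm [actDef, coassoc .A, coassoc .H, invTauMid] 1] (by decide +kernel)

/-- The action does not respect the original product of A. This identity measures the failure, which
the modified product corrects. -/
instance : IsValid M actMul :=
  Rule.valid_of_test [actDef, .norm expandRules 1] [actDef, .norm expandRules 1] (by decide +kernel)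

end

section

variable [IsHom M]

instance : IsValid M antMulQMid :=
  Rule.valid_of_test [(coassoc .A).rev, qComul.rev, antMul .H, qCounit, counitComul .A] []
    (by decide +kernel)

instance : IsValid M mulAntQMid :=
  Rule.valid_of_test [(coassoc .A).rev, qComul.rev, mulAnt .H, qCounit, counitComul .A] []
    (by decide +kernel)

instance : IsValid M mulAntMulQMid :=
  Rule.valid_of_test [(coassoc .A).rev, qComul.rev, mulAntMul .H, qCounit, counitComul .A] []
    (by decide +kernel)

instance : IsValid M mulMulAntQMid :=
  Rule.valid_of_test [(coassoc .A).rev, qComul.rev, mulMulAnt .H, qCounit, counitComul .A] []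
    (by decide +kernel)

instance : AllValid M qCancelRules := by
  unfold qCancelRules; infer_instance

instance [IsPairing M] : AllValid M expandQRules := by
  unfold expandQRules; infer_instance

instance [IsPairing M] : AllValid M allUnitRules := by
  unfold allUnitRules; infer_instance

end

section

variable [IsHom M] [IsNuclear M]

/-- S(q(a)) = q(S(a)) again lies in the image of q. -/
instance : IsValid M antQAssocLeft :=
  Rule.valid_of_test [antQ.rev, qAssocLeft, antQ] [] (by decide +kernel)

instance : IsValid M antQAssocMid :=
  Rule.valid_of_test [antQ.rev, qAssocMid, antQ] [] (by decide +kernel)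

instance : AllValid M assocRules := by
  unfold assocRules; infer_instance

end

section

variable [IsPairing M] [IsInduced M]

instance : IsValid M qTwistMid :=
  Rule.valid_of_test [(coassoc .A).rev, (coassoc .H).rev, qTwist, coassoc .A, coassoc .H] []
    (by decide +kernel)

variable [IsHom M]

/-- The exchange law at S(a), using qS = Sq and δ(S(a)) = S(a₂) ⊗ S(a₁). -/
instance : IsValid M qTwistAnt :=
  Rule.valid_of_test [antQ.rev, (antComul .A).rev, qTwist, antComul .A, antQ] [] (by decide +kernel)

instance : IsValid M qTwistAntMid :=
  Rule.valid_of_test [(coassoc .A).rev, (coassoc .H).rev, qTwistAnt, coassoc .A, coassoc .H] []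
    (by decide +kernel)

/-- The exchange law at h = S(q(b)), with δ(h) = S(q(b₂)) ⊗ S(q(b₁)) written out so that it matches
expanded diagrams. -/
instance : IsValid M qTwistQMid :=
  Rule.valid_of_test [.one (coassoc .A).rev [(0, 0)], .one (coassoc .A).rev [(0, 2)], qComul.rev,
    (antComul .H).rev, qTwist, antComul .H, qComul, .norm [coassoc .A] 1] [] (by decide +kernel)

instance : IsValid M qTwistAntQMid :=
  Rule.valid_of_test [.one (coassoc .A).rev [(0, 0)], .one (coassoc .A).rev [(0, 2)], qComul.rev,
    (antComul .H).rev, qTwistAnt, antComul .H, qComul, .norm [coassoc .A] 1] [] (by decide +kernel)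

end

/-! ### Rules for the modified product and antipode -/

/-- `S(S(q(a₃)))τ(S(S(a₂)), q(a₁)) = q(a₁)τ(S(S(a₃)), q(a₂))` -/
def qTwistSq : Rule :=
  ⟨[wire .A 0], [de .A 0 1 2, de .A 2 3 4, qu 1 5, an .A 3 6, an .A 6 7, ta 7 5, qu 4 8, an .H 8 9,
      an .H 9 10], [wire .H 10],
    [de .A 0 1 2, de .A 2 3 4, qu 1 10, qu 3 5, an .A 4 6, an .A 6 7, ta 7 5], [wire .H 10]⟩

def qTwistSqMid : Rule :=
  ⟨[wire .A 0], [de .A 0 1 2, de .A 2 3 11, de .A 11 4 12, qu 1 5, an .A 3 6, an .A 6 7, ta 7 5,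
      qu 4 8, an .H 8 9, an .H 9 10], [wire .H 10, wire .A 12],
    [de .A 0 1 2, de .A 2 3 11, de .A 11 4 12, qu 1 10, qu 3 5, an .A 4 6, an .A 6 7, ta 7 5],
    [wire .H 10, wire .A 12]⟩

/-- For `x = s(a)`: `x₁ ⊗ S(q(x₂)) = τ(b₁, k₁)b₂ ⊗ k₂τ(S(b₃), k₃)`, where `b = S(a₂)` and
`k = q(a₁)`. -/
def inclTant : Rule :=
  ⟨[wire .A 0], [tn 0 1, de .A 1 2 3, qu 3 4, an .H 4 5], [wire .A 2, wire .H 5],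
    [de .A 0 6 7, qu 6 8, an .A 7 9, de .H 8 10 11, de .H 11 5 12, de .A 9 13 14, de .A 14 2 15,
      ta 13 10, an .A 15 16, ta 16 12], [wire .A 2, wire .H 5]⟩

/-- For `x = m(a, b)`: `x₁ ⊗ S(q(x₂)) = τ(b₁, h₁)a₁b₂ ⊗ h₂S(q(b₄))τ(S(b₃), h₃)`, where
`h = S(q(a₂))`. -/
def inclMul : Rule :=
  ⟨[wire .A 0, wire .A 1], [tm 0 1 2, de .A 2 3 4, qu 4 5, an .H 5 6], [wire .A 3, wire .H 6],
    [de .A 0 7 8, qu 8 9, an .H 9 10, de .H 10 11 12, de .H 12 13 14, de .A 1 15 16, de .A 16 17 18,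
      de .A 18 19 20, ta 15 11, mu .A 7 17 3, an .A 19 21, ta 21 14, qu 20 22, an .H 22 23,
      mu .H 13 23 6], [wire .A 3, wire .H 6]⟩

/-- `m(s(a), b) = q(a₁) ▷ S(a₂)b` -/
def tmulTant : Rule :=
  ⟨[wire .A 0, wire .A 1], [tn 0 2, tm 2 1 3], [wire .A 3],
    [de .A 0 4 5, qu 4 6, an .A 5 7, mu .A 7 1 8, ac 6 8 3], [wire .A 3]⟩

variable {C : Type u} [Category.{v} C] [MonoidalCategory C] [SymmetricCategory C] {M : Model C}
  [IsHQ M .A] [IsHQ M .H] [IsPairing M] [IsHom M] [IsInduced M]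

/-- Multiply S²(q(a₃)) by an inserted product (– q(u₁))S(q(u₂)). The exchange law for x = S²(a) and
h = q(a) moves q(a₁) to the far left; then S²(q(·)) and S(q(·)) cancel by (yS(z₁))z₂ = yε(z) with z
= S(q(·)). The pair (6, n) given to the reversed coassociativity selects the node of a comb that
splits off wire n, and regroups n with the next leg. -/
instance : IsValid M qTwistSq :=
  Rule.valid_of_test [.one (pad .A) [(0, 2)], qCounit.rev, .one (mulMulAnt .H).rev [(3, 21)],
    qComul, .norm [antQ.rev, coassoc .A] 1, .one (coassoc .A).rev [(6, 22)], qComul.rev,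
    .norm [(antComul .A).rev] 1, qTwist.rev, .norm [antComul .A, qComul, antQ, coassoc .A] 1,
    .one (coassoc .A).rev [(6, 62)], qComul.rev, (antComul .H).rev, mulAntMul .H, antCounit .H,
    qCounit, counitComul .A] [] (by decide +kernel)

instance : IsValid M qTwistSqMid :=
  Rule.valid_of_test [.one (coassoc .A).rev [(6, 6)], .one (coassoc .A).rev [(6, 2)], qTwistSq,
    .norm [coassoc .A] 1] [] (by decide +kernel)

/-- In A ⋈_τ H this reads i(s(a)) = (1 ⊗ q(a₁))(S(a₂) ⊗ 1). After expansion the two sides differ by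
`qTwistSq`. -/
instance : IsValid M inclTant :=
  Rule.valid_of_test [padA 0, tantDef, actDef, .norm expandQRules 1, antQ, qTwistSqMid]
    [padA 0, .norm expandQRules 1] (by decide +kernel)

/-- In A ⋈_τ H this reads i(m(a, b)) = i(a)i(b): the modified product is the one transported along
i. The exchange law is needed at h = S(q(a)). -/
instance : IsValid M inclMul :=
  Rule.valid_of_test [padA 0, padA 1, tmulDef, actDef, .norm expandQRules 1, qTwistAntQMid.rev]
    [padA 0, padA 1, .norm expandQRules 1] (by decide +kernel)

/-- Insert `inclTant` in m(x, b) = x₁(S(q(x₂)) ▷ b); the result is the expansion of q(a₁) ▷ S(a₂)b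
by `actMul`. -/
instance : IsValid M tmulTant :=
  Rule.valid_of_test [tmulDef, inclTant] [actMul] (by decide +kernel)

/-! ### The modified structure is a Hopf quasigroup of Yetter–Drinfeld modules -/

open Sweedler.Expr Sweedler.Ob

/-- Rules that express iterated coproducts of antipodes in a standard form. -/
def combRules : List Rule := [antComul .A, coassoc .A, coassoc .H]

variable {C : Type u} [Category.{v} C] [MonoidalCategory C] [SymmetricCategory C]

/-- The interpretation of the expressions for the structure morphisms. -/
def Data.hopfData {X : Ob} (D : Data X) (M : Model C) : HopfQG.HopfData (X.ev M.ob) where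
  one := D.one.eval M
  mul := D.mul.eval M
  counit := D.counit.eval M
  comul := D.comul.eval M
  antipode := D.ant.eval M

variable (M : Model C) [IsHQ M .A] [IsHQ M .H] [IsPairing M]

instance : AllValid M combRules := by
  unfold combRules; infer_instance

variable [IsHom M] [IsNuclear M] [IsInduced M]

theorem isYDModule : HopfQG.IsYDModule (M.dat .H) (act.eval M) (coact.eval M) where
  one_act := Expr.eval_eq (e := .whiskerRight (.one .H) A ⊚ act) (e' := .left A) [oneAct] []
    (by decide +kernel)
  act_act := Expr.eval_eq (e := .whiskerLeft H act ⊚ act)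
    (e' := .assocInv H H A ⊚ .whiskerRight (.mul .H) A ⊚ act) [actAct] [] (by decide +kernel)
  counit_coact := Expr.eval_eq (e := coact ⊚ .whiskerRight (.counit .H) A) (e' := .leftInv A)
    [.norm allUnitRules 1] [] (by decide +kernel)
  coact_coact := Expr.eval_eq (e := coact ⊚ .whiskerLeft H coact)
    (e' := coact ⊚ .whiskerRight (.comul .H) A ⊚ .assoc H H A)
    [.norm expandQRules 1] [.norm expandQRules 1] (by decide +kernel)
  compat := Expr.eval_eq
    (e := .whiskerRight (.comul .H) A ⊚ .assoc H H A ⊚ .whiskerLeft H (.braid H A) ⊚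
      .assocInv H A H ⊚ .whiskerRight (act ⊚ coact) H ⊚ mulPast A)
    (e' := .tensor (.comul .H) coact ⊚ tensorμ H H H A ⊚ .tensor (.mul .H) act)
    -- The exchange law is used twice: for S(q(a)) with τ⁻¹ and for q(a) with τ, with a rebracketing
    -- by nuclearity in between.
    [padH 0, padA 1, actDef, .norm combRules 1, .norm assocRules 1, qTwistAntMid.rev,
      qAssocLeft.rev, qTwistMid.rev, qAssocMid]
    [padH 0, padA 1, actDef, .norm combRules 1] (by decide +kernel)
  coact_assoc_left := Expr.eval_eq (e := .tensor coact (.mul .H) ⊚ mulPast A)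
    (e' := .assocInv A H H ⊚ .whiskerRight (.whiskerRight coact H) H ⊚
      .whiskerRight (mulPast A) H ⊚ mulPast A)
    [.norm assocRules 1] [.norm assocRules 1] (by decide +kernel)
  coact_assoc_mid := Expr.eval_eq
    (e := .whiskerLeft H coactMap ⊚ .assocInv H H A ⊚ .whiskerRight (.mul .H) A)
    (e' := .assocInv H A H ⊚ .whiskerRight (.whiskerLeft H coact ⊚ .assocInv H H A ⊚
      .whiskerRight (.mul .H) A) H ⊚ mulPast A)
    -- The coaction has values q(a₁)S(q(a₃)) = q(a₁S(a₃)) in the image of q, so middle nuclearity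
    -- applies to them as a whole.
    [antQ.rev, mulQ.rev] [antQ.rev, mulQ.rev, qAssocMid] (by decide +kernel)

theorem modified_isUnitalMagma : HopfQG.IsUnitalMagma (modifiedData.hopfData M) where
  one_mul := Expr.eval_eq (e := .whiskerRight modifiedData.one A ⊚ modifiedData.mul) (e' := .left A)
    [tmulDef, .norm allUnitRules 1] [] (by decide +kernel)
  mul_one := Expr.eval_eq (e := .whiskerLeft A modifiedData.one ⊚ modifiedData.mul) (e' := .right A)
    [tmulDef, .norm allUnitRules 1] [] (by decide +kernel)

theorem modified_isComonoid : HopfQG.IsComonoid (modifiedData.hopfData M) where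
  counit_comul := Expr.eval_eq (e := modifiedData.comul ⊚ .whiskerRight modifiedData.counit A)
    (e' := .leftInv A) [counitComul .A] [] (by decide +kernel)
  comul_counit := Expr.eval_eq (e := modifiedData.comul ⊚ .whiskerLeft A modifiedData.counit)
    (e' := .rightInv A) [comulCounit .A] [] (by decide +kernel)
  comul_assoc := Expr.eval_eq (e := modifiedData.comul ⊚ .whiskerLeft A modifiedData.comul)
    (e' := modifiedData.comul ⊚ .whiskerRight modifiedData.comul A ⊚ .assoc A A A)
    [] [coassoc .A] (by decide +kernel)

/-- By `tmulTant`, m(s(a₁), m(a₂, b)) = q(a₁) ▷ S(a₂)(a₃(S(q(a₄)) ▷ b)) collapses to q(a₁)S(q(a₂)) ▷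
b, and m(a₁, m(s(a₂), b)) to a₁(S(a₂)b). On the right, `inclMul` rewrites i of the inner product;
everything is then expanded until pairings and antipodes cancel. -/
theorem modified_hasAntipode : HopfQG.HasAntipode (modifiedData.hopfData M) where
  left₁ := Expr.eval_eq (e := modifiedData.left₁) (e' := modifiedData.leftCounit)
    [tmulTant, tmulDef, padA 0, .norm [coassoc .A] 1, .one (coassoc .A).rev [(6, 16)], antMul .A,
      counitComul .A, actAct, (coassoc .A).rev, qComul.rev, convAnt .H, qCounit, oneAct,
      counitComul .A] [] (by decide +kernel)
  left₂ := Expr.eval_eq (e := modifiedData.left₂) (e' := modifiedData.leftCounit)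
    [tmulTant, tmulDef, actAct, padA 0, .norm [coassoc .A] 1, .one (coassoc .A).rev [(6, 26)],
      qComul.rev, antConv .H, oneAct, qCounit, counitComul .A, mulAntMid .A] []
    (by decide +kernel)
  right₁ := Expr.eval_eq (e := modifiedData.right₁) (e' := modifiedData.rightCounit)
    [.one tmulDef [(0, 10)], inclMul, .one (coassoc .A).rev [(6, 44)],
      .one (coassoc .A).rev [(6, 40)], inclTant, actAct.rev, padA 1, padH 15, padH 33,
      .norm [actDef] 1, .norm combRules 1, .norm cancelRules 1, .norm reduceRules 2,
      .norm allUnitRules 1] [] (by decide +kernel)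
  right₂ := Expr.eval_eq (e := modifiedData.right₂) (e' := modifiedData.rightCounit)
    [.one tmulDef [(0, 8)], inclMul, actAct.rev, padA 1, padH 15, tantDef, .one actAct [(1, 57)],
      .norm combRules 1, .one (coassoc .A).rev [(6, 50)], qComul.rev, antConv .H, oneAct, qCounit,
      counitComul .A, actDef, .norm combRules 1, .norm reduceRules 2, .norm allUnitRules 1] []
    (by decide +kernel)

theorem isYDHopfQuasigroup : HopfQG.IsYDHopfQuasigroup (M.dat .H) (act.eval M) (coact.eval M)
    (modifiedData.hopfData M) where
  ydModule := isYDModule M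
  magma := modified_isUnitalMagma M
  act_one := Expr.eval_eq (e := .whiskerLeft H modifiedData.one ⊚ act)
    (e' := .tensor (.counit .H) modifiedData.one ⊚ .left A) [actOne] [] (by decide +kernel)
  act_mul := Expr.eval_eq (e := diagAction ⊚ modifiedData.mul)
    (e' := .whiskerLeft H modifiedData.mul ⊚ act)
    [tmulDef, .norm [actAct] 1, .one actDef [(2, 2)], padH 0, padA 1, .norm expandQRules 1,
      qTwistAntMid.rev]
    [tmulDef, actMul, actAct, padH 0, padA 1, .norm combRules 1] (by decide +kernel)
  coact_one := Expr.eval_eq (e := modifiedData.one ⊚ coact)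
    (e' := .leftInv .unit ⊚ .tensor (.one .H) modifiedData.one) [.norm allUnitRules 1] []
    (by decide +kernel)
  coact_mul := Expr.eval_eq (e := modifiedData.mul ⊚ coact)
    (e' := codiagCoaction ⊚ .whiskerLeft H modifiedData.mul)
    -- The pairings of b with S(q(a)) that come from the action have to pass the factors q(b) and
    -- S(q(b)) of the coaction; hence the two exchange laws at h = S(q(a)).
    [padA 0, padA 1, tmulDef, actDef, .norm expandQRules 1, qTwistAntQMid.rev, .norm assocRules 1,
      antQAssocMid.rev, qTwistQMid.rev, .norm assocRules 1]
    [padA 0, padA 1, tmulDef, actDef, .norm expandQRules 1, .norm assocRules 1] (by decide +kernel)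
  comonoid := modified_isComonoid M
  act_counit := Expr.eval_eq (e := act ⊚ modifiedData.counit)
    (e' := .tensor (.counit .H) modifiedData.counit ⊚ .left .unit) [actCounit] []
    (by decide +kernel)
  act_comul := Expr.eval_eq (e := act ⊚ modifiedData.comul)
    (e' := .whiskerLeft H modifiedData.comul ⊚ diagAction) [actComul] [] (by decide +kernel)
  coact_counit := Expr.eval_eq (e := coact ⊚ .whiskerLeft H modifiedData.counit)
    (e' := modifiedData.counit ⊚ .one .H ⊚ .rightInv H)
    [comulCounit .A, qComul.rev, convAnt .H, qCounit] [] (by decide +kernel)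
  coact_comul := Expr.eval_eq (e := coact ⊚ .whiskerLeft H modifiedData.comul)
    (e' := modifiedData.comul ⊚ codiagCoaction)
    [padA 0, .norm [coassoc .A] 1]
    -- The two coactions multiply to (q(a₁)S(q(a₃)))(q(a₄)S(q(a₆))); after rebracketing, the inner
    -- S(q(a₃)) and q(a₄) cancel.
    [padA 0, .norm [coassoc .A] 1, .norm assocRules 1, .one (coassoc .A).rev [(6, 8)], qComul.rev,
      antMul .H, qCounit, counitComul .A] (by decide +kernel)
  one_counit := Expr.eval_eq (e := modifiedData.one ⊚ modifiedData.counit) (e' := .id .unit)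
    [oneCounit .A] [] (by decide +kernel)
  mul_counit := Expr.eval_eq (e := modifiedData.mul ⊚ modifiedData.counit)
    (e' := modifiedData.counit₂)
    [tmulDef, mulCounit .A, .norm allUnitRules 1] [] (by decide +kernel)
  one_comul := Expr.eval_eq (e := modifiedData.one ⊚ modifiedData.comul) (e' := modifiedData.one₂)
    [oneComul .A] [] (by decide +kernel)
  mul_comul := Expr.eval_eq (e := modifiedData.mul ⊚ modifiedData.comul)
    (e' := .tensor modifiedData.comul modifiedData.comul ⊚ .mid A A ydBraiding ⊚
      .tensor modifiedData.mul modifiedData.mul)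
    [padA 0, tmulDef, .norm expandQRules 1]
    -- The factor S(q(a₂)) of the first product cancels with q(a₃) from the coaction in the
    -- braiding.
    [padA 0, .norm [tmulDef, actAct] 1, .norm expandQRules 1, .one (coassoc .A).rev [(6, 40)],
      qComul.rev, antMul .H, qCounit, counitComul .A] (by decide +kernel)
  hasAntipode := modified_hasAntipode M

/-! ### The isomorphism from the bosonization to the double cross product -/

open Sweedler.Expr Sweedler.Ob

/-- An expression between the antipodes of the bosonization and of the double cross product:
`x ↦ τ(b₁, u₁)b₂ ⊗ u₂τ(S(b₃), u₃)`, where `b = S(a₃)` and `u = S((q(a₁)S(q(a₄)))h)q(a₂)`. -/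
def antBridge : Expr (.ten A H) (.ten A H) :=
  coactMap ⊚ .tensor (.ant .H) (.comul .A ⊚ .tensor .q (.ant .A)) ⊚ .assocInv H H A ⊚
    .whiskerRight (.mul .H) A ⊚ .braid H A ⊚ .sandwich .tau .tauInverse

variable {C : Type u} [Category.{v} C] [MonoidalCategory C] [SymmetricCategory C]
variable (M : Model C) [IsHQ M .A] [IsHQ M .H] [IsPairing M] [IsHom M] [IsNuclear M] [IsInduced M]

/-- The isomorphism `w`. -/
noncomputable def isoW : M.ob .A ⊗ M.ob .H ≅ M.ob .A ⊗ M.ob .H where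
  hom := Expr.isoW.eval M
  inv := Expr.isoWInv.eval M
  hom_inv_id := Expr.eval_eq (e := Expr.isoW ⊚ Expr.isoWInv) (e' := .id (.ten A H))
    -- q(a₂)(S(q(a₃))h) collapses to h; in the other composite it is S(q(a₂))(q(a₃)h).
    [padA 0, .norm [coassoc .A] 1, .norm qCancelRules 1, comulCounit .A] [] (by decide +kernel)
  inv_hom_id := Expr.eval_eq (e := Expr.isoWInv ⊚ Expr.isoW) (e' := .id (.ten A H))
    [padA 0, .norm [coassoc .A] 1, .norm qCancelRules 1, comulCounit .A] [] (by decide +kernel)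

/-- As w(a ⊗ h) = i(a)h and i is multiplicative by `inclMul`, what remains for products is (1 ⊗
h)i(b) = i(h₁ ▷ b)(1 ⊗ h₂), which is the exchange law `qTwistAnt`, and nuclearity for the brackets.
-/
theorem isoW_isHopfQuasigroupHom : HopfQG.IsHopfQuasigroupHom (bosonization.hopfData M)
    (doubleCross.hopfData M) (Expr.isoW.eval M) where
  one := Expr.eval_eq (e := bosonization.one ⊚ Expr.isoW) (e' := doubleCross.one)
    [.norm allUnitRules 1] [] (by decide +kernel)
  mul := Expr.eval_eq (e := bosonization.mul ⊚ Expr.isoW)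
    (e' := .tensor Expr.isoW Expr.isoW ⊚ doubleCross.mul)
    [inclMul, actDef, padA 0, padH 1, padA 2, .norm expandQRules 1, .norm assocRules 1,
      antQAssocLeft.rev, qTwistAntMid.rev, .norm assocRules 1]
    [padA 0, padH 1, padA 2, .norm expandRules 1, .norm expandQRules 1, .norm assocRules 1]
    (by decide +kernel)
  counit := Expr.eval_eq (e := Expr.isoW ⊚ doubleCross.counit) (e' := bosonization.counit)
    [.norm allUnitRules 1] [] (by decide +kernel)
  comul := Expr.eval_eq (e := Expr.isoW ⊚ doubleCross.comul)
    (e' := bosonization.comul ⊚ .tensor Expr.isoW Expr.isoW)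
    [padA 0, .norm expandQRules 1]
    [padA 0, .norm expandQRules 1, .norm assocRules 1, .one (coassoc .A).rev [(6, 32)], qComul.rev,
      antMul .H, qCounit, counitComul .A] (by decide +kernel)

/-- Needed because the antipode of the bosonization is prescribed, so it has to be matched with the
one carried over by w before the laws can be pulled back. -/
theorem bosonization_ant_isoW : bosonization.ant.eval M ≫ Expr.isoW.eval M =
    Expr.isoW.eval M ≫ doubleCross.ant.eval M :=
  (Expr.eval_eq (e := bosonization.ant ⊚ Expr.isoW) (e' := antBridge)
    [actDef, .norm [coassoc .A, coassoc .H] 1, qTwistAnt.rev, .one (coassoc .A).rev [(6, 32)],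
      .one (coassoc .A).rev [(6, 46)], inclTant, .norm combRules 1]
    [.norm [mulComul .H, tauMulRight, antComul .A, coassoc .A, coassoc .H] 1]
    (by decide +kernel)).trans
  (Expr.eval_eq (e := antBridge) (e' := Expr.isoW ⊚ doubleCross.ant)
    -- In the bridge, u = S(h)(S²(q(a₄))q(S(a₁)a₂)) = S(S(q(a₄))h). Now b and u are both antipodes,
    -- and τ(S(x), S(y)) = τ(x, y) turns the pairings into those of the antipode of A ⋈_τ H.
    [.norm [mulAntipode .H, antQ.rev, mulQ.rev, qAssocMid, mulQ, qAssocLeft] 1, mulQ.rev,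
      .norm [coassoc .A] 1, .one (coassoc .A).rev [(6, 12)], antConv .A, oneQ, mulOne .H,
      counitComul .A, .norm [antQ] 1, (mulAntipode .H).rev,
      .norm [antComul .H, antComul .A, tauAnt, coassoc .A, coassoc .H] 1]
    [.norm combRules 1] (by decide +kernel))

/-! ### Transport of Hopf quasigroup structures -/

section

variable (N : Model C)

instance [h : IsIso N.q] : IsIso (Expr.q.eval N) := h

instance {X Y X' Y' : Ob} (e : Expr X Y) (e' : Expr X' Y') [IsIso (e.eval N)]
    [IsIso (e'.eval N)] : IsIso ((Expr.tensor e e').eval N) :=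
  inferInstanceAs (IsIso (e.eval N ⊗ₘ e'.eval N))

instance {X Y : Ob} (Z : Ob) (e : Expr X Y) [IsIso (e.eval N)] :
    IsIso ((Expr.whiskerLeft Z e).eval N) :=
  inferInstanceAs (IsIso (Z.ev N.ob ◁ e.eval N))

instance {X Y : Ob} (Z : Ob) (e : Expr X Y) [IsIso (e.eval N)] :
    IsIso ((Expr.whiskerRight e Z).eval N) :=
  inferInstanceAs (IsIso (e.eval N ▷ Z.ev N.ob))

variable {N}

theorem Expr.eval_eq_of_isIso {X Y Z : Ob} {e e' : Expr X Y} (f : Expr Y Z) [IsIso (f.eval N)]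
    (is is' : List Instr) [ScriptValid N is] [ScriptValid N is']
    (h : compare (inputs X) (e ⊚ f).state (e' ⊚ f).state is is' = true) :
    e.eval N = e'.eval N :=
  (cancel_mono (f.eval N)).1 (Expr.eval_eq is is' h)

variable (N)

/-- Each law, composed with an isomorphism built from q where its target is not the unit object,
becomes the corresponding law on the target of q. -/
theorem isHopfQuasigroup_of_isIso [IsHQ N .H] [IsHom N] [IsIso N.q]
    (h : (N.dat .A).antipode ≫ N.q = N.q ≫ (N.dat .H).antipode) :
    HopfQG.IsHopfQuasigroup (N.dat .A) := by
  have : IsValid N antQ := valid_of_expr (e := .ant .A ⊚ .q) (e' := .q ⊚ .ant .H) h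
    (by decide +kernel)
  refine ⟨⟨⟨?_, ?_⟩, ⟨?_, ?_, ?_⟩, ?_, ?_, ?_, ?_⟩, ⟨?_, ?_, ?_, ?_⟩⟩
  · exact Expr.eval_eq_of_isIso (e := .whiskerRight (.one .A) A ⊚ .mul .A) (e' := .left A) .q
      [mulQ, oneQ, oneMul .H] [] (by decide +kernel)
  · exact Expr.eval_eq_of_isIso (e := .whiskerLeft A (.one .A) ⊚ .mul .A) (e' := .right A) .q
      [mulQ, oneQ, mulOne .H] [] (by decide +kernel)
  · exact Expr.eval_eq_of_isIso (e := .comul .A ⊚ .whiskerRight (.counit .A) A) (e' := .leftInv A)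
      (.whiskerLeft .unit .q) [qCounit.rev, qComul.rev, counitComul .H] [] (by decide +kernel)
  · exact Expr.eval_eq_of_isIso (e := .comul .A ⊚ .whiskerLeft A (.counit .A)) (e' := .rightInv A)
      (.whiskerRight .q .unit) [qCounit.rev, qComul.rev, comulCounit .H] [] (by decide +kernel)
  · exact Expr.eval_eq_of_isIso (e := .comul .A ⊚ .whiskerLeft A (.comul .A))
      (e' := .comul .A ⊚ .whiskerRight (.comul .A) A ⊚ .assoc A A A) (.tensor .q (.tensor .q .q))
      [qComul.rev, qComul.rev] [qComul.rev, qComul.rev, coassoc .H] (by decide +kernel)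
  · exact Expr.eval_eq (e := .one .A ⊚ .counit .A) (e' := .id .unit)
      [qCounit.rev, oneQ, oneCounit .H] [] (by decide +kernel)
  · exact Expr.eval_eq (e := .mul .A ⊚ .counit .A) (e' := (baseData .A).counit₂)
      [qCounit.rev, mulQ, mulCounit .H, qCounit, qCounit] [] (by decide +kernel)
  · exact Expr.eval_eq_of_isIso (e := .one .A ⊚ .comul .A) (e' := (baseData .A).one₂)
      (.tensor .q .q) [qComul.rev, oneQ, oneComul .H] [oneQ, oneQ] (by decide +kernel)
  · exact Expr.eval_eq_of_isIso (e := .mul .A ⊚ .comul .A)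
      (e' := (baseData .A).comul₂ ⊚ .tensor (.mul .A) (.mul .A))
      (.tensor .q .q) [qComul.rev, mulQ, mulComul .H, qComul, qComul] [mulQ, mulQ]
      (by decide +kernel)
  · exact Expr.eval_eq_of_isIso (e := (baseData .A).left₁) (e' := (baseData .A).leftCounit) .q
      [mulQ, mulQ, antQ, qComul.rev, antMul .H, qCounit] [] (by decide +kernel)
  · exact Expr.eval_eq_of_isIso (e := (baseData .A).left₂) (e' := (baseData .A).leftCounit) .q
      [mulQ, mulQ, antQ, qComul.rev, mulAnt .H, qCounit] [] (by decide +kernel)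
  · exact Expr.eval_eq_of_isIso (e := (baseData .A).right₁) (e' := (baseData .A).rightCounit) .q
      [mulQ, mulQ, antQ, qComul.rev, mulAntMul .H, qCounit] [] (by decide +kernel)
  · exact Expr.eval_eq_of_isIso (e := (baseData .A).right₂) (e' := (baseData .A).rightCounit) .q
      [mulQ, mulQ, antQ, qComul.rev, mulMulAnt .H, qCounit] [] (by decide +kernel)

end

/-- Two objects with structure morphisms and a morphism between them, as a model. -/
noncomputable def Model.ofHom {X Y : C} (D : HopfQG.HopfData X) (E : HopfQG.HopfData Y)
    (f : X ⟶ Y) : Model C where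
  ob
    | .A => X
    | .H => Y
  dat
    | .A => D
    | .H => E
  -- `tau` and `R` are placeholders of the right type; no rule about them is used in the transport.
  tau := (D.counit ⊗ₘ E.counit) ≫ (λ_ (𝟙_ C)).hom
  q := f
  R := (λ_ (𝟙_ C)).inv ≫ (E.one ⊗ₘ E.one)

/-- The same engine with other roles: the bosonization plays the part of A, the double cross product
that of H, and w that of q. -/
theorem bosonization_isHopfQuasigroup : HopfQG.IsHopfQuasigroup (bosonization.hopfData M) :=
  let N := Model.ofHom (bosonization.hopfData M) (doubleCross.hopfData M) (Expr.isoW.eval M)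
  have : IsHQ N .H := ⟨doubleCross_isHopfQuasigroup M⟩
  have : IsHom N := ⟨isoW_isHopfQuasigroupHom M⟩
  have : IsIso N.q := (isoW M).isIso_hom
  isHopfQuasigroup_of_isIso N (bosonization_ant_isoW M)

/-! ### The main theorem -/

variable {C : Type u} [Category.{v} C] [MonoidalCategory C]

/-- The model given by two objects with structure morphisms, a pairing, and an element of
`H ⊗ H`. -/
noncomputable def Model.ofPairing {A H : C} (𝓐 : HopfQG.HopfData A) (𝓗 : HopfQG.HopfData H)
    (τ : A ⊗ H ⟶ 𝟙_ C) (R : 𝟙_ C ⟶ H ⊗ H) : Model C where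
  ob
    | .A => A
    | .H => H
  dat
    | .A => 𝓐
    | .H => 𝓗
  tau := τ
  q := HopfQG.pairingR τ R
  R := R

end Sweedler

theorem mainTheorem7 {C : Type u} [Category.{v} C] [MonoidalCategory C] [SymmetricCategory C]
    {A H : C} (𝓐 : HopfQG.HopfData A) (𝓗 : HopfQG.HopfData H)
    (hA : HopfQG.IsHopfQuasigroup 𝓐) (hH : HopfQG.IsHopfQuasigroup 𝓗)
    (τ : A ⊗ H ⟶ 𝟙_ C) (hτ : HopfQG.IsSkewPairing 𝓐 𝓗 τ)
    (R : 𝟙_ C ⟶ H ⊗ H) (hR : HopfQG.IsQuasitriangular 𝓗 R)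
    (hrt1 : (HopfQG.projG 𝓗 τ R ▷ H) ≫ 𝓗.mul =
      (α_ A H H).hom ≫ (A ◁ 𝓗.mul) ≫ HopfQG.projG 𝓗 τ R)
    (hrt2 : (H ◁ HopfQG.projG 𝓗 τ R) ≫ 𝓗.mul =
      (H ◁ (HopfQG.pairingR τ R ▷ H)) ≫ (α_ H H H).inv ≫ (𝓗.mul ▷ H) ≫ 𝓗.mul) :
    HopfQG.IsConvolutionInverse 𝓐 𝓗 τ (HopfQG.skewPairingInv 𝓐 τ) ∧
    HopfQG.IsHopfQuasigroup (HopfQG.doubleCross 𝓐 𝓗 τ) ∧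
    HopfQG.IsYDHopfQuasigroup 𝓗 (HopfQG.actionA 𝓐 𝓗 τ) (HopfQG.coactionA 𝓐 𝓗 τ R)
      (HopfQG.modifiedA 𝓐 𝓗 τ R) ∧
    HopfQG.IsHopfQuasigroup (HopfQG.bosonization 𝓗 (HopfQG.actionA 𝓐 𝓗 τ)
      (HopfQG.coactionA 𝓐 𝓗 τ R) (HopfQG.modifiedA 𝓐 𝓗 τ R)) ∧
    ∃ e : A ⊗ H ≅ A ⊗ H, e.hom = HopfQG.isoW 𝓐 𝓗 τ R ∧
      HopfQG.IsHopfQuasigroupHom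
        (HopfQG.bosonization 𝓗 (HopfQG.actionA 𝓐 𝓗 τ) (HopfQG.coactionA 𝓐 𝓗 τ R)
          (HopfQG.modifiedA 𝓐 𝓗 τ R))
        (HopfQG.doubleCross 𝓐 𝓗 τ) e.hom := by
  let M := Sweedler.Model.ofPairing 𝓐 𝓗 τ R
  have : Sweedler.IsHQ M .A := ⟨hA⟩
  have : Sweedler.IsHQ M .H := ⟨hH⟩
  have : Sweedler.IsPairing M := ⟨hτ⟩
  have : Sweedler.IsInduced M := ⟨hR, rfl⟩
  have : Sweedler.IsHom M := Sweedler.IsHom.of_isInduced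
  -- `projG` unfolds to multiplication by q from the left, so the hypotheses are the two nuclearity
  -- conditions by definition. In the same way the evaluated expressions below unfold to the
  -- structures of the statement.
  have : Sweedler.IsNuclear M := ⟨hrt1, hrt2⟩
  exact ⟨Sweedler.isConvolutionInverse (M := M), Sweedler.doubleCross_isHopfQuasigroup M,
    Sweedler.isYDHopfQuasigroup M, Sweedler.bosonization_isHopfQuasigroup M, Sweedler.isoW M, rfl,
    Sweedler.isoW_isHopfQuasigroupHom M⟩
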